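/- Let $M$ be a connected smooth manifold (Hausdorff, second countable) of even dimension $n=p+q\ge 3$, and let $c$ be a conformal class of smooth semi-Riemannian metrics of signature $(p,q)$ on $M$ (that is, $c=\{e^{2\sigma}g : \sigma\in C^\infty(M)\}$). Let $(\mathcal T,h,\nabla^{nc})$ be the standard tractor bundle of $(M,c)$ with its tractor metric and normal conformal tractor connection. In the splitting $\mathcal T\cong\underline{\mathbb R}\oplus TM\oplus\underline{\mathbb R}$ given by any $g\in c$, with elements written $(\alpha,Y,\beta)=\alpha s_-+Y+\beta s_+$, these are $$h\big((\alpha_1,Y_1,\beta_1),(\alpha_2,Y_2,\beta_2)\big)=\alpha_1\beta_2+\alpha_2\beta_1+g(Y_1,Y_2),$$ $$\nabla^{nc}_X(\alpha,Y,\beta)=\big(X(\alpha)-\mathsf P(X,Y),\ \nabla^g_XY+\alpha X+\beta\,\mathsf P(X),\ X(\beta)-g(X,Y)\big),$$ where $\nabla^g$ is the Levi-Civita connection and $\mathsf P=\frac1{n-2}\big(\mathrm{Ric}^g-\frac{\mathrm{scal}^g}{2(n-1)}g\big)$ is the Schouten tensor of $g$, regarded also as an endomorphism of $TM$. Let $\mathcal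 I=\mathbb R s_-$ be the distinguished null line, with orthogonal complement $\mathcal I^\perp$ with respect to $h$. For $x\in M$ let $\mathrm{Hol}^0_x(M,c)$ be the restricted holonomy group (the identity component of the holonomy group) of $\nabla^{nc}$ at $x$, consisting of the parallel transports along null-homotopic piecewise smooth loops at $x$, and let $\mathfrak{hol}_x(M,c)\subset\mathfrak{so}(\mathcal T_x,h_x)$ be its Lie algebra. The conformal holonomy distribution is $$\mathcal E_x=\{\mathrm{pr}_{T_xM}(A\tau) : \tau\in\mathcal T_x,\ A\in\mathfrak{hol}_x(M,c),\ A\,\mathcal I=0,\ h(A\,\mathcal I^\perp,\mathcal I^\perp)=0\}\subset T_xM,$$ a linear subspace of $T_xM$ that does not depend on the choice of $g\in c$, and $r^{\mathcal E}(x)=\dim\mathcal E_x$. Let $\mathcal N\subset\mathbb R^{p+1,q+1}$ be the light cone of nonzero null vectors. A linear isometry $\mathbb R^{p+1,q+1}\to(\mathcal T_x,h_x)$ makes $\mathrm{Hol}^0_x(M,c)$ act on $\mathcal N$; since $M$ is connected, this action is independent of $x$ and of the isometry up to conjugation. Then at least one of the following holds: 1. there is an open dense subset of $M$ on which $r^{\mathcal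 E}\le 1$; or 2. $\mathrm{Hol}^0(M,c)$ acts on the light cone $\mathcal N\subset\mathbb R^{p+1,q+1}$ with an open orbit, i.e. for every $x\in M$ and every linear isometry $\mathbb R^{p+1,q+1}\to\mathcal T_x$ some orbit of $\mathrm{Hol}^0_x(M,c)$ in $\mathcal N$ is open in $\mathcal N$. -/

import Mathlib

open Set Topology Manifold ContDiff

noncomputable section

namespace ConfHol

/-! ### Semi-Riemannian geometry in coordinates

`G` is a field of symmetric nondegenerate bilinear forms on (an open subset of) `ℝⁿ`. -/

/-- Coordinate space `ℝⁿ`. -/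
abbrev E (n : ℕ) : Type := EuclideanSpace ℝ (Fin n)

/-- Bilinear forms on `ℝⁿ`. -/
abbrev Bil (n : ℕ) : Type := E n →L[ℝ] E n →L[ℝ] ℝ

/-- The `i`-th coordinate vector `∂ᵢ`. -/
def ebasis {n : ℕ} (i : Fin n) : E n := EuclideanSpace.single i 1

/-- The vector `θ♯` with `G(θ♯, ·) = θ`. -/
def sharp {n : ℕ} (G : E n → Bil n) (y : E n) (θ : E n →L[ℝ] ℝ) : E n :=
  (G y).inverse θ

/-- The Levi-Civita Christoffel symbol `Γ(u, v)`, determined by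
`2 G(Γ(u, v), w) = (∂ᵤ G)(v, w) + (∂ᵥ G)(u, w) - (∂_w G)(u, v)`. -/
def christoffel {n : ℕ} (G : E n → Bil n) (y u v : E n) : E n :=
  sharp G y ((1 / 2 : ℝ) •
    (fderiv ℝ G y u v + fderiv ℝ G y v u - ((fderiv ℝ G y).flip u).flip v))

/-- The curvature `R(u, v) w = [∇ᵤ, ∇ᵥ] w` on coordinate vector fields. -/
def curvature {n : ℕ} (G : E n → Bil n) (y u v w : E n) : E n :=
  fderiv ℝ (fun z => christoffel G z v w) y u - fderiv ℝ (fun z => christoffel G z u w) y v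
    + christoffel G y u (christoffel G y v w) - christoffel G y v (christoffel G y u w)

/-- `Ric(v, w) = tr (u ↦ R(u, v) w)`. -/
def ricci {n : ℕ} (G : E n → Bil n) (y v w : E n) : ℝ :=
  ∑ i : Fin n, curvature G y (ebasis i) v w i

/-- The scalar curvature `tr_G Ric`. -/
def scalarCurv {n : ℕ} (G : E n → Bil n) (y : E n) : ℝ :=
  ∑ i : Fin n, ricci G y (sharp G y (EuclideanSpace.proj i)) (ebasis i)

/-- The Schouten tensor `P = (Ric - scal / (2 (n - 1)) G) / (n - 2)`. -/
def schouten {n : ℕ} (G : E n → Bil n) (y v w : E n) : ℝ :=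
  (1 / ((n : ℝ) - 2)) * (ricci G y v w - scalarCurv G y / (2 * ((n : ℝ) - 1)) * G y v w)

/-- The Schouten tensor as an endomorphism: `G(P(v), w) = P(v, w)`. -/
def schoutenEnd {n : ℕ} (G : E n → Bil n) (y v : E n) : E n :=
  ∑ i : Fin n, schouten G y v (ebasis i) • sharp G y (EuclideanSpace.proj i)

/-! ### Metrics and conformal structures on a manifold -/

/-- A smooth semi-Riemannian metric of signature `(p, q)` (`p` negative and `q` positive
directions, so that `p + q = n`) on an `n`-dimensional manifold. -/
structure Metric (n p q : ℕ) (M : Type*) [TopologicalSpace M] [ChartedSpace (E n) M]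
    [IsManifold (𝓡 n) ∞ M] where
  val : ∀ x : M, TangentSpace (𝓡 n) x →L[ℝ] TangentSpace (𝓡 n) x →L[ℝ] ℝ
  smooth : ContMDiff (𝓡 n) ((𝓡 n).prod 𝓘(ℝ, Bil n)) ∞
    (fun x => Bundle.TotalSpace.mk' (Bil n)
      (E := fun x : M => TangentSpace (𝓡 n) x →L[ℝ] TangentSpace (𝓡 n) x →L[ℝ] ℝ) x (val x))
  symm : ∀ (x : M) (v w : TangentSpace (𝓡 n) x), val x v w = val x w v
  signature : ∀ x : M, ∃ b : Module.Basis (Fin p ⊕ Fin q) ℝ (TangentSpace (𝓡 n) x),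
    ∀ i j, val x (b i) (b j) =
      if i = j then Sum.elim (fun _ => (-1 : ℝ)) (fun _ => 1) i else 0

/-- Conformal equivalence `g' = e^{2σ} g` with `σ` smooth. -/
def ConformallyEquivalent {n p q : ℕ} {M : Type*} [TopologicalSpace M] [ChartedSpace (E n) M]
    [IsManifold (𝓡 n) ∞ M] (g g' : Metric n p q M) : Prop :=
  ∃ σ : M → ℝ, ContMDiff (𝓡 n) 𝓘(ℝ, ℝ) ∞ σ ∧
    ∀ (x : M) (v w : TangentSpace (𝓡 n) x), g'.val x v w = Real.exp (2 * σ x) * g.val x v w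

/-- Conformal equivalence is an equivalence relation. -/
def conformalSetoid (n p q : ℕ) (M : Type*) [TopologicalSpace M] [ChartedSpace (E n) M]
    [IsManifold (𝓡 n) ∞ M] : Setoid (Metric n p q M) where
  r := ConformallyEquivalent
  iseqv :=
    { refl := fun g => ⟨fun _ => 0, contMDiff_const, by simp⟩
      symm := by
        rintro g g' ⟨σ, hσ, h⟩
        refine ⟨fun x => -σ x, hσ.neg, fun x v w => ?_⟩
        rw [h, ← mul_assoc, ← Real.exp_add]
        simp
      trans := by
        rintro g g' g'' ⟨σ, hσ, h⟩ ⟨σ', hσ', h'⟩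
        refine ⟨fun x => σ' x + σ x, hσ'.add hσ, fun x v w => ?_⟩
        rw [h', h, ← mul_assoc, ← Real.exp_add, mul_add] }

/-- A conformal structure of signature `(p, q)`: a conformal class `c = [g]` of metrics. -/
def ConformalStructure (n p q : ℕ) (M : Type*) [TopologicalSpace M] [ChartedSpace (E n) M]
    [IsManifold (𝓡 n) ∞ M] : Type _ :=
  Quotient (conformalSetoid n p q M)

/-- `g ∈ c`. -/
instance {n p q : ℕ} {M : Type*} [TopologicalSpace M] [ChartedSpace (E n) M]
    [IsManifold (𝓡 n) ∞ M] : Membership (Metric n p q M) (ConformalStructure n p q M) where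
  mem c g := Quotient.mk (conformalSetoid n p q M) g = c

section Manifold

variable {n p q : ℕ} {M : Type*} [TopologicalSpace M] [ChartedSpace (E n) M]
  [IsManifold (𝓡 n) ∞ M]

/-- The components of `g` in the chart of `M` centred at `x₀`. -/
def coordMetric (g : Metric n p q M) (x₀ : M) (y : E n) : Bil n :=
  let B : Bil n := g.val ((extChartAt (𝓡 n) x₀).symm y)
  let D : E n →L[ℝ] E n := mfderiv 𝓘(ℝ, E n) (𝓡 n) (extChartAt (𝓡 n) x₀).symm y
  B.bilinearComp D D

/-! ### The standard tractor bundle in the splitting given by `g ∈ c` -/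

/-- The fibre of the standard tractor bundle: under the splitting `𝒯 ≅ ℝ ⊕ TM ⊕ ℝ` given by
`g ∈ c`, a tractor at `x` is `α s₋ + Y + β s₊ = (α, Y, β)` with `Y ∈ T_x M`. (As a type,
`TangentSpace (𝓡 n) x` is `E n`, read in the chart centred at `x`.) -/
abbrev Tractor (n : ℕ) : Type := ℝ × E n × ℝ

/-- The tractor metric `h` at `x`. -/
def tractorMetric (g : Metric n p q M) (x : M) (τ τ' : Tractor n) : ℝ :=
  τ.1 * τ'.2.2 + τ'.1 * τ.2.2 + g.val x τ.2.1 τ'.2.1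

/-- The tractor `s₋`, which spans the distinguished null line `ℐ`. -/
def sMinus (n : ℕ) : Tractor n := (1, 0, 0)

/-- The tractor field `τ = (α, Y, β)` along the curve `γ` satisfies `∇^{nc}_{γ'} τ = 0` at time `t`,
where
`∇^{nc}_X (α, Y, β) = (X(α) - P(X, Y), ∇_X Y + α X + β P(X), X(β) - g(X, Y))`
is the normal conformal tractor connection in the splitting given by `g`.
Everything is computed in the chart centred at `γ t`, where `∇_{γ'} Y = Y' + Γ(γ', Y)`. -/
structure IsParallelAt (g : Metric n p q M) (γ : ℝ → M) (τ : ℝ → Tractor n) (t : ℝ) : Prop where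
  top : HasDerivAt (fun s => (τ s).1)
    (schouten (coordMetric g (γ t)) (extChartAt (𝓡 n) (γ t) (γ t))
      (deriv (fun s => extChartAt (𝓡 n) (γ t) (γ s)) t) (τ t).2.1) t
  mid : HasDerivAt (fun s => (mfderiv (𝓡 n) 𝓘(ℝ, E n) (extChartAt (𝓡 n) (γ t)) (γ s) (τ s).2.1 : E n))
    (-(christoffel (coordMetric g (γ t)) (extChartAt (𝓡 n) (γ t) (γ t))
        (deriv (fun s => extChartAt (𝓡 n) (γ t) (γ s)) t) (τ t).2.1)
      - (τ t).1 • deriv (fun s => extChartAt (𝓡 n) (γ t) (γ s)) t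
      - (τ t).2.2 • schoutenEnd (coordMetric g (γ t)) (extChartAt (𝓡 n) (γ t) (γ t))
        (deriv (fun s => extChartAt (𝓡 n) (γ t) (γ s)) t)) t
  bot : HasDerivAt (fun s => (τ s).2.2)
    (coordMetric g (γ t) (extChartAt (𝓡 n) (γ t) (γ t))
      (deriv (fun s => extChartAt (𝓡 n) (γ t) (γ s)) t) (τ t).2.1) t

/-- `γ : [0, 1] → M` is piecewise smooth: for some finite set `F` of times, `γ` is smooth (up to
the end points) on each closed interval without points of `F` in its interior. -/
def IsPiecewiseSmooth (γ : ℝ → M) : Prop :=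
  ∃ F : Finset ℝ, ∀ a b : ℝ, 0 ≤ a → a < b → b ≤ 1 → (∀ t ∈ F, t ∉ Ioo a b) →
    ContMDiffOn 𝓘(ℝ, ℝ) (𝓡 n) ∞ γ (Icc a b)

/-- `τ` is a parallel tractor field along the piecewise smooth curve `γ : [0, 1] → M`: it is
continuous, and `∇^{nc}_{γ'} τ = 0` except at finitely many times. -/
def IsParallelAlong (g : Metric n p q M) (γ : ℝ → M) (τ : ℝ → Tractor n) : Prop :=
  ContinuousOn (fun t => (τ t).1) (Icc 0 1) ∧
  ContinuousOn (fun t => (Bundle.TotalSpace.mk (γ t) (τ t).2.1 : TangentBundle (𝓡 n) M))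
    (Icc 0 1) ∧
  ContinuousOn (fun t => (τ t).2.2) (Icc 0 1) ∧
  ∃ F : Finset ℝ, ∀ t ∈ Ioo (0 : ℝ) 1, t ∉ F → IsParallelAt g γ τ t

/-- The restricted conformal holonomy group `Hol⁰_x(M, c)`, i.e. the identity component of the
holonomy group: the parallel transports of `∇^{nc}` along the null-homotopic piecewise smooth
loops at `x`. -/
def holonomy0 (g : Metric n p q M) (x : M) : Set (Tractor n →L[ℝ] Tractor n) :=
  {A | ∃ γ : Path x x, IsPiecewiseSmooth (n := n) γ.extend ∧ γ.Homotopic (Path.refl x) ∧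
    ∀ v : Tractor n, ∃ τ : ℝ → Tractor n,
      IsParallelAlong g γ.extend τ ∧ τ 0 = v ∧ τ 1 = A v}

/-- The conformal holonomy algebra `𝔥𝔬𝔩_x(M, c)`, the Lie algebra of the holonomy group: the
tangent vectors at the identity of the smooth curves in `Hol⁰_x(M, c)`. (They form a vector
space.) -/
def holAlg (g : Metric n p q M) (x : M) : Submodule ℝ (Tractor n →L[ℝ] Tractor n) :=
  Submodule.span ℝ {A | ∃ c : ℝ → (Tractor n →L[ℝ] Tractor n), ContDiff ℝ ∞ c ∧
    (∀ t, c t ∈ holonomy0 g x) ∧ c 0 = ContinuousLinearMap.id ℝ (Tractor n) ∧ HasDerivAt c A 0}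

/-- The conformal holonomy distribution at `x`: the subspace `ℰ_x` of the `pr_{TM} (A τ)`,
for tractors `τ` and those `A ∈ 𝔥𝔬𝔩_x(M, c)` with `A ℐ = 0` and `h(A ℐ^⊥, ℐ^⊥) = 0`. -/
def holDistribution (g : Metric n p q M) (x : M) : Submodule ℝ (TangentSpace (𝓡 n) x) :=
  Submodule.span ℝ {X | ∃ A ∈ holAlg g x, A (sMinus n) = 0 ∧
    (∀ τ τ' : Tractor n, tractorMetric g x (sMinus n) τ = 0 →
      tractorMetric g x (sMinus n) τ' = 0 → tractorMetric g x (A τ) τ' = 0) ∧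
    ∃ τ : Tractor n, X = (A τ).2.1}

/-- The function `r^ℰ(x) = dim ℰ_x`. -/
def rankE (g : Metric n p q M) (x : M) : ℕ := Module.finrank ℝ (holDistribution g x)

/-! ### The action on the null cone -/

/-- The vector space underlying `ℝ^{p+1,q+1}`. -/
abbrev PseudoSpace (p q : ℕ) : Type := Fin (p + 1) ⊕ Fin (q + 1) → ℝ

/-- The scalar product of `ℝ^{p+1,q+1}`. -/
def pseudoInner {p q : ℕ} (v w : PseudoSpace p q) : ℝ :=
  -(∑ i, v (Sum.inl i) * w (Sum.inl i)) + ∑ j, v (Sum.inr j) * w (Sum.inr j)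

/-- The light cone `𝒩 ⊂ ℝ^{p+1,q+1}` of nonzero null vectors. -/
def nullCone (p q : ℕ) : Set (PseudoSpace p q) := {v | v ≠ 0 ∧ pseudoInner v v = 0}

/-- Linear isometries `ℝ^{p+1,q+1} → (𝒯_x, h)`. -/
def IsTractorFrame (g : Metric n p q M) (x : M) (ψ : PseudoSpace p q ≃ₗ[ℝ] Tractor n) : Prop :=
  ∀ v w, tractorMetric g x (ψ v) (ψ w) = pseudoInner v w

/-- `Hol⁰(M, c)` acts on `𝒩 ⊂ ℝ^{p+1,q+1}` with an open orbit, where it acts on `ℝ^{p+1,q+1}`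
after the choice of a base point `x` and of a linear isometry `ℝ^{p+1,q+1} → 𝒯_x`; the assertion
is made for every choice (of which there is at least one at every `x`). -/
def HasOpenOrbit (g : Metric n p q M) : Prop :=
  ∀ x : M, (∃ ψ : PseudoSpace p q ≃ₗ[ℝ] Tractor n, IsTractorFrame g x ψ) ∧
    ∀ ψ : PseudoSpace p q ≃ₗ[ℝ] Tractor n, IsTractorFrame g x ψ →
      ∃ v ∈ nullCone p q,
        IsOpen {w : nullCone p q | ∃ A ∈ holonomy0 g x, ψ.symm (A (ψ v)) = (w : PseudoSpace p q)}

end Manifold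

end ConfHol

end

noncomputable section

namespace ConfHol

set_option maxSynthPendingDepth 3
set_option linter.unusedSectionVars false

/-! If the first alternative fails, some nonempty open `W` has a dense set of points where `ℰ` is
nonzero; fix `x₀ ∈ W`. A nonzero vector of `ℰ_y` comes from an element of `𝔥𝔬𝔩_y` of the form `s₋ ∧
w` with `w ∈ T_yM` nonzero (`eq_wedge_of_skew`). Parallel transport `P` from `x₀` to `y` conjugates
it into `f ∧ k ∈ 𝔥𝔬𝔩_{x₀}`, where `f = P⁻¹ s₋` is null and `k ⊥ f` is not a multiple of `f`. Since
`∇_X s₋ = X`, the map sending `y` to the line of `f` has invertible derivative at `x₀` into the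
space of null lines (`exists_local_transport`). Hence `𝔥𝔬𝔩_{x₀}` contains such a wedge for a dense
set of null lines in an open set (`exists_open_forall_wedge_mem_holAlg`).

The rest at `x₀` is linear algebra. Membership in `𝔥𝔬𝔩_{x₀}` is a kernel condition on the tangent
vector, so near a point of minimal kernel dimension it has a continuous nonzero solution
(`exists_continuous_kernel_section`). Let `v_t`, with tangent vectors `w_t`, be the null vectors
over the line `y + tX`. Apply `v_t ∧ w_t` to `v = v_0`: the pairing `h(w_t, v)` has order `t` and
`h(v_t, v)` has order `t²`. Dividing by `t` and letting `t → 0` gives `v ∈ 𝔥𝔬𝔩 · v`. Subtracting a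
multiple of `v` and dividing by `t` again gives, up to tangent coordinates, `b(X, w) X - ½ b(X, X)
w`. For `n ≥ 3` these vectors span everything (`eq_top_of_forall_quadratic_mem`), so `𝔥𝔬𝔩 · v =
v^⊥`, the tangent space of the light cone at `v` (`exists_nullVec_orbit_tangent`).

A product of curves in the holonomy group then acts submersively at `v`, which makes the orbit open
(`eventually_mem_orbit`). Parallel transport spreads this over the connected manifold
(`hasOpenNullOrbit_of_exists`).

The analytic input is that tractor parallelism does not depend on the chart
(`isParallelAt_of_chart`), that transport is isometric (`IsTransport.isometry`), and that transport
along short segments is strictly differentiable in the segment (`exists_fundamental_family`). -/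

/-- `G` is a smooth semi-Riemannian metric on the open set `s`. -/
structure IsMetricOn {n : ℕ} (G : E n → Bil n) (s : Set (E n)) : Prop where
  isOpen : IsOpen s
  smooth : ContDiffOn ℝ ∞ G s
  symm : ∀ y ∈ s, ∀ u v, G y u v = G y v u
  nondeg : ∀ y ∈ s, (G y).IsInvertible

/-! ### Levi-Civita connection and curvature in coordinates. -/

section Christoffel

variable {n : ℕ} {G : E n → Bil n} {s : Set (E n)} {y : E n}

theorem sharp_spec (h : IsMetricOn G s) (hy : y ∈ s) (θ : E n →L[ℝ] ℝ) :
    G y (sharp G y θ) = θ :=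
  (h.nondeg y hy).self_apply_inverse θ

theorem sharp_eq_of (h : IsMetricOn G s) (hy : y ∈ s) {θ : E n →L[ℝ] ℝ} {a : E n}
    (ha : ∀ w, G y a w = θ w) : a = sharp G y θ := by
  apply (h.nondeg y hy).injective
  rw [sharp_spec h hy]
  ext w
  exact ha w

theorem IsMetricOn.ext (h : IsMetricOn G s) (hy : y ∈ s) {a b : E n}
    (hab : ∀ w, G y a w = G y b w) : a = b :=
  (h.nondeg y hy).injective (ContinuousLinearMap.ext hab)

theorem IsMetricOn.differentiableAt (h : IsMetricOn G s) (hy : y ∈ s) :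
    DifferentiableAt ℝ G y :=
  (h.smooth.contDiffAt (h.isOpen.mem_nhds hy)).differentiableAt (by simp)

theorem contDiffOn_sharp (h : IsMetricOn G s) {θ : E n → E n →L[ℝ] ℝ}
    (hθ : ContDiffOn ℝ ∞ θ s) : ContDiffOn ℝ ∞ (fun y => sharp G y (θ y)) s := by
  unfold sharp
  refine ContDiffOn.clm_apply (fun y hy => ?_) hθ
  exact (ContinuousLinearMap.IsInvertible.contDiffAt_map_inverse (h.nondeg y hy)).comp_contDiffWithinAt y
    (h.smooth y hy)

/-- The Christoffel symbol as a bilinear map. -/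
def christoffelBil (G : E n → Bil n) (y : E n) : E n →L[ℝ] E n →L[ℝ] E n :=
  (LinearMap.mk₂ ℝ (christoffel G y)
    (by
      intro a b c
      simp only [christoffel, sharp]
      rw [← map_add]
      congr 1
      ext w
      simp
      ring)
    (by
      intro r a c
      simp only [christoffel, sharp]
      rw [← map_smul]
      congr 1
      ext w
      simp
      ring)
    (by
      intro a b c
      simp only [christoffel, sharp]
      rw [← map_add]
      congr 1
      ext w
      simp
      ring)
    (by
      intro r a c
      simp only [christoffel, sharp]
      rw [← map_smul]
      congr 1
      ext w
      simp
      ring)).toContinuousBilinearMap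

theorem christoffelBil_apply (u v : E n) : christoffelBil G y u v = christoffel G y u v := rfl

theorem contDiffOn_christoffelBil (h : IsMetricOn G s) :
    ContDiffOn ℝ ∞ (christoffelBil G) s := by
  have hd : ContDiffOn ℝ ∞ (fderiv ℝ G) s := h.smooth.fderiv_of_isOpen h.isOpen (by simp)
  have hda : ∀ u, ContDiffOn ℝ ∞ (fun y => fderiv ℝ G y u) s := fun u =>
    hd.clm_apply contDiffOn_const
  have hdb : ∀ u v, ContDiffOn ℝ ∞ (fun y => fderiv ℝ G y u v) s := fun u v =>
    (hda u).clm_apply contDiffOn_const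
  rw [contDiffOn_clm_apply]
  intro u
  rw [contDiffOn_clm_apply]
  intro v
  refine contDiffOn_sharp h (ContDiffOn.const_smul _ (((hdb u v).add (hdb v u)).sub ?_))
  rw [contDiffOn_clm_apply]
  intro w
  exact (hdb w u).clm_apply contDiffOn_const

theorem differentiableAt_christoffelBil (h : IsMetricOn G s) (hy : y ∈ s) :
    DifferentiableAt ℝ (christoffelBil G) y :=
  ((contDiffOn_christoffelBil h).contDiffAt (h.isOpen.mem_nhds hy)).differentiableAt (by simp)

theorem christoffel_spec (h : IsMetricOn G s) (hy : y ∈ s) (u v w : E n) :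
    2 * G y (christoffel G y u v) w =
      fderiv ℝ G y u v w + fderiv ℝ G y v u w - fderiv ℝ G y w u v := by
  rw [christoffel, sharp_spec h hy]
  simp

theorem fderiv_metric_apply (h : IsMetricOn G s) (hy : y ∈ s) (u v w : E n) :
    fderiv ℝ (fun z => G z v w) y u = fderiv ℝ G y u v w := by
  have := (((h.differentiableAt hy).hasFDerivAt.clm_apply (hasFDerivAt_const v y)).clm_apply
    (hasFDerivAt_const w y)).fderiv
  rw [this]
  simp

theorem fderiv_metric_symm (h : IsMetricOn G s) (hy : y ∈ s) (u v w : E n) :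
    fderiv ℝ G y u v w = fderiv ℝ G y u w v := by
  rw [← fderiv_metric_apply h hy, ← fderiv_metric_apply h hy]
  congr 1
  apply Filter.EventuallyEq.fderiv_eq
  filter_upwards [h.isOpen.mem_nhds hy] with z hz using h.symm z hz v w

/-- The Levi-Civita connection is metric. -/
theorem fderiv_metric_eq (h : IsMetricOn G s) (hy : y ∈ s) (u v w : E n) :
    fderiv ℝ G y u v w = G y (christoffel G y u v) w + G y v (christoffel G y u w) := by
  have h1 := christoffel_spec h hy u v w
  have h2 := christoffel_spec h hy u w v
  rw [h.symm y hy _ v] at h2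
  have h3 := fderiv_metric_symm h hy u v w
  have h4 := fderiv_metric_symm h hy v u w
  have h5 := fderiv_metric_symm h hy w u v
  linarith

theorem fderiv_christoffelBil_apply (h : IsMetricOn G s) (hy : y ∈ s) (u v w : E n) :
    fderiv ℝ (fun z => christoffel G z v w) y u = fderiv ℝ (christoffelBil G) y u v w := by
  have := (((differentiableAt_christoffelBil h hy).hasFDerivAt.clm_apply
    (hasFDerivAt_const v y)).clm_apply (hasFDerivAt_const w y)).fderiv
  simp only [christoffelBil_apply] at this
  rw [this]
  simp

theorem curvature_eq (h : IsMetricOn G s) (hy : y ∈ s) (u v w : E n) :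
    curvature G y u v w =
      fderiv ℝ (christoffelBil G) y u v w - fderiv ℝ (christoffelBil G) y v u w
      + christoffelBil G y u (christoffelBil G y v w)
      - christoffelBil G y v (christoffelBil G y u w) := by
  rw [curvature, fderiv_christoffelBil_apply h hy, fderiv_christoffelBil_apply h hy]
  rfl

theorem contDiffOn_curvature (h : IsMetricOn G s) (u v w : E n) :
    ContDiffOn ℝ ∞ (fun y => curvature G y u v w) s := by
  have hc := contDiffOn_christoffelBil h
  have hd : ContDiffOn ℝ ∞ (fderiv ℝ (christoffelBil G)) s := hc.fderiv_of_isOpen h.isOpen (by simp)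
  refine ContDiffOn.congr (f := fun y => fderiv ℝ (christoffelBil G) y u v w -
    fderiv ℝ (christoffelBil G) y v u w
      + christoffelBil G y u (christoffelBil G y v w)
      - christoffelBil G y v (christoffelBil G y u w)) ?_ fun y hy => curvature_eq h hy u v w
  have h1 : ∀ a, ContDiffOn ℝ ∞ (fun y => christoffelBil G y a) s := fun a =>
    hc.clm_apply contDiffOn_const
  have h2 : ∀ a b, ContDiffOn ℝ ∞ (fun y => christoffelBil G y a b) s := fun a b =>
    (h1 a).clm_apply contDiffOn_const
  have h3 : ∀ a b c, ContDiffOn ℝ ∞ (fun y => fderiv ℝ (christoffelBil G) y a b c) s :=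
    fun a b c => ((hd.clm_apply contDiffOn_const).clm_apply contDiffOn_const).clm_apply
      contDiffOn_const
  exact (((h3 u v w).sub (h3 v u w)).add ((h1 u).clm_apply (h2 v w))).sub
    ((h1 v).clm_apply (h2 u w))

theorem ricci_add_left (h : IsMetricOn G s) (hy : y ∈ s) (v v' w : E n) :
    ricci G y (v + v') w = ricci G y v w + ricci G y v' w := by
  simp only [ricci, curvature_eq h hy, ← Finset.sum_add_distrib]
  refine Finset.sum_congr rfl fun i _ => ?_
  simp
  ring

theorem ricci_smul_left (h : IsMetricOn G s) (hy : y ∈ s) (r : ℝ) (v w : E n) :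
    ricci G y (r • v) w = r * ricci G y v w := by
  simp only [ricci, curvature_eq h hy, Finset.mul_sum]
  refine Finset.sum_congr rfl fun i _ => ?_
  simp
  ring

theorem ricci_add_right (h : IsMetricOn G s) (hy : y ∈ s) (v w w' : E n) :
    ricci G y v (w + w') = ricci G y v w + ricci G y v w' := by
  simp only [ricci, curvature_eq h hy, ← Finset.sum_add_distrib]
  refine Finset.sum_congr rfl fun i _ => ?_
  simp
  ring

theorem ricci_smul_right (h : IsMetricOn G s) (hy : y ∈ s) (r : ℝ) (v w : E n) :
    ricci G y v (r • w) = r * ricci G y v w := by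
  simp only [ricci, curvature_eq h hy, Finset.mul_sum]
  refine Finset.sum_congr rfl fun i _ => ?_
  simp
  ring

theorem contDiffOn_ricci (h : IsMetricOn G s) (v w : E n) :
    ContDiffOn ℝ ∞ (fun y => ricci G y v w) s := by
  refine ContDiffOn.sum fun i _ => ?_
  exact (EuclideanSpace.proj (𝕜 := ℝ) i).contDiff.comp_contDiffOn (contDiffOn_curvature h _ v w)

end Christoffel

theorem two_le_infty : (2 : WithTop ℕ∞) ≤ ∞ :=
  WithTop.coe_le_coe.2 (le_top : (2 : ℕ∞) ≤ ⊤)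

/-! ### The Schouten tensor and the connection form of the tractor connection. -/

section Schouten

variable {n : ℕ} {G : E n → Bil n} {s : Set (E n)} {y : E n}

theorem sharp_add (θ θ' : E n →L[ℝ] ℝ) : sharp G y (θ + θ') = sharp G y θ + sharp G y θ' :=
  map_add _ _ _

theorem sharp_smul (r : ℝ) (θ : E n →L[ℝ] ℝ) : sharp G y (r • θ) = r • sharp G y θ :=
  map_smul _ _ _

theorem sum_coord_smul_ebasis (v : E n) : ∑ i, v i • ebasis i = v := by
  ext j
  simp [ebasis, Pi.single_apply]

theorem contDiffOn_ricci_apply (h : IsMetricOn G s) {v : E n → E n} (hv : ContDiffOn ℝ ∞ v s)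
    (w : E n) : ContDiffOn ℝ ∞ (fun y => ricci G y (v y) w) s := by
  have : ∀ y ∈ s, ricci G y (v y) w = ∑ i, v y i * ricci G y (ebasis i) w := by
    intro y hy
    let f : E n →ₗ[ℝ] ℝ :=
      { toFun := fun v => ricci G y v w
        map_add' := fun a b => ricci_add_left h hy a b w
        map_smul' := fun r a => ricci_smul_left h hy r a w }
    change f (v y) = _
    conv_lhs => rw [← sum_coord_smul_ebasis (v y)]
    rw [map_sum]
    simp [f]
  refine ContDiffOn.congr ?_ this
  refine ContDiffOn.sum fun i _ => ContDiffOn.mul ?_ (contDiffOn_ricci h _ w)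
  exact (EuclideanSpace.proj (𝕜 := ℝ) i).contDiff.comp_contDiffOn hv

theorem contDiffOn_scalarCurv (h : IsMetricOn G s) :
    ContDiffOn ℝ ∞ (scalarCurv G) s := by
  refine ContDiffOn.sum fun i _ => ?_
  exact contDiffOn_ricci_apply h (contDiffOn_sharp h contDiffOn_const) _

theorem contDiffOn_metric_apply (h : IsMetricOn G s) (v w : E n) :
    ContDiffOn ℝ ∞ (fun y => G y v w) s :=
  (h.smooth.clm_apply contDiffOn_const).clm_apply contDiffOn_const

theorem contDiffOn_schouten (h : IsMetricOn G s) (v w : E n) :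
    ContDiffOn ℝ ∞ (fun y => schouten G y v w) s := by
  refine contDiffOn_const.mul ((contDiffOn_ricci h v w).sub (ContDiffOn.mul ?_
    (contDiffOn_metric_apply h v w)))
  exact (contDiffOn_scalarCurv h).div_const _

theorem schouten_add_left (h : IsMetricOn G s) (hy : y ∈ s) (v v' w : E n) :
    schouten G y (v + v') w = schouten G y v w + schouten G y v' w := by
  simp only [schouten, ricci_add_left h hy, map_add, add_apply]
  ring

theorem schouten_smul_left (h : IsMetricOn G s) (hy : y ∈ s) (r : ℝ) (v w : E n) :
    schouten G y (r • v) w = r * schouten G y v w := by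
  simp only [schouten, ricci_smul_left h hy, map_smul, smul_apply, smul_eq_mul]
  ring

theorem schouten_add_right (h : IsMetricOn G s) (hy : y ∈ s) (v w w' : E n) :
    schouten G y v (w + w') = schouten G y v w + schouten G y v w' := by
  simp only [schouten, ricci_add_right h hy, map_add]
  ring

theorem schouten_smul_right (h : IsMetricOn G s) (hy : y ∈ s) (r : ℝ) (v w : E n) :
    schouten G y v (r • w) = r * schouten G y v w := by
  simp only [schouten, ricci_smul_right h hy, map_smul, smul_eq_mul]
  ring

theorem schoutenEnd_spec (h : IsMetricOn G s) (hy : y ∈ s) (v w : E n) :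
    G y (schoutenEnd G y v) w = schouten G y v w := by
  let f : E n →ₗ[ℝ] ℝ :=
    { toFun := fun w => schouten G y v w
      map_add' := fun a b => schouten_add_right h hy v a b
      map_smul' := fun r a => schouten_smul_right h hy r v a }
  change _ = f w
  conv_rhs => rw [← sum_coord_smul_ebasis w]
  rw [map_sum, schoutenEnd, map_sum, sum_apply]
  refine Finset.sum_congr rfl fun i _ => ?_
  simp [sharp_spec h hy, f]
  ring

theorem schoutenEnd_add (h : IsMetricOn G s) (hy : y ∈ s) (v v' : E n) :
    schoutenEnd G y (v + v') = schoutenEnd G y v + schoutenEnd G y v' := by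
  simp [schoutenEnd, schouten_add_left h hy, add_smul, Finset.sum_add_distrib]

theorem schoutenEnd_smul (h : IsMetricOn G s) (hy : y ∈ s) (r : ℝ) (v : E n) :
    schoutenEnd G y (r • v) = r • schoutenEnd G y v := by
  simp [schoutenEnd, schouten_smul_left h hy, mul_smul, Finset.smul_sum]

theorem contDiffOn_schoutenEnd (h : IsMetricOn G s) (v : E n) :
    ContDiffOn ℝ ∞ (fun y => schoutenEnd G y v) s :=
  ContDiffOn.sum fun _ _ => (contDiffOn_schouten h v _).smul (contDiffOn_sharp h contDiffOn_const)

/-- The zeroth order part of the tractor connection in coordinates. -/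
def tractorTerm (G : E n → Bil n) (y X : E n) (τ : Tractor n) : Tractor n :=
  (-schouten G y X τ.2.1,
    christoffel G y X τ.2.1 + τ.1 • X + τ.2.2 • schoutenEnd G y X, -G y X τ.2.1)

/-- The connection form of the tractor connection in coordinates. -/
theorem exists_tractorForm (h : IsMetricOn G s) :
    ∃ B : E n → E n →L[ℝ] Tractor n →L[ℝ] Tractor n, ContDiffOn ℝ ∞ B s ∧
      ∀ y ∈ s, ∀ X τ, B y X τ = tractorTerm G y X τ := by
  classical
  have hbil : ∀ y ∈ s, ∃ b : E n →L[ℝ] Tractor n →L[ℝ] Tractor n,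
      ∀ X τ, b X τ = tractorTerm G y X τ := by
    intro y hy
    refine ⟨(LinearMap.mk₂ ℝ (tractorTerm G y) ?_ ?_ ?_ ?_).toContinuousBilinearMap,
      fun _ _ => rfl⟩
    · intro a b c
      simp only [tractorTerm, schouten_add_left h hy, ← christoffelBil_apply,
        schoutenEnd_add h hy, map_add, add_apply, Prod.mk_add_mk, smul_add]
      refine Prod.ext ?_ (Prod.ext ?_ ?_) <;> dsimp only <;> first | ring1 | abel
    · intro r a c
      simp only [tractorTerm, schouten_smul_left h hy, ← christoffelBil_apply,
        schoutenEnd_smul h hy, map_smul, smul_apply, Prod.smul_mk, smul_add,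
        smul_eq_mul, smul_comm r]
      refine Prod.ext ?_ (Prod.ext ?_ ?_) <;> dsimp only <;> ring1
    · intro a b c
      simp only [tractorTerm, schouten_add_right h hy, ← christoffelBil_apply,
        map_add, Prod.mk_add_mk, add_smul, Prod.fst_add,
        Prod.snd_add]
      refine Prod.ext ?_ (Prod.ext ?_ ?_) <;> dsimp only <;> first | ring1 | abel
    · intro r a c
      simp only [tractorTerm, schouten_smul_right h hy, ← christoffelBil_apply,
        map_smul, Prod.smul_mk, smul_add, Prod.smul_fst, Prod.smul_snd,
        smul_eq_mul, mul_smul]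
      refine Prod.ext ?_ (Prod.ext ?_ ?_) <;> dsimp only <;> ring1
  -- Off `s` the value of `B` is arbitrary: `tractorTerm` is known to be bilinear only where `G` is
  -- a smooth metric.
  choose! B hB using hbil
  refine ⟨B, ?_, hB⟩
  rw [contDiffOn_clm_apply]
  intro X
  rw [contDiffOn_clm_apply]
  intro τ
  refine ContDiffOn.congr (f := fun y => tractorTerm G y X τ) ?_ fun y hy => hB y hy X τ
  unfold tractorTerm
  refine (contDiffOn_schouten h _ _).neg.prodMk (ContDiffOn.prodMk ?_
    (contDiffOn_metric_apply h _ _).neg)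
  refine ContDiffOn.add (ContDiffOn.add ?_ contDiffOn_const)
    (ContDiffOn.const_smul _ (contDiffOn_schoutenEnd h X))
  exact ((contDiffOn_christoffelBil h).clm_apply contDiffOn_const).clm_apply contDiffOn_const

end Schouten

/-! ### Naturality of curvature quantities under coordinate changes. -/

/-- `G` is the pullback of `G'` under the smooth map `φ` on the open set `s`. -/
structure IsPullback {n : ℕ} (φ : E n → E n) (G : E n → Bil n) (s : Set (E n))
    (G' : E n → Bil n) (s' : Set (E n)) : Prop where
  source : IsMetricOn G s
  target : IsMetricOn G' s'
  smooth : ContDiffOn ℝ ∞ φ s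
  mapsTo : MapsTo φ s s'
  eq : ∀ y ∈ s, ∀ u v, G y u v = G' (φ y) (fderiv ℝ φ y u) (fderiv ℝ φ y v)

section Pullback

variable {n : ℕ} {φ : E n → E n} {G G' : E n → Bil n} {s s' : Set (E n)} {y : E n}

theorem IsPullback.contDiffAt (h : IsPullback φ G s G' s') (hy : y ∈ s) : ContDiffAt ℝ ∞ φ y :=
  h.smooth.contDiffAt (h.source.isOpen.mem_nhds hy)

theorem IsPullback.hasFDerivAt (h : IsPullback φ G s G' s') (hy : y ∈ s) :
    HasFDerivAt φ (fderiv ℝ φ y) y :=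
  ((h.contDiffAt hy).differentiableAt (by simp)).hasFDerivAt

theorem IsPullback.contDiffOn_fderiv (h : IsPullback φ G s G' s') :
    ContDiffOn ℝ ∞ (fderiv ℝ φ) s :=
  h.smooth.fderiv_of_isOpen h.source.isOpen (by simp)

theorem IsPullback.hasFDerivAt_fderiv (h : IsPullback φ G s G' s') (hy : y ∈ s) :
    HasFDerivAt (fderiv ℝ φ) (fderiv ℝ (fderiv ℝ φ) y) y :=
  ((h.contDiffOn_fderiv.contDiffAt (h.source.isOpen.mem_nhds hy)).differentiableAt
    (by simp)).hasFDerivAt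

theorem IsPullback.hasFDerivAt_fderiv_fderiv (h : IsPullback φ G s G' s') (hy : y ∈ s) :
    HasFDerivAt (fderiv ℝ (fderiv ℝ φ)) (fderiv ℝ (fderiv ℝ (fderiv ℝ φ)) y) y :=
  (((h.contDiffOn_fderiv.fderiv_of_isOpen h.source.isOpen (m := ∞) (by simp)).contDiffAt
    (h.source.isOpen.mem_nhds hy)).differentiableAt (by simp)).hasFDerivAt

theorem IsPullback.second_symm (h : IsPullback φ G s G' s') (hy : y ∈ s) (u v : E n) :
    fderiv ℝ (fderiv ℝ φ) y u v = fderiv ℝ (fderiv ℝ φ) y v u :=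
  ((h.contDiffAt hy).isSymmSndFDerivAt (by simpa using two_le_infty)).eq u v

theorem IsPullback.third_symm (h : IsPullback φ G s G' s') (hy : y ∈ s) (u v w : E n) :
    fderiv ℝ (fderiv ℝ (fderiv ℝ φ)) y u v w = fderiv ℝ (fderiv ℝ (fderiv ℝ φ)) y v u w := by
  rw [((h.contDiffOn_fderiv.contDiffAt
    (h.source.isOpen.mem_nhds hy)).isSymmSndFDerivAt (by simpa using two_le_infty)).eq u v]

/-- A vector killed by the differential lies in the radical of `G`, which is zero. -/
theorem IsPullback.injective (h : IsPullback φ G s G' s') (hy : y ∈ s) :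
    Function.Injective (fderiv ℝ φ y) := by
  rw [injective_iff_map_eq_zero]
  intro u hu
  apply h.source.ext hy
  intro w
  rw [h.eq y hy, hu]
  simp

/-- The differential of `φ` as a linear equivalence. -/
def IsPullback.equiv (h : IsPullback φ G s G' s') (hy : y ∈ s) : E n ≃L[ℝ] E n :=
  (LinearEquiv.ofInjectiveEndo (fderiv ℝ φ y : E n →ₗ[ℝ] E n)
    (h.injective hy)).toContinuousLinearEquiv

theorem IsPullback.equiv_apply (h : IsPullback φ G s G' s') (hy : y ∈ s) (u : E n) :
    h.equiv hy u = fderiv ℝ φ y u := rfl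

theorem IsPullback.fderiv_metric (h : IsPullback φ G s G' s') (hy : y ∈ s) (u v w : E n) :
    fderiv ℝ G y u v w =
      fderiv ℝ G' (φ y) (fderiv ℝ φ y u) (fderiv ℝ φ y v) (fderiv ℝ φ y w)
      + G' (φ y) (fderiv ℝ (fderiv ℝ φ) y u v) (fderiv ℝ φ y w)
      + G' (φ y) (fderiv ℝ φ y v) (fderiv ℝ (fderiv ℝ φ) y u w) := by
  rw [← fderiv_metric_apply h.source hy]
  have heq : (fun z => G z v w) =ᶠ[𝓝 y]
      fun z => G' (φ z) (fderiv ℝ φ z v) (fderiv ℝ φ z w) := by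
    filter_upwards [h.source.isOpen.mem_nhds hy] with z hz using h.eq z hz v w
  rw [heq.fderiv_eq]
  have h1 : HasFDerivAt (fun z => G' (φ z)) _ y :=
    (h.target.differentiableAt (h.mapsTo hy)).hasFDerivAt.comp y (h.hasFDerivAt hy)
  have h2 := (h.hasFDerivAt_fderiv hy).clm_apply (hasFDerivAt_const v y)
  have h3 := (h.hasFDerivAt_fderiv hy).clm_apply (hasFDerivAt_const w y)
  rw [((h1.clm_apply h2).clm_apply h3).fderiv]
  simp
  ring

/-- Differentiating the pullback relation puts six second-derivative terms into the Koszul formula.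
By symmetry of the second derivative four cancel and the other two agree, which leaves the
inhomogeneous term. -/
theorem IsPullback.christoffel (h : IsPullback φ G s G' s') (hy : y ∈ s) (u v : E n) :
    fderiv ℝ φ y (christoffel G y u v) =
      fderiv ℝ (fderiv ℝ φ) y u v
      + ConfHol.christoffel G' (φ y) (fderiv ℝ φ y u) (fderiv ℝ φ y v) := by
  apply h.target.ext (h.mapsTo hy)
  intro w'
  obtain ⟨w, rfl⟩ : ∃ w, fderiv ℝ φ y w = w' := (h.equiv hy).surjective w'
  rw [← h.eq y hy]
  have h1 := christoffel_spec h.source hy u v w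
  rw [h.fderiv_metric hy, h.fderiv_metric hy, h.fderiv_metric hy] at h1
  have h2 := christoffel_spec h.target (h.mapsTo hy) (fderiv ℝ φ y u) (fderiv ℝ φ y v)
    (fderiv ℝ φ y w)
  rw [h.second_symm hy v u, h.second_symm hy w u, h.second_symm hy w v,
    h.target.symm _ (h.mapsTo hy) (fderiv ℝ φ y v) (fderiv ℝ (fderiv ℝ φ) y u w)] at h1
  rw [map_add, add_apply]
  linarith [h.target.symm _ (h.mapsTo hy) (fderiv ℝ φ y u) (fderiv ℝ (fderiv ℝ φ) y v w)]

theorem IsPullback.fderiv_christoffel (h : IsPullback φ G s G' s') (hy : y ∈ s) (u v w : E n) :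
    fderiv ℝ (fderiv ℝ φ) y u (christoffelBil G y v w)
      + fderiv ℝ φ y (fderiv ℝ (christoffelBil G) y u v w) =
    fderiv ℝ (fderiv ℝ (fderiv ℝ φ)) y u v w
      + fderiv ℝ (christoffelBil G') (φ y) (fderiv ℝ φ y u) (fderiv ℝ φ y v) (fderiv ℝ φ y w)
      + christoffelBil G' (φ y) (fderiv ℝ (fderiv ℝ φ) y u v) (fderiv ℝ φ y w)
      + christoffelBil G' (φ y) (fderiv ℝ φ y v) (fderiv ℝ (fderiv ℝ φ) y u w) := by
  have heq : (fun z => fderiv ℝ φ z (christoffelBil G z v w)) =ᶠ[𝓝 y]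
      fun z => fderiv ℝ (fderiv ℝ φ) z v w
        + christoffelBil G' (φ z) (fderiv ℝ φ z v) (fderiv ℝ φ z w) := by
    filter_upwards [h.source.isOpen.mem_nhds hy] with z hz using h.christoffel hz v w
  have h0 := ((differentiableAt_christoffelBil h.source hy).hasFDerivAt.clm_apply
    (hasFDerivAt_const v y)).clm_apply (hasFDerivAt_const w y)
  have h1 := (h.hasFDerivAt_fderiv hy).clm_apply h0
  have hc := (differentiableAt_christoffelBil h.target (h.mapsTo hy)).hasFDerivAt.comp y
    (h.hasFDerivAt hy)
  have h2 := (h.hasFDerivAt_fderiv hy).clm_apply (hasFDerivAt_const v y)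
  have h3 := (h.hasFDerivAt_fderiv hy).clm_apply (hasFDerivAt_const w y)
  have h4' := (h.hasFDerivAt_fderiv_fderiv hy).clm_apply (hasFDerivAt_const v y)
  have h4 := h4'.clm_apply (hasFDerivAt_const w y)
  have h5 := h1.unique ((h4.add ((hc.clm_apply h2).clm_apply h3)).congr_of_eventuallyEq heq)
  have h6 := DFunLike.congr_fun h5 u
  simp at h6
  rw [add_comm, h6]
  abel

/-- Antisymmetrizing the differentiated law for the Christoffel symbols in `u, v` removes the third
derivative of `φ`; the second-derivative terms cancel against those produced by the quadratic part.
-/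
theorem IsPullback.curvature (h : IsPullback φ G s G' s') (hy : y ∈ s) (u v w : E n) :
    fderiv ℝ φ y (curvature G y u v w) =
      ConfHol.curvature G' (φ y) (fderiv ℝ φ y u) (fderiv ℝ φ y v) (fderiv ℝ φ y w) := by
  rw [curvature_eq h.source hy, curvature_eq h.target (h.mapsTo hy)]
  have e : ∀ a b, fderiv ℝ φ y (christoffelBil G y a b) = fderiv ℝ (fderiv ℝ φ) y a b
      + christoffelBil G' (φ y) (fderiv ℝ φ y a) (fderiv ℝ φ y b) := fun a b => h.christoffel hy a b
  have h1 := h.fderiv_christoffel hy u v w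
  have h2 := h.fderiv_christoffel hy v u w
  rw [h.third_symm hy v u, h.second_symm hy v u] at h2
  have h1' := eq_sub_of_add_eq' h1
  have h2' := eq_sub_of_add_eq' h2
  simp only [map_add, map_sub, h1', h2', e]
  abel

/-- A trace may be computed in any pair of dual bases, here the images of the standard pair under
`L`. This turns the coordinate sums in `ricci` and `scalarCurv` into invariants. -/
theorem sum_dual_basis_conj (b : (E n →L[ℝ] ℝ) → E n → ℝ)
    (hadd : ∀ θ θ' v, b (θ + θ') v = b θ v + b θ' v) (hsmul : ∀ (r : ℝ) θ v, b (r • θ) v = r * b θ v)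
    (hadd' : ∀ θ v v', b θ (v + v') = b θ v + b θ v')
    (hsmul' : ∀ (r : ℝ) θ v, b θ (r • v) = r * b θ v) (L : E n ≃L[ℝ] E n) :
    ∑ i : Fin n, b ((EuclideanSpace.proj i : E n →L[ℝ] ℝ).comp (L : E n →L[ℝ] E n))
      (L.symm (ebasis i)) = ∑ i : Fin n, b (EuclideanSpace.proj i) (ebasis i) := by
  let f : (E n →L[ℝ] ℝ) →ₗ[ℝ] E n →ₗ[ℝ] ℝ := LinearMap.mk₂ ℝ b hadd hsmul hadd' hsmul'
  have hf : ∀ θ v, b θ v = f θ v := fun _ _ => rfl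
  simp only [hf]
  have h1 : ∀ i : Fin n, (EuclideanSpace.proj i : E n →L[ℝ] ℝ).comp (L : E n →L[ℝ] E n) =
      ∑ j, L (ebasis j) i • (EuclideanSpace.proj j : E n →L[ℝ] ℝ) := by
    intro i
    ext v
    conv_lhs => rw [← sum_coord_smul_ebasis v]
    simp [sum_apply]
    refine Finset.sum_congr rfl fun j _ => mul_comm _ _
  simp only [h1, map_sum, map_smul, LinearMap.sum_apply, LinearMap.smul_apply]
  rw [Finset.sum_comm]
  refine Finset.sum_congr rfl fun j _ => ?_
  simp only [← map_smul]
  rw [← map_sum, ← map_sum, sum_coord_smul_ebasis]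
  simp

theorem IsPullback.ricci (h : IsPullback φ G s G' s') (hy : y ∈ s) (v w : E n) :
    ricci G y v w = ConfHol.ricci G' (φ y) (fderiv ℝ φ y v) (fderiv ℝ φ y w) := by
  refine Eq.trans (Finset.sum_congr rfl fun i _ => ?_) (sum_dual_basis_conj
    (fun θ u => θ (ConfHol.curvature G' (φ y) u (fderiv ℝ φ y v) (fderiv ℝ φ y w)))
    (by simp) (by simp) ?_ ?_ (h.equiv hy).symm)
  · have h1 := h.curvature hy (ebasis i) v w
    rw [← h.equiv_apply hy, ← h.equiv_apply hy (ebasis i)] at h1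
    simp [← h1]
  · intro θ a b
    simp [curvature_eq h.target (h.mapsTo hy)]
    ring
  · intro r θ a
    simp [curvature_eq h.target (h.mapsTo hy)]
    ring

theorem IsPullback.sharp (h : IsPullback φ G s G' s') (hy : y ∈ s) (θ : E n →L[ℝ] ℝ) :
    fderiv ℝ φ y (sharp G y θ) =
      ConfHol.sharp G' (φ y) (θ.comp ((h.equiv hy).symm : E n →L[ℝ] E n)) := by
  refine sharp_eq_of h.target (h.mapsTo hy) fun w => ?_
  obtain ⟨w, rfl⟩ := (h.equiv hy).surjective w
  rw [h.equiv_apply, ← h.eq y hy, sharp_spec h.source hy, ← h.equiv_apply hy]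
  simp

theorem IsPullback.scalarCurv (h : IsPullback φ G s G' s') (hy : y ∈ s) :
    scalarCurv G y = ConfHol.scalarCurv G' (φ y) := by
  have hy' := h.mapsTo hy
  refine Eq.trans (Finset.sum_congr rfl fun i _ => ?_) (sum_dual_basis_conj
    (fun θ u => ConfHol.ricci G' (φ y) (ConfHol.sharp G' (φ y) θ) u)
    (by simp [sharp_add, ricci_add_left h.target hy'])
    (by simp [sharp_smul, ricci_smul_left h.target hy'])
    (by simp [ricci_add_right h.target hy'])
    (by simp [ricci_smul_right h.target hy']) (h.equiv hy).symm)
  rw [h.ricci hy, h.sharp hy]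
  rfl

theorem IsPullback.schouten (h : IsPullback φ G s G' s') (hy : y ∈ s) (v w : E n) :
    schouten G y v w = ConfHol.schouten G' (φ y) (fderiv ℝ φ y v) (fderiv ℝ φ y w) := by
  rw [ConfHol.schouten, ConfHol.schouten, h.ricci hy, h.scalarCurv hy, h.eq y hy]

theorem IsPullback.schoutenEnd (h : IsPullback φ G s G' s') (hy : y ∈ s) (v : E n) :
    fderiv ℝ φ y (schoutenEnd G y v) = ConfHol.schoutenEnd G' (φ y) (fderiv ℝ φ y v) := by
  refine h.target.ext (h.mapsTo hy) fun w => ?_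
  obtain ⟨w, rfl⟩ := (h.equiv hy).surjective w
  rw [h.equiv_apply, ← h.eq y hy, schoutenEnd_spec h.source hy,
    schoutenEnd_spec h.target (h.mapsTo hy), h.schouten hy]

end Pullback

/-! ### Differentials of charts and transition maps. -/

section ChartDerivatives

variable {n : ℕ} {M : Type*} [TopologicalSpace M] [ChartedSpace (E n) M]
  [IsManifold (𝓡 n) ∞ M]

/-- The differential at `x` of the chart centred at `x₀`. -/
def chartD (x₀ x : M) : E n →L[ℝ] E n :=
  mfderiv (𝓡 n) 𝓘(ℝ, E n) (extChartAt (𝓡 n) x₀) x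

/-- The differential at `y` of the inverse of the chart centred at `x₀`. -/
def chartDInv (x₀ : M) (y : E n) : E n →L[ℝ] E n :=
  mfderiv 𝓘(ℝ, E n) (𝓡 n) (extChartAt (𝓡 n) x₀).symm y

theorem chartD_self (x : M) : chartD (n := n) x x = ContinuousLinearMap.id ℝ (E n) :=
  mfderiv_extChartAt_self

theorem chartD_chartDInv {x₀ : M} {y : E n} (hy : y ∈ (extChartAt (𝓡 n) x₀).target) (u : E n) :
    chartD x₀ ((extChartAt (𝓡 n) x₀).symm y) (chartDInv x₀ y u) = u := by
  have h := mfderiv_extChartAt_comp_mfderivWithin_extChartAt_symm (I := 𝓡 n) hy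
  rw [ModelWithCorners.range_eq_univ, mfderivWithin_univ] at h
  exact DFunLike.congr_fun h u

theorem chartDInv_chartD {x₀ x : M} (hx : x ∈ (extChartAt (𝓡 n) x₀).source) (u : E n) :
    chartDInv x₀ (extChartAt (𝓡 n) x₀ x) (chartD x₀ x u) = u := by
  have h := mfderivWithin_extChartAt_symm_comp_mfderiv_extChartAt' (I := 𝓡 n) hx
  rw [ModelWithCorners.range_eq_univ, mfderivWithin_univ] at h
  exact DFunLike.congr_fun h u

/-- The bridge between the topology of the tangent bundle and vectors read in a chart. -/
theorem trivializationAt_eq_chartD {x₀ x : M} (hx : x ∈ (extChartAt (𝓡 n) x₀).source)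
    (u : TangentSpace (𝓡 n) x) :
    (trivializationAt (E n) (TangentSpace (𝓡 n)) x₀ ⟨x, u⟩).2 = chartD x₀ x u := by
  rw [extChartAt_source] at hx
  rw [← Bundle.Trivialization.continuousLinearMapAt_apply_of_mem (R := ℝ)]
  · exact DFunLike.congr_fun (TangentBundle.continuousLinearMapAt_trivializationAt hx) u
  · simpa using hx

/-- The domain of the change of charts. -/
def overlap (n : ℕ) {M : Type*} [TopologicalSpace M] [ChartedSpace (E n) M] (x₀ x₁ : M) :
    Set (E n) :=
  ((extChartAt (𝓡 n) x₀).symm ≫ extChartAt (𝓡 n) x₁).source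

theorem mem_overlap {x₀ x₁ : M} {y : E n} : y ∈ overlap n x₀ x₁ ↔
    y ∈ (extChartAt (𝓡 n) x₀).target ∧
      (extChartAt (𝓡 n) x₀).symm y ∈ (extChartAt (𝓡 n) x₁).source := by
  rw [overlap, PartialEquiv.trans_source]
  rfl

theorem isOpen_overlap (x₀ x₁ : M) : IsOpen (overlap n x₀ x₁) := by
  have : overlap n x₀ x₁ = (extChartAt (𝓡 n) x₀).target ∩
      (extChartAt (𝓡 n) x₀).symm ⁻¹' (extChartAt (𝓡 n) x₁).source := by
    ext y
    exact mem_overlap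
  rw [this]
  exact (continuousOn_extChartAt_symm x₀).isOpen_inter_preimage (isOpen_extChartAt_target x₀)
    (isOpen_extChartAt_source x₁)

/-- The change of charts. -/
def transition (n : ℕ) {M : Type*} [TopologicalSpace M] [ChartedSpace (E n) M] (x₀ x₁ : M) :
    E n → E n :=
  extChartAt (𝓡 n) x₁ ∘ (extChartAt (𝓡 n) x₀).symm

theorem contDiffOn_transition (x₀ x₁ : M) :
    ContDiffOn ℝ ∞ (transition n x₀ x₁) (overlap n x₀ x₁) :=
  contDiffOn_ext_coord_change x₁ x₀

theorem mdifferentiableAt_extChartAt_symm {x₀ : M} {y : E n}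
    (hy : y ∈ (extChartAt (𝓡 n) x₀).target) :
    MDifferentiableAt 𝓘(ℝ, E n) (𝓡 n) (extChartAt (𝓡 n) x₀).symm y := by
  have := mdifferentiableWithinAt_extChartAt_symm (I := 𝓡 n) hy
  rwa [ModelWithCorners.range_eq_univ, mdifferentiableWithinAt_univ] at this

theorem fderiv_transition {x₀ x₁ : M} {y : E n} (hy : y ∈ overlap n x₀ x₁) (u : E n) :
    fderiv ℝ (transition n x₀ x₁) y u =
      chartD x₁ ((extChartAt (𝓡 n) x₀).symm y) (chartDInv x₀ y u) := by
  rw [mem_overlap] at hy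
  rw [← mfderiv_eq_fderiv, transition, mfderiv_comp (I' := 𝓡 n)]
  · rfl
  · apply mdifferentiableAt_extChartAt
    simpa using hy.2
  · exact mdifferentiableAt_extChartAt_symm hy.1

theorem chartD_eq_fderiv_transition {x₀ x₁ x : M} (h₀ : x ∈ (extChartAt (𝓡 n) x₀).source)
    (h₁ : x ∈ (extChartAt (𝓡 n) x₁).source) (u : E n) :
    chartD x₁ x u = fderiv ℝ (transition n x₀ x₁) (extChartAt (𝓡 n) x₀ x) (chartD x₀ x u) := by
  rw [fderiv_transition, chartDInv_chartD h₀, (extChartAt (𝓡 n) x₀).left_inv h₀]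
  rw [mem_overlap, (extChartAt (𝓡 n) x₀).left_inv h₀]
  exact ⟨(extChartAt (𝓡 n) x₀).map_source h₀, h₁⟩

theorem contMDiffOn_coordField (x₀ : M) (u : E n) :
    ContMDiffOn 𝓘(ℝ, E n) ((𝓡 n).prod 𝓘(ℝ, E n)) ∞
      (fun y => Bundle.TotalSpace.mk' (E n) (E := fun x : M => TangentSpace (𝓡 n) x)
        ((extChartAt (𝓡 n) x₀).symm y) (chartDInv x₀ y u)) (extChartAt (𝓡 n) x₀).target := by
  rw [(trivializationAt (E n) (TangentSpace (𝓡 n)) x₀).contMDiffOn_iff]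
  · refine ⟨contMDiffOn_extChartAt_symm x₀, (contMDiffOn_const (c := u)).congr fun y hy => ?_⟩
    exact (trivializationAt_eq_chartD ((extChartAt (𝓡 n) x₀).map_target hy) _).trans
      (chartD_chartDInv hy u)
  · intro y hy
    have := (extChartAt (𝓡 n) x₀).map_target hy
    rw [extChartAt_source] at this
    simpa using this

end ChartDerivatives

/-! ### The metric in charts. -/

section CoordMetric

variable {n p q : ℕ} {M : Type*} [TopologicalSpace M] [ChartedSpace (E n) M]
  [IsManifold (𝓡 n) ∞ M]

theorem coordMetric_apply (g : Metric n p q M) (x₀ : M) (y u v : E n) :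
    coordMetric g x₀ y u v =
      g.val ((extChartAt (𝓡 n) x₀).symm y) (chartDInv x₀ y u) (chartDInv x₀ y v) := rfl

theorem metric_eq_coordMetric (g : Metric n p q M) {x₀ x : M}
    (hx : x ∈ (extChartAt (𝓡 n) x₀).source) (u v : E n) :
    g.val x u v = coordMetric g x₀ (extChartAt (𝓡 n) x₀ x) (chartD x₀ x u) (chartD x₀ x v) := by
  rw [coordMetric_apply, chartDInv_chartD hx, chartDInv_chartD hx,
    (extChartAt (𝓡 n) x₀).left_inv hx]

theorem metric_nondeg (g : Metric n p q M) (x : M) {u : E n}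
    (hu : ∀ v : E n, g.val x u v = 0) : u = 0 := by
  obtain ⟨b, hb⟩ := g.signature x
  let u' : TangentSpace (𝓡 n) x := u
  change u' = 0
  apply b.ext_elem
  intro i
  have h := hu (b i)
  change g.val x u' (b i) = 0 at h
  rw [← b.sum_repr u', map_sum, sum_apply] at h
  simp only [map_smul, smul_apply, hb, smul_eq_mul] at h
  rw [Finset.sum_eq_single i (by intro j _ hj; simp [hj]) (by simp)] at h
  rcases i with i | i <;> simpa using h

theorem isMetricOn_coordMetric (g : Metric n p q M) (x₀ : M) :
    IsMetricOn (coordMetric g x₀) (extChartAt (𝓡 n) x₀).target where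
  isOpen := isOpen_extChartAt_target x₀
  smooth := by
    rw [contDiffOn_clm_apply]
    intro u
    rw [contDiffOn_clm_apply]
    intro v
    have h : ContMDiffOn 𝓘(ℝ, E n) ((𝓡 n).prod 𝓘(ℝ, ℝ)) ∞
        (fun y => Bundle.TotalSpace.mk' ℝ (E := Bundle.Trivial M ℝ) ((extChartAt (𝓡 n) x₀).symm y)
          (g.val ((extChartAt (𝓡 n) x₀).symm y) (chartDInv x₀ y u) (chartDInv x₀ y v)))
        (extChartAt (𝓡 n) x₀).target := by
      apply ContMDiffOn.clm_bundle_apply₂ (F₁ := E n) (F₂ := E n)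
      · exact g.smooth.comp_contMDiffOn (contMDiffOn_extChartAt_symm x₀)
      · exact contMDiffOn_coordField x₀ u
      · exact contMDiffOn_coordField x₀ v
    rw [← contMDiffOn_iff_contDiffOn]
    intro y hy
    have := h y hy
    rw [Bundle.contMDiffWithinAt_totalSpace] at this
    exact this.2
  symm y _ u v := g.symm _ _ _
  nondeg := by
    intro y hy
    have hinj : Function.Injective (coordMetric g x₀ y) := by
      rw [injective_iff_map_eq_zero]
      intro u hu
      have : chartDInv x₀ y u = 0 := by
        apply metric_nondeg g ((extChartAt (𝓡 n) x₀).symm y)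
        intro v
        have h := DFunLike.congr_fun hu (chartD x₀ ((extChartAt (𝓡 n) x₀).symm y) v)
        rw [coordMetric_apply] at h
        have h' := chartDInv_chartD ((extChartAt (𝓡 n) x₀).map_target hy) v
        rw [(extChartAt (𝓡 n) x₀).right_inv hy] at h'
        rw [h'] at h
        exact h
      rw [← chartD_chartDInv hy u, this, map_zero]
    have hdim : Module.finrank ℝ (E n) = Module.finrank ℝ (E n →L[ℝ] ℝ) := by
      rw [← LinearMap.toContinuousLinearMap.finrank_eq]
      exact Subspace.dual_finrank_eq.symm
    refine ⟨(LinearEquiv.ofInjectiveOfFinrankEq (coordMetric g x₀ y : E n →ₗ[ℝ] _) hinj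
      hdim).toContinuousLinearEquiv, ?_⟩
    ext u v
    rfl

theorem IsMetricOn.mono {G : E n → Bil n} {s t : Set (E n)} (h : IsMetricOn G s) (hts : t ⊆ s)
    (ht : IsOpen t) : IsMetricOn G t :=
  ⟨ht, h.smooth.mono hts, fun y hy => h.symm y (hts hy), fun y hy => h.nondeg y (hts hy)⟩

theorem isPullback_transition (g : Metric n p q M) (x₀ x₁ : M) :
    IsPullback (transition n x₀ x₁) (coordMetric g x₀) (overlap n x₀ x₁) (coordMetric g x₁)
      (extChartAt (𝓡 n) x₁).target where
  source := (isMetricOn_coordMetric g x₀).mono (fun _ hy => (mem_overlap.1 hy).1)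
    (isOpen_overlap x₀ x₁)
  target := isMetricOn_coordMetric g x₁
  smooth := contDiffOn_transition x₀ x₁
  mapsTo y hy := (extChartAt (𝓡 n) x₁).map_source (mem_overlap.1 hy).2
  eq y hy u v := by
    have hy' := mem_overlap.1 hy
    rw [fderiv_transition hy, fderiv_transition hy, transition, Function.comp_apply,
      ← metric_eq_coordMetric g hy'.2, coordMetric_apply]

end CoordMetric

/-! ### Parallel tractor fields in a fixed chart, and compatibility with the tractor metric. -/

section ParallelCharts

variable {n p q : ℕ} {M : Type*} [TopologicalSpace M] [ChartedSpace (E n) M]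
  [IsManifold (𝓡 n) ∞ M]

/-- The connection form of the tractor connection in the chart centred at `x₀`. -/
def tractorForm (g : Metric n p q M) (x₀ : M) : E n → E n →L[ℝ] Tractor n →L[ℝ] Tractor n :=
  (exists_tractorForm (isMetricOn_coordMetric g x₀)).choose

theorem contDiffOn_tractorForm (g : Metric n p q M) (x₀ : M) :
    ContDiffOn ℝ ∞ (tractorForm g x₀) (extChartAt (𝓡 n) x₀).target :=
  (exists_tractorForm (isMetricOn_coordMetric g x₀)).choose_spec.1

theorem tractorForm_apply (g : Metric n p q M) {x₀ : M} {y : E n}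
    (hy : y ∈ (extChartAt (𝓡 n) x₀).target) (X : E n) (τ : Tractor n) :
    tractorForm g x₀ y X τ = tractorTerm (coordMetric g x₀) y X τ :=
  (exists_tractorForm (isMetricOn_coordMetric g x₀)).choose_spec.2 y hy X τ

/-- Reading a tractor at `x` in the chart centred at `x₀`. -/
def chartT (x₀ x : M) : Tractor n →L[ℝ] Tractor n :=
  (ContinuousLinearMap.id ℝ ℝ).prodMap ((chartD x₀ x).prodMap (ContinuousLinearMap.id ℝ ℝ))

/-- The tractor with given components in the chart centred at `x₀`. -/
def chartTInv (x₀ : M) (y : E n) : Tractor n →L[ℝ] Tractor n :=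
  (ContinuousLinearMap.id ℝ ℝ).prodMap ((chartDInv x₀ y).prodMap (ContinuousLinearMap.id ℝ ℝ))

theorem chartT_apply (x₀ x : M) (τ : Tractor n) :
    chartT x₀ x τ = (τ.1, chartD x₀ x τ.2.1, τ.2.2) := rfl

theorem chartTInv_apply (x₀ : M) (y : E n) (τ : Tractor n) :
    chartTInv x₀ y τ = (τ.1, chartDInv x₀ y τ.2.1, τ.2.2) := rfl

theorem chartT_self (x : M) (τ : Tractor n) : chartT x x τ = τ := by
  rw [chartT_apply, chartD_self]
  rfl

theorem chartT_chartTInv {x₀ : M} {y : E n} (hy : y ∈ (extChartAt (𝓡 n) x₀).target)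
    (τ : Tractor n) : chartT x₀ ((extChartAt (𝓡 n) x₀).symm y) (chartTInv x₀ y τ) = τ := by
  rw [chartT_apply, chartTInv_apply, chartD_chartDInv hy]

theorem chartTInv_chartT {x₀ x : M} (hx : x ∈ (extChartAt (𝓡 n) x₀).source)
    (τ : Tractor n) : chartTInv x₀ (extChartAt (𝓡 n) x₀ x) (chartT x₀ x τ) = τ := by
  rw [chartTInv_apply, chartT_apply, chartDInv_chartD hx]

theorem chartTInv_self (x : M) (τ : Tractor n) :
    chartTInv x (extChartAt (𝓡 n) x x) τ = τ := by
  simpa [chartT_self] using chartTInv_chartT (mem_extChartAt_source (I := 𝓡 n) x) τ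

theorem hasDerivAt_tractor_iff {τ : ℝ → Tractor n} {τ' : Tractor n} {t : ℝ} :
    HasDerivAt τ τ' t ↔ HasDerivAt (fun s => (τ s).1) τ'.1 t ∧
      HasDerivAt (fun s => (τ s).2.1) τ'.2.1 t ∧ HasDerivAt (fun s => (τ s).2.2) τ'.2.2 t := by
  constructor
  · intro h
    have h2 : HasDerivAt (fun s => (τ s).2) τ'.2 t :=
      (ContinuousLinearMap.snd ℝ ℝ (E n × ℝ)).hasFDerivAt.comp_hasDerivAt t h
    exact ⟨(ContinuousLinearMap.fst ℝ ℝ (E n × ℝ)).hasFDerivAt.comp_hasDerivAt t h,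
      (ContinuousLinearMap.fst ℝ (E n) ℝ).hasFDerivAt.comp_hasDerivAt t h2,
      (ContinuousLinearMap.snd ℝ (E n) ℝ).hasFDerivAt.comp_hasDerivAt t h2⟩
  · rintro ⟨h1, h2, h3⟩
    exact h1.prodMk (h2.prodMk h3)

/-- The three component equations form one linear equation. The chart differential at the centre `γ
t` is the identity, so `τ t` enters the right-hand side unchanged. -/
theorem isParallelAt_iff {g : Metric n p q M} {γ : ℝ → M} {τ : ℝ → Tractor n} {t : ℝ} :
    IsParallelAt g γ τ t ↔ HasDerivAt (fun s => chartT (γ t) (γ s) (τ s))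
      (-(tractorForm g (γ t) (extChartAt (𝓡 n) (γ t) (γ t))
        (deriv (fun s => extChartAt (𝓡 n) (γ t) (γ s)) t) (τ t))) t := by
  rw [hasDerivAt_tractor_iff, tractorForm_apply g (mem_extChartAt_target _)]
  simp only [tractorTerm, chartT_apply, Prod.fst_neg, Prod.snd_neg, neg_neg]
  constructor
  · intro h
    refine ⟨h.top, ?_, h.bot⟩
    convert! h.mid using 1
    abel
  · rintro ⟨h1, h2, h3⟩
    refine ⟨h1, ?_, h3⟩
    convert! h2 using 1
    abel

/-- `IsParallelAt` uses a chart that moves with `t`, whereas solving the equation needs a fixed one.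
On changing charts, the derivative of the transition differential along the curve cancels the
inhomogeneous term of the Christoffel symbols. -/
theorem isParallelAt_of_chart {g : Metric n p q M} {γ : ℝ → M} {τ : ℝ → Tractor n} {t : ℝ}
    {x₀ : M} {c' : E n} (hx : γ t ∈ (extChartAt (𝓡 n) x₀).source) (hγ : ContinuousAt γ t)
    (hc : HasDerivAt (fun s => extChartAt (𝓡 n) x₀ (γ s)) c' t)
    (hτ : HasDerivAt (fun s => chartT x₀ (γ s) (τ s))
      (-(tractorForm g x₀ (extChartAt (𝓡 n) x₀ (γ t)) c' (chartT x₀ (γ t) (τ t)))) t) :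
    IsParallelAt g γ τ t := by
  have hP := isPullback_transition g x₀ (γ t)
  have hy : extChartAt (𝓡 n) x₀ (γ t) ∈ overlap n x₀ (γ t) := by
    rw [mem_overlap, (extChartAt (𝓡 n) x₀).left_inv hx]
    exact ⟨(extChartAt (𝓡 n) x₀).map_source hx, mem_extChartAt_source _⟩
  have hχ : transition n x₀ (γ t) (extChartAt (𝓡 n) x₀ (γ t)) = extChartAt (𝓡 n) (γ t) (γ t) := by
    rw [transition, Function.comp_apply, (extChartAt (𝓡 n) x₀).left_inv hx]
  have hnear : ∀ᶠ s in 𝓝 t, γ s ∈ (extChartAt (𝓡 n) x₀).source ∧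
      γ s ∈ (extChartAt (𝓡 n) (γ t)).source :=
    (hγ.eventually ((isOpen_extChartAt_source x₀).mem_nhds hx)).and
      (hγ.eventually ((isOpen_extChartAt_source (γ t)).mem_nhds (mem_extChartAt_source _)))
  set D := fderiv ℝ (transition n x₀ (γ t)) with hD
  have hDc : HasDerivAt (fun s => D (extChartAt (𝓡 n) x₀ (γ s)))
      (fderiv ℝ D (extChartAt (𝓡 n) x₀ (γ t)) c') t :=
    (hP.hasFDerivAt_fderiv hy).comp_hasDerivAt t hc
  have hc1 : HasDerivAt (fun s => extChartAt (𝓡 n) (γ t) (γ s))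
      (D (extChartAt (𝓡 n) x₀ (γ t)) c') t := by
    refine ((hP.hasFDerivAt hy).comp_hasDerivAt t hc).congr_of_eventuallyEq ?_
    filter_upwards [hnear] with s hs
    rw [transition, Function.comp_apply, Function.comp_apply,
      (extChartAt (𝓡 n) x₀).left_inv hs.1]
  rw [isParallelAt_iff, hc1.deriv]
  rw [hasDerivAt_tractor_iff, tractorForm_apply g (mem_extChartAt_target _)]
  rw [hasDerivAt_tractor_iff, tractorForm_apply g (mem_overlap.1 hy).1] at hτ
  obtain ⟨h1, h2, h3⟩ := hτ
  simp only [tractorTerm, chartT_apply, Prod.fst_neg, Prod.snd_neg, neg_neg] at h1 h2 h3 ⊢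
  set Y := chartD x₀ (γ t) (τ t).2.1 with hY
  have hYt : (τ t).2.1 = D (extChartAt (𝓡 n) x₀ (γ t)) Y := by
    rw [hY, hD, ← chartD_eq_fderiv_transition hx (mem_extChartAt_source _), chartD_self]
    rfl
  rw [hYt, ← hχ, ← hP.schouten hy, ← hP.eq _ hy]
  refine ⟨h1, ?_, h3⟩
  refine ((hDc.clm_apply h2).congr_of_eventuallyEq ?_).congr_deriv ?_
  · filter_upwards [hnear] with s hs
    exact chartD_eq_fderiv_transition hs.1 hs.2 _
  · rw [← hP.schoutenEnd hy, map_neg, map_add, map_add, hP.christoffel hy, map_smul, map_smul]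
    abel

/-- Parallel transport is isometric, infinitesimally. -/
theorem hasDerivAt_tractorMetric {g : Metric n p q M} {γ : ℝ → M} {τ τ' : ℝ → Tractor n} {t : ℝ}
    (hγ : ContinuousAt γ t)
    (hc : DifferentiableAt ℝ (fun s => extChartAt (𝓡 n) (γ t) (γ s)) t)
    (h : IsParallelAt g γ τ t) (h' : IsParallelAt g γ τ' t) :
    HasDerivAt (fun s => tractorMetric g (γ s) (τ s) (τ' s)) 0 t := by
  have hM := isMetricOn_coordMetric g (γ t)
  have hy := mem_extChartAt_target (I := 𝓡 n) (γ t)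
  have hG := (hM.differentiableAt hy).hasFDerivAt.comp_hasDerivAt t hc.hasDerivAt
  have hmid := (hG.clm_apply h.mid).clm_apply h'.mid
  have hall := ((h.top.mul h'.bot).add (h'.top.mul h.bot)).add hmid
  refine (hall.congr_of_eventuallyEq ?_).congr_deriv ?_
  · filter_upwards [hγ.eventually ((isOpen_extChartAt_source (γ t)).mem_nhds
      (mem_extChartAt_source (I := 𝓡 n) (γ t)))] with s hs
    change (τ s).1 * (τ' s).2.2 + (τ' s).1 * (τ s).2.2 + g.val (γ s) (τ s).2.1 (τ' s).2.1 = _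
    rw [metric_eq_coordMetric g hs]
    rfl
  · have hid : ∀ v : E n,
        (mfderiv (𝓡 n) 𝓘(ℝ, E n) (extChartAt (𝓡 n) (γ t)) (γ t) : E n →L[ℝ] E n) v = v := fun v => by
      change chartD (γ t) (γ t) v = v
      rw [chartD_self]
      rfl
    have e1 := fderiv_metric_eq hM hy (deriv (fun s => extChartAt (𝓡 n) (γ t) (γ s)) t)
      (τ t).2.1 (τ' t).2.1
    have e2 := schoutenEnd_spec hM hy (deriv (fun s => extChartAt (𝓡 n) (γ t) (γ s)) t)
      (τ' t).2.1
    have e3 := schoutenEnd_spec hM hy (deriv (fun s => extChartAt (𝓡 n) (γ t) (γ s)) t)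
      (τ t).2.1
    rw [hM.symm _ hy] at e3
    have e4 := hM.symm _ hy (τ t).2.1 (deriv (fun s => extChartAt (𝓡 n) (γ t) (γ s)) t)
    simp only [Function.comp_apply]
    erw [hid, hid]
    simp only [add_apply, map_sub, map_neg, map_smul, neg_apply, smul_apply, sub_apply,
      smul_eq_mul]
    rw [e1, e2, e3, e4]
    ring

theorem tendsto_tangent_iff {α : Type*} {l : Filter α} {b : α → M} {v : α → E n} {x₀ x : M}
    {u : E n} (hx : x ∈ (extChartAt (𝓡 n) x₀).source) :
    Filter.Tendsto (fun a => (Bundle.TotalSpace.mk (b a) (v a) : TangentBundle (𝓡 n) M)) l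
      (𝓝 (Bundle.TotalSpace.mk x u)) ↔
    Filter.Tendsto b l (𝓝 x) ∧
      Filter.Tendsto (fun a => chartD x₀ (b a) (v a)) l (𝓝 (chartD x₀ x u)) := by
  have hx' := hx
  rw [extChartAt_source] at hx'
  rw [(trivializationAt (E n) (TangentSpace (𝓡 n)) x₀).tendsto_nhds_iff (by simpa using hx')]
  refine and_congr_right fun hb => ?_
  have hb' : Filter.Tendsto b l (𝓝 x) := hb
  have e : 𝓝 (trivializationAt (E n) (TangentSpace (𝓡 n)) x₀ ⟨x, u⟩).2 = 𝓝 (chartD x₀ x u) :=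
    congrArg 𝓝 (trivializationAt_eq_chartD hx u)
  refine (Filter.tendsto_congr' (f₂ := fun a => chartD x₀ (b a) (v a)) ?_).trans
    (iff_of_eq (congrArg (Filter.Tendsto _ l) e))
  filter_upwards [hb'.eventually ((isOpen_extChartAt_source x₀).mem_nhds hx)] with a ha
  exact trivializationAt_eq_chartD ha _

theorem continuousOn_tractorMetric {g : Metric n p q M} {γ : ℝ → M} {τ τ' : ℝ → Tractor n}
    {s : Set ℝ} (h1 : ContinuousOn (fun t => (τ t).1) s)
    (h2 : ContinuousOn
      (fun t => (Bundle.TotalSpace.mk (γ t) (τ t).2.1 : TangentBundle (𝓡 n) M)) s)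
    (h3 : ContinuousOn (fun t => (τ t).2.2) s)
    (h1' : ContinuousOn (fun t => (τ' t).1) s)
    (h2' : ContinuousOn
      (fun t => (Bundle.TotalSpace.mk (γ t) (τ' t).2.1 : TangentBundle (𝓡 n) M)) s)
    (h3' : ContinuousOn (fun t => (τ' t).2.2) s) :
    ContinuousOn (fun t => tractorMetric g (γ t) (τ t) (τ' t)) s := by
  refine ((h1.mul h3').add (h1'.mul h3)).add fun t ht => ?_
  have hx := mem_extChartAt_source (I := 𝓡 n) (γ t)
  obtain ⟨hb, hv⟩ := (tendsto_tangent_iff hx).1 (h2 t ht)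
  obtain ⟨-, hv'⟩ := (tendsto_tangent_iff hx).1 (h2' t ht)
  have hG : ContinuousWithinAt (fun a => coordMetric g (γ t) (extChartAt (𝓡 n) (γ t) (γ a))) s t :=
    (((isMetricOn_coordMetric g (γ t)).smooth.contDiffAt
      ((isOpen_extChartAt_target (γ t)).mem_nhds (mem_extChartAt_target _))).continuousAt).tendsto.comp
      ((continuousAt_extChartAt (I := 𝓡 n) (γ t)).tendsto.comp hb)
  have hv : ContinuousWithinAt (fun a => chartD (γ t) (γ a) (τ a).2.1) s t := hv
  have hv' : ContinuousWithinAt (fun a => chartD (γ t) (γ a) (τ' a).2.1) s t := hv'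
  refine ((hG.clm_apply hv).clm_apply hv').congr_of_eventuallyEq ?_
    (metric_eq_coordMetric g hx _ _)
  filter_upwards [hb.eventually ((isOpen_extChartAt_source (γ t)).mem_nhds hx)] with a ha
  exact metric_eq_coordMetric g ha _ _

end ParallelCharts

/-! ### Transport along paths: isometry, concatenation, reversal, conjugation. -/

section Reparametrization

variable {n p q : ℕ} {M : Type*} [TopologicalSpace M] [ChartedSpace (E n) M]
  [IsManifold (𝓡 n) ∞ M]

theorem IsParallelAt.congr {g : Metric n p q M} {γ γ' : ℝ → M} {τ τ' : ℝ → Tractor n} {t : ℝ}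
    (h : IsParallelAt g γ τ t) (hγ : γ' =ᶠ[𝓝 t] γ) (hτ : τ' =ᶠ[𝓝 t] τ) :
    IsParallelAt g γ' τ' t := by
  rw [isParallelAt_iff] at h ⊢
  have h1 : (fun s => extChartAt (𝓡 n) (γ t) (γ' s)) =ᶠ[𝓝 t]
      fun s => extChartAt (𝓡 n) (γ t) (γ s) := hγ.fun_comp _
  rw [hγ.eq_of_nhds, hτ.eq_of_nhds, h1.deriv_eq]
  refine h.congr_of_eventuallyEq ?_
  filter_upwards [hγ, hτ] with s hs hs'
  rw [hs, hs']

/-- Both sides of the parallel equation scale by `a`. Positive `a` serves concatenation, `a = -1`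
serves reversal. -/
theorem IsParallelAt.comp_affine {g : Metric n p q M} {γ : ℝ → M} {τ : ℝ → Tractor n}
    {a b t : ℝ} (h : IsParallelAt g γ τ (a * t + b)) :
    IsParallelAt g (fun s => γ (a * s + b)) (fun s => τ (a * s + b)) t := by
  rw [isParallelAt_iff] at h ⊢
  have hd : deriv (fun s => extChartAt (𝓡 n) (γ (a * t + b)) (γ (a * s + b))) t =
      a • deriv (fun s => extChartAt (𝓡 n) (γ (a * t + b)) (γ s)) (a * t + b) := by
    rw [deriv_comp_mul_left a (fun s => extChartAt (𝓡 n) (γ (a * t + b)) (γ (s + b))) t,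
      deriv_comp_add_const (fun s => extChartAt (𝓡 n) (γ (a * t + b)) (γ s)) b]
  have ha : HasDerivAt (fun s : ℝ => a * s + b) a t := by
    simpa using ((hasDerivAt_id t).const_mul a).add_const b
  refine (h.scomp t ha).congr_deriv ?_
  rw [hd, map_smul, smul_apply, smul_neg]

theorem IsPiecewiseSmooth.exists_finset {γ : ℝ → M} (h : IsPiecewiseSmooth (n := n) γ) :
    ∃ F : Finset ℝ, ∀ t ∈ Ioo (0 : ℝ) 1, t ∉ F → ContMDiffAt 𝓘(ℝ, ℝ) (𝓡 n) ∞ γ t := by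
  obtain ⟨F, hF⟩ := h
  refine ⟨F, fun t ht htF => ?_⟩
  have hU : (F : Set ℝ)ᶜ ∩ Ioo 0 1 ∈ 𝓝 t :=
    ((F.finite_toSet.isClosed.isOpen_compl).inter isOpen_Ioo).mem_nhds ⟨htF, ht⟩
  obtain ⟨ε, hε, hball⟩ := Metric.mem_nhds_iff.1 hU
  have hsub : Icc (t - ε / 2) (t + ε / 2) ⊆ (F : Set ℝ)ᶜ ∩ Ioo 0 1 := by
    intro s hs
    apply hball
    rw [Metric.mem_ball, Real.dist_eq, abs_lt]
    constructor <;> linarith [hs.1, hs.2]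
  have h1 := (hsub (left_mem_Icc.2 (by linarith))).2.1
  have h2 := (hsub (right_mem_Icc.2 (by linarith))).2.2
  refine (hF (t - ε / 2) (t + ε / 2) h1.le (by linarith) h2.le ?_).contMDiffAt
    (Icc_mem_nhds (by linarith) (by linarith))
  intro s hs hs'
  exact (hsub (Ioo_subset_Icc_self hs')).1 hs

/-- `A` is the parallel transport of tractors along the piecewise smooth path `γ`. -/
def IsTransport (g : Metric n p q M) {x y : M} (γ : Path x y)
    (A : Tractor n →L[ℝ] Tractor n) : Prop :=
  IsPiecewiseSmooth (n := n) γ.extend ∧ ∀ v : Tractor n, ∃ τ : ℝ → Tractor n,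
    IsParallelAlong g γ.extend τ ∧ τ 0 = v ∧ τ 1 = A v

theorem mem_holonomy0 {g : Metric n p q M} {x : M} {A : Tractor n →L[ℝ] Tractor n} :
    A ∈ holonomy0 g x ↔ ∃ γ : Path x x, IsTransport g γ A ∧ γ.Homotopic (Path.refl x) :=
  ⟨fun ⟨γ, h1, h2, h3⟩ => ⟨γ, ⟨h1, h3⟩, h2⟩, fun ⟨γ, ⟨h1, h3⟩, h2⟩ => ⟨γ, h1, h2, h3⟩⟩

/-- The scalar product of two parallel fields is continuous on `[0, 1]` with zero derivative off a
finite set, so the difference of its end values is the integral of zero. -/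
theorem IsTransport.isometry {g : Metric n p q M} {x y : M} {γ : Path x y}
    {A : Tractor n →L[ℝ] Tractor n} (h : IsTransport g γ A) (v w : Tractor n) :
    tractorMetric g y (A v) (A w) = tractorMetric g x v w := by
  obtain ⟨τ, ⟨c1, c2, c3, F, hF⟩, h0, h1⟩ := h.2 v
  obtain ⟨τ', ⟨c1', c2', c3', F', hF'⟩, h0', h1'⟩ := h.2 w
  obtain ⟨F'', hF''⟩ := h.1.exists_finset
  have hint := intervalIntegral.integral_zero (μ := MeasureTheory.volume) (a := 0) (b := 1) (E := ℝ)
  rw [MeasureTheory.integral_eq_of_hasDerivAt_off_countable_of_le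
    (fun t => tractorMetric g (γ.extend t) (τ t) (τ' t)) (fun _ => 0) zero_le_one
    (s := F ∪ F' ∪ F'') (Set.Countable.union (Set.Countable.union F.countable_toSet
      F'.countable_toSet) F''.countable_toSet)
    (continuousOn_tractorMetric c1 c2 c3 c1' c2' c3') ?_ (by simp)] at hint
  · rw [h0, h1, h0', h1', Path.extend_zero, Path.extend_one] at hint
    linarith
  · rintro t ⟨ht, htF⟩
    simp only [mem_union, Finset.mem_coe, not_or] at htF
    have hs := hF'' t ht htF.2
    refine hasDerivAt_tractorMetric hs.continuousAt ?_ (hF t ht htF.1.1) (hF' t ht htF.1.2)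
    have h2 := (mdifferentiableAt_extChartAt (I := 𝓡 n)
      (mem_chart_source (E n) (γ.extend t))).comp t (hs.mdifferentiableAt (by simp))
    exact h2.differentiableAt

theorem isPiecewiseSmooth_refl (x : M) : IsPiecewiseSmooth (n := n) (Path.refl x).extend :=
  ⟨∅, fun _ _ _ _ _ _ => contMDiffOn_const⟩

theorem isTransport_refl (g : Metric n p q M) (x : M) :
    IsTransport g (Path.refl x) (ContinuousLinearMap.id ℝ (Tractor n)) := by
  refine ⟨isPiecewiseSmooth_refl x, fun (v : Tractor n) => ⟨fun _ => v, ⟨continuousOn_const, ?_,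
    continuousOn_const, ∅, fun t _ _ => ?_⟩, rfl, rfl⟩⟩
  · exact continuousOn_const (c := (Bundle.TotalSpace.mk x v.2.1 : TangentBundle (𝓡 n) M))
  · rw [isParallelAt_iff]
    simp only [Path.refl_extend, ContinuousMap.const_apply, deriv_const, map_zero, zero_apply,
      neg_zero]
    exact hasDerivAt_const _ _

theorem continuousOn_Icc_of_halves {X : Type*} [TopologicalSpace X] {f f₁ f₂ : ℝ → X}
    (h₁ : ContinuousOn f₁ (Icc 0 1)) (h₂ : ContinuousOn f₂ (Icc 0 1))
    (e₁ : ∀ t ≤ 1 / 2, f t = f₁ (2 * t)) (e₂ : ∀ t ≥ 1 / 2, f t = f₂ (2 * t - 1)) :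
    ContinuousOn f (Icc 0 1) := by
  rw [← Icc_union_Icc_eq_Icc (b := (1 / 2 : ℝ)) (by norm_num) (by norm_num)]
  refine ContinuousOn.union_of_isClosed ?_ ?_ isClosed_Icc isClosed_Icc
  · refine ContinuousOn.congr (f := fun t => f₁ (2 * t)) ?_ fun t ht => e₁ t ht.2
    exact h₁.comp (by fun_prop) fun t ht => ⟨by linarith [ht.1], by linarith [ht.2]⟩
  · refine ContinuousOn.congr (f := fun t => f₂ (2 * t - 1)) ?_ fun t ht => e₂ t ht.1
    exact h₂.comp (by fun_prop) fun t ht => ⟨by linarith [ht.1], by linarith [ht.2]⟩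

theorem continuousOn_Icc_reverse {X : Type*} [TopologicalSpace X] {f : ℝ → X}
    (h : ContinuousOn f (Icc 0 1)) : ContinuousOn (fun t => f (1 - t)) (Icc 0 1) :=
  h.comp (by fun_prop) fun t ht => ⟨by linarith [ht.2], by linarith [ht.1]⟩

theorem IsPiecewiseSmooth.trans {x y z : M} {γ : Path x y} {γ' : Path y z}
    (h : IsPiecewiseSmooth (n := n) γ.extend) (h' : IsPiecewiseSmooth (n := n) γ'.extend) :
    IsPiecewiseSmooth (n := n) (γ.trans γ').extend := by
  classical
  obtain ⟨F, hF⟩ := h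
  obtain ⟨F', hF'⟩ := h'
  -- Listing the joint `1 / 2` as a break point forces every admissible interval into one of the two
  -- halves.
  refine ⟨insert (1 / 2) (F.image (fun t => t / 2) ∪ F'.image (fun t => (t + 1) / 2)), ?_⟩
  intro a b ha hab hb hab'
  have hhalf := hab' (1 / 2) (by simp)
  rw [mem_Ioo, not_and_or, not_lt, not_lt] at hhalf
  rcases hhalf with hhalf | hhalf
  · refine ContMDiffOn.congr (f := fun t => γ'.extend (2 * t - 1)) ?_
      fun t ht => Path.extend_trans_of_half_le _ _ (hhalf.trans ht.1)
    refine (hF' (2 * a - 1) (2 * b - 1) (by linarith) (by linarith) (by linarith) ?_).comp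
      (ContDiff.contMDiff (by fun_prop)).contMDiffOn
      fun t ht => ⟨by linarith [ht.1], by linarith [ht.2]⟩
    intro t ht ht'
    refine hab' ((t + 1) / 2) (Finset.mem_insert_of_mem (Finset.mem_union_right _
      (Finset.mem_image_of_mem _ ht))) ⟨by linarith [ht'.1], by linarith [ht'.2]⟩
  · refine ContMDiffOn.congr (f := fun t => γ.extend (2 * t)) ?_
      fun t ht => Path.extend_trans_of_le_half _ _ (ht.2.trans hhalf)
    refine (hF (2 * a) (2 * b) (by linarith) (by linarith) (by linarith) ?_).comp
      (ContDiff.contMDiff (by fun_prop)).contMDiffOn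
      fun t ht => ⟨by linarith [ht.1], by linarith [ht.2]⟩
    intro t ht ht'
    refine hab' (t / 2) (Finset.mem_insert_of_mem (Finset.mem_union_left _
      (Finset.mem_image_of_mem _ ht))) ⟨by linarith [ht'.1], by linarith [ht'.2]⟩

theorem IsPiecewiseSmooth.symm {x y : M} {γ : Path x y}
    (h : IsPiecewiseSmooth (n := n) γ.extend) : IsPiecewiseSmooth (n := n) γ.symm.extend := by
  classical
  obtain ⟨F, hF⟩ := h
  refine ⟨F.image (fun t => 1 - t), fun a b ha hab hb hab' => ?_⟩
  refine ContMDiffOn.congr (f := fun t => γ.extend (1 - t)) ?_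
      fun t _ => Path.extend_symm_apply _ _
  refine (hF (1 - b) (1 - a) (by linarith) (by linarith) (by linarith) ?_).comp
    (ContDiff.contMDiff (by fun_prop)).contMDiffOn
    fun t ht => ⟨by linarith [ht.2], by linarith [ht.1]⟩
  intro t ht ht'
  exact hab' (1 - t) (Finset.mem_image_of_mem _ ht) ⟨by linarith [ht'.2], by linarith [ht'.1]⟩

theorem IsTransport.trans {g : Metric n p q M} {x y z : M} {γ : Path x y} {γ' : Path y z}
    {A B : Tractor n →L[ℝ] Tractor n} (h : IsTransport g γ A) (h' : IsTransport g γ' B) :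
    IsTransport g (γ.trans γ') (B ∘L A) := by
  classical
  refine ⟨h.1.trans h'.1, fun v => ?_⟩
  obtain ⟨τ₁, ⟨c1, c2, c3, F, hF⟩, h0, h1⟩ := h.2 v
  obtain ⟨τ₂, ⟨c1', c2', c3', F', hF'⟩, h0', h1'⟩ := h'.2 (A v)
  let τ : ℝ → Tractor n := fun t => if t ≤ 1 / 2 then τ₁ (2 * t) else τ₂ (2 * t - 1)
  have e₁ : ∀ t ≤ 1 / 2, τ t = τ₁ (2 * t) := fun t ht => if_pos ht
  have e₂ : ∀ t ≥ 1 / 2, τ t = τ₂ (2 * t - 1) := by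
    intro t ht
    rcases eq_or_lt_of_le ht with rfl | ht
    · rw [e₁ _ le_rfl]
      norm_num [h1, h0']
    · exact if_neg (not_le.2 ht)
  refine ⟨τ, ⟨?_, ?_, ?_, ?_⟩, ?_, ?_⟩
  · exact continuousOn_Icc_of_halves c1 c1' (fun t ht => by rw [e₁ t ht])
      (fun t ht => by rw [e₂ t ht])
  · exact continuousOn_Icc_of_halves c2 c2'
      (fun t ht => by rw [e₁ t ht, Path.extend_trans_of_le_half _ _ ht])
      (fun t ht => by rw [e₂ t ht, Path.extend_trans_of_half_le _ _ ht])
  · exact continuousOn_Icc_of_halves c3 c3' (fun t ht => by rw [e₁ t ht])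
      (fun t ht => by rw [e₂ t ht])
  · refine ⟨insert (1 / 2) (F.image (fun t => t / 2) ∪ F'.image (fun t => (t + 1) / 2)), ?_⟩
    intro t ht htF
    simp only [Finset.mem_insert, Finset.mem_union, Finset.mem_image, not_or] at htF
    obtain ⟨hne, hF1, hF2⟩ := htF
    rcases lt_or_gt_of_ne hne with hlt | hlt
    · have hp : IsParallelAt g γ.extend τ₁ (2 * t + 0) := by
        refine hF _ ⟨by linarith [ht.1], by linarith⟩ fun hm => hF1 ⟨_, hm, by ring⟩
      refine hp.comp_affine.congr ?_ ?_
      · filter_upwards [Iio_mem_nhds hlt] with s hs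
        rw [Path.extend_trans_of_le_half _ _ (le_of_lt hs), add_zero]
      · filter_upwards [Iio_mem_nhds hlt] with s hs
        rw [e₁ s (le_of_lt hs), add_zero]
    · have hp : IsParallelAt g γ'.extend τ₂ (2 * t + (-1)) := by
        refine hF' _ ⟨by linarith, by linarith [ht.2]⟩ fun hm => hF2 ⟨_, hm, by ring⟩
      refine hp.comp_affine.congr ?_ ?_
      · filter_upwards [Ioi_mem_nhds hlt] with s hs
        rw [Path.extend_trans_of_half_le _ _ (le_of_lt hs), sub_eq_add_neg]
      · filter_upwards [Ioi_mem_nhds hlt] with s hs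
        rw [e₂ s (le_of_lt hs), sub_eq_add_neg]
  · rw [e₁ 0 (by norm_num), mul_zero, h0]
  · rw [e₂ 1 (by norm_num)]
    norm_num [h1']

theorem IsTransport.symm {g : Metric n p q M} {x y : M} {γ : Path x y}
    {A : Tractor n ≃L[ℝ] Tractor n} (h : IsTransport g γ A) :
    IsTransport g γ.symm (A.symm : Tractor n →L[ℝ] Tractor n) := by
  classical
  refine ⟨h.1.symm, fun v => ?_⟩
  obtain ⟨τ, ⟨c1, c2, c3, F, hF⟩, h0, h1⟩ := h.2 (A.symm v)
  refine ⟨fun t => τ (1 - t), ⟨continuousOn_Icc_reverse c1, ?_, continuousOn_Icc_reverse c3,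
    F.image (fun t => 1 - t), ?_⟩, ?_, ?_⟩
  · exact (continuousOn_Icc_reverse c2).congr fun t _ => by rw [Path.extend_symm_apply]
  · intro t ht htF
    have hp : IsParallelAt g γ.extend τ ((-1) * t + 1) :=
      hF _ ⟨by linarith [ht.2], by linarith [ht.1]⟩ fun hm =>
        htF (Finset.mem_image.2 ⟨_, hm, by ring⟩)
    refine hp.comp_affine.congr (.of_forall fun s => ?_) (.of_forall fun s => ?_)
    · simp only [Path.extend_symm_apply]
      ring_nf
    · ring_nf
  · simpa using h1
  · simpa using h0

theorem one_mem_holonomy0 (g : Metric n p q M) (x : M) :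
    ContinuousLinearMap.id ℝ (Tractor n) ∈ holonomy0 g x :=
  mem_holonomy0.2 ⟨_, isTransport_refl g x, .refl _⟩

theorem comp_mem_holonomy0 {g : Metric n p q M} {x : M} {A B : Tractor n →L[ℝ] Tractor n}
    (hA : A ∈ holonomy0 g x) (hB : B ∈ holonomy0 g x) : A ∘L B ∈ holonomy0 g x := by
  obtain ⟨γ, h, hγ⟩ := mem_holonomy0.1 hA
  obtain ⟨δ, h', hδ⟩ := mem_holonomy0.1 hB
  refine mem_holonomy0.2 ⟨δ.trans γ, h'.trans h, ?_⟩
  simpa using hδ.hcomp hγ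

/-- Conjugation by parallel transport identifies holonomy groups. -/
theorem IsTransport.conj_mem_holonomy0 {g : Metric n p q M} {x y : M} {γ : Path x y}
    {P : Tractor n ≃L[ℝ] Tractor n} (h : IsTransport g γ P) {A : Tractor n →L[ℝ] Tractor n}
    (hA : A ∈ holonomy0 g y) :
    (P.symm : Tractor n →L[ℝ] Tractor n) ∘L A ∘L (P : Tractor n →L[ℝ] Tractor n)
      ∈ holonomy0 g x := by
  obtain ⟨δ, h', hδ⟩ := mem_holonomy0.1 hA
  refine mem_holonomy0.2 ⟨(γ.trans δ).trans γ.symm, (h.trans h').trans h.symm, ?_⟩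
  have h1 : ((γ.trans δ).trans γ.symm).Homotopic ((γ.trans (Path.refl y)).trans γ.symm) :=
    ((Path.Homotopic.refl γ).hcomp hδ).hcomp (.refl _)
  have h2 : ((γ.trans (Path.refl y)).trans γ.symm).Homotopic (γ.trans γ.symm) :=
    Path.Homotopic.hcomp ⟨Path.Homotopy.transRefl γ⟩ (.refl _)
  exact (h1.trans h2).trans ⟨(Path.Homotopy.reflTransSymm γ).symm⟩

theorem isometry_of_mem_holonomy0 {g : Metric n p q M} {x : M} {A : Tractor n →L[ℝ] Tractor n}
    (hA : A ∈ holonomy0 g x) (v w : Tractor n) :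
    tractorMetric g x (A v) (A w) = tractorMetric g x v w := by
  obtain ⟨γ, h, -⟩ := mem_holonomy0.1 hA
  exact h.isometry v w

end Reparametrization

/-! ### Linear equations along short segments and differentiability in the segment. -/

section LinearODE

open scoped NNReal

/-- Grönwall with rate `1 / 2` on the unit interval; the growth factor is at most `2` because its
square is `e < 4`. -/
theorem norm_le_of_hasDerivWithinAt_le_half {F : Type*} [NormedAddCommGroup F] [NormedSpace ℝ F]
    {f f' : ℝ → F} {δ ε : ℝ} (hδ : 0 ≤ δ) (hε : 0 ≤ ε)
    (hf : ∀ t ∈ Icc (0 : ℝ) 1, HasDerivWithinAt f (f' t) (Icc 0 1) t) (h0 : ‖f 0‖ ≤ δ)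
    (bound : ∀ t ∈ Ico (0 : ℝ) 1, ‖f' t‖ ≤ 1 / 2 * ‖f t‖ + ε) {t : ℝ} (ht : t ∈ Icc (0 : ℝ) 1) :
    ‖f t‖ ≤ 2 * δ + 2 * ε := by
  have h := norm_le_gronwallBound_of_norm_deriv_right_le
    (fun t ht => (hf t ht).continuousWithinAt)
    (fun t ht => (hf t (Ico_subset_Icc_self ht)).mono_of_mem_nhdsWithin (Icc_mem_nhdsGE_of_mem ht))
    h0 bound t ht
  have h2 := gronwallBound_mono hδ hε (by norm_num : (0 : ℝ) ≤ 1 / 2)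
    (show t - 0 ≤ 1 by linarith [ht.2])
  rw [gronwallBound_of_K_ne_0 (by norm_num : (1 / 2 : ℝ) ≠ 0)] at h2 h
  have he : Real.exp (1 / 2 * 1) ≤ 2 := by
    have h3 : Real.exp (1 / 2 * 1) * Real.exp (1 / 2 * 1) = Real.exp 1 := by
      rw [← Real.exp_add]
      norm_num
    nlinarith [Real.exp_one_lt_d9, Real.exp_pos (1 / 2 * 1)]
  refine h.trans (h2.trans ?_)
  dsimp only
  have : ε / (1 / 2) = 2 * ε := by ring
  rw [this]
  nlinarith

variable {V R : Type*} [NormedAddCommGroup V] [NormedSpace ℝ V] [NormedRing R] [NormedAlgebra ℝ R]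
  [CompleteSpace R] [NormOneClass R]

/-- `U` is the fundamental solution of `U' = -B(y₀ + tξ)(ξ) U` on `[0, 1]`. -/
def IsFundamental (B : V → V →L[ℝ] R) (y₀ ξ : V) (U : ℝ → R) : Prop :=
  U 0 = 1 ∧ ∀ t ∈ Icc (0 : ℝ) 1,
    HasDerivWithinAt U (-(B (y₀ + t • ξ) ξ) * U t) (Icc 0 1) t

/-- The smallness of `ξ` lets one Picard–Lindelöf step cover `[0, 1]`: in the unit ball about `1`
one has `‖u‖ ≤ 2`, so the field is bounded by `1 / 2 * 2 = 1`. -/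
theorem exists_isFundamental {B : V → V →L[ℝ] R} {y₀ ξ : V} {C r : ℝ}
    (hB : ContinuousOn B (Metric.ball y₀ r))
    (hC : ∀ y ∈ Metric.ball y₀ r, ‖B y‖ ≤ C) (hξ : ‖ξ‖ < r) (hCξ : C * ‖ξ‖ ≤ 1 / 2) :
    ∃ U, IsFundamental B y₀ ξ U := by
  have hmem : ∀ t ∈ Icc (0 : ℝ) 1, y₀ + t • ξ ∈ Metric.ball y₀ r := by
    intro t ht
    rw [mem_ball_iff_norm, add_sub_cancel_left, norm_smul, Real.norm_of_nonneg ht.1]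
    nlinarith [norm_nonneg ξ, ht.2]
  have hA : ∀ t ∈ Icc (0 : ℝ) 1, ‖B (y₀ + t • ξ) ξ‖ ≤ 1 / 2 := fun t ht =>
    ((B _).le_opNorm ξ).trans ((mul_le_mul_of_nonneg_right (hC _ (hmem t ht))
      (norm_nonneg _)).trans hCξ)
  have hP : IsPicardLindelof (fun t u => -(B (y₀ + t • ξ) ξ) * u)
      (⟨0, by simp⟩ : Icc (0 : ℝ) 1) (1 : R) 1 0 1 1 := by
    refine ⟨fun t ht => ?_, fun u _ => ?_, fun t ht u hu => ?_, by simp⟩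
    · refine LipschitzWith.lipschitzOnWith (LipschitzWith.of_dist_le_mul fun u v => ?_)
      rw [dist_eq_norm, dist_eq_norm, ← mul_sub]
      refine (norm_mul_le _ _).trans (mul_le_mul_of_nonneg_right ?_ (norm_nonneg _))
      rw [norm_neg]
      refine (hA t ht).trans ?_
      norm_num
    · refine ContinuousOn.mul (ContinuousOn.neg ?_) continuousOn_const
      refine ContinuousOn.clm_apply ?_ continuousOn_const
      exact hB.comp (by fun_prop) hmem
    · have hu' : ‖u‖ ≤ 2 := by
        rw [mem_closedBall_iff_norm] at hu
        have := norm_le_norm_add_norm_sub' u 1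
        simp at this hu
        linarith
      refine (norm_mul_le _ _).trans ?_
      rw [norm_neg]
      refine (mul_le_mul (hA t ht) hu' (norm_nonneg _) (by norm_num)).trans ?_
      norm_num
  obtain ⟨U, h0, hU⟩ := hP.exists_eq_forall_mem_Icc_hasDerivWithinAt₀
  exact ⟨U, h0, hU⟩

/-- The fundamental solutions along straight segments depend differentiably on the segment. -/
theorem exists_fundamental_family {B : V → V →L[ℝ] R} {y₀ : V} (hB : ContDiffAt ℝ 1 B y₀) :
    ∃ r > 0, ∃ U : V → ℝ → R, (∀ ξ, ‖ξ‖ < r → IsFundamental B y₀ ξ (U ξ)) ∧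
      HasStrictFDerivAt (fun ξ => U ξ 1) (-(B y₀)) 0 := by
  obtain ⟨L, s, hs, hL⟩ := hB.exists_lipschitzOnWith
  obtain ⟨r₁, hr₁, hball⟩ := Metric.mem_nhds_iff.1 hs
  have hLip := hL.mono hball
  obtain ⟨C, hC0, hC⟩ : ∃ C : ℝ, 0 < C ∧ ∀ y ∈ Metric.ball y₀ r₁, ‖B y‖ ≤ C := by
    refine ⟨‖B y₀‖ + L * r₁ + 1, by positivity, fun y hy => ?_⟩
    have h1 := hLip.dist_le_mul y hy y₀ (Metric.mem_ball_self hr₁)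
    have h2 := norm_le_norm_add_norm_sub' (B y) (B y₀)
    rw [dist_eq_norm] at h1
    have h3 : (L : ℝ) * dist y y₀ ≤ L * r₁ := by
      gcongr
      exact (Metric.mem_ball.1 hy).le
    linarith
  -- The first bound keeps the segment where `B` is Lipschitz, the second makes the coefficient at
  -- most `1 / 2`.
  set r := min r₁ (1 / (2 * C)) with hr
  have hr0 : 0 < r := by positivity
  have hsmall : ∀ ξ : V, ‖ξ‖ < r → ‖ξ‖ < r₁ ∧ C * ‖ξ‖ ≤ 1 / 2 := by
    intro ξ hξ
    refine ⟨hξ.trans_le (min_le_left _ _), ?_⟩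
    have h1 : ‖ξ‖ ≤ 1 / (2 * C) := hξ.le.trans (min_le_right _ _)
    calc C * ‖ξ‖ ≤ C * (1 / (2 * C)) := by gcongr
      _ = 1 / 2 := by field_simp
  have hex : ∀ ξ : V, ‖ξ‖ < r → ∃ U, IsFundamental B y₀ ξ U := fun ξ hξ =>
    exists_isFundamental hLip.continuousOn hC (hsmall ξ hξ).1 (hsmall ξ hξ).2
  choose! U hU using hex
  refine ⟨r, hr0, U, hU, ?_⟩
  have hmem : ∀ ξ : V, ‖ξ‖ < r → ∀ t ∈ Icc (0 : ℝ) 1, y₀ + t • ξ ∈ Metric.ball y₀ r₁ := by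
    intro ξ hξ t ht
    rw [mem_ball_iff_norm, add_sub_cancel_left, norm_smul, Real.norm_of_nonneg ht.1]
    nlinarith [norm_nonneg ξ, ht.2, (hsmall ξ hξ).1]
  have hBap : ∀ ξ : V, ‖ξ‖ < r → ∀ t ∈ Icc (0 : ℝ) 1, ∀ η, ‖B (y₀ + t • ξ) η‖ ≤ C * ‖η‖ :=
    fun ξ hξ t ht η => (B _).le_of_opNorm_le (hC _ (hmem ξ hξ t ht)) η
  have hBdiff : ∀ ξ η : V, ‖ξ‖ < r → ‖η‖ < r → ∀ t ∈ Icc (0 : ℝ) 1, ∀ ζ,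
      ‖B (y₀ + t • ξ) ζ - B (y₀ + t • η) ζ‖ ≤ L * ‖ξ - η‖ * ‖ζ‖ := by
    intro ξ η hξ hη t ht ζ
    rw [← sub_apply]
    refine ContinuousLinearMap.le_of_opNorm_le _ ?_ ζ
    have h1 := hLip.dist_le_mul _ (hmem ξ hξ t ht) _ (hmem η hη t ht)
    rw [dist_eq_norm, dist_eq_norm, add_sub_add_left_eq_sub, ← smul_sub, norm_smul,
      Real.norm_of_nonneg ht.1] at h1
    refine h1.trans ?_
    gcongr
    exact mul_le_of_le_one_left (norm_nonneg _) ht.2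
  have hU2 : ∀ ξ : V, ‖ξ‖ < r → ∀ t ∈ Icc (0 : ℝ) 1, ‖U ξ t‖ ≤ 2 := by
    intro ξ hξ t ht
    have := norm_le_of_hasDerivWithinAt_le_half (δ := 1) (ε := 0) zero_le_one le_rfl (hU ξ hξ).2
      (by rw [(hU ξ hξ).1, norm_one]) (fun t ht => ?_) ht
    · linarith
    · rw [add_zero]
      refine (norm_mul_le _ _).trans (mul_le_mul_of_nonneg_right ?_ (norm_nonneg _))
      rw [norm_neg]
      exact (hBap ξ hξ t (Ico_subset_Icc_self ht) ξ).trans (hsmall ξ hξ).2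
  have hU1 : ∀ ξ : V, ‖ξ‖ < r → ∀ t ∈ Icc (0 : ℝ) 1, ‖U ξ t - 1‖ ≤ 2 * C * ‖ξ‖ := by
    intro ξ hξ t ht
    have := norm_image_sub_le_of_norm_deriv_le_segment' (C := 2 * C * ‖ξ‖) (hU ξ hξ).2
      (fun t ht => ?_) t ht
    · rw [(hU ξ hξ).1] at this
      refine this.trans (mul_le_of_le_one_right (by positivity) ?_)
      linarith [ht.2]
    · have ht' := Ico_subset_Icc_self ht
      refine (norm_mul_le _ _).trans ?_
      rw [norm_neg]
      calc _ ≤ C * ‖ξ‖ * 2 := by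
            gcongr
            exacts [hBap ξ hξ t ht' ξ, hU2 ξ hξ t ht']
        _ = _ := by ring
  -- The three summands are the coefficients in the bounds `b1`, `b2`, `b3` below.
  set M : ℝ := 4 * C * (C + L * r) + 2 * L + 2 * C * C with hM
  have hM0 : 0 ≤ M := by positivity
  -- The factor `‖ξ‖ + ‖η‖` tends to zero, so this is strict differentiability at `0`. It follows by
  -- comparing `U ξ t - U η t` with its linearization `-t • B y₀ (ξ - η)`.
  have hmain : ∀ ξ η : V, ‖ξ‖ < r → ‖η‖ < r →
      ‖U ξ 1 - U η 1 - (-(B y₀)) (ξ - η)‖ ≤ M * (‖ξ‖ + ‖η‖) * ‖ξ - η‖ := by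
    intro ξ η hξ hη
    have hsub : ∀ t ∈ Icc (0 : ℝ) 1, HasDerivWithinAt (fun t => U ξ t - U η t)
        (-(B (y₀ + t • ξ) ξ) * (U ξ t - U η t)
          - (B (y₀ + t • ξ) (ξ - η) + (B (y₀ + t • ξ) η - B (y₀ + t • η) η)) * U η t)
        (Icc 0 1) t := by
      intro t ht
      refine (((hU ξ hξ).2 t ht).sub ((hU η hη).2 t ht)).congr_deriv ?_
      rw [map_sub]
      noncomm_ring
    have hD : ∀ t ∈ Icc (0 : ℝ) 1, ‖U ξ t - U η t‖ ≤ 4 * (C + L * r) * ‖ξ - η‖ := by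
      intro t ht
      have := norm_le_of_hasDerivWithinAt_le_half (δ := 0) (ε := 2 * (C + L * r) * ‖ξ - η‖) le_rfl
        (by positivity) hsub (by simp [(hU ξ hξ).1, (hU η hη).1]) (fun t ht => ?_) ht
      · linarith
      · have ht' := Ico_subset_Icc_self ht
        refine (norm_sub_le _ _).trans (add_le_add ((norm_mul_le _ _).trans
          (mul_le_mul_of_nonneg_right ?_ (norm_nonneg _))) ((norm_mul_le _ _).trans ?_))
        · rw [norm_neg]
          exact (hBap ξ hξ t ht' ξ).trans (hsmall ξ hξ).2
        · calc _ ≤ (C * ‖ξ - η‖ + L * ‖ξ - η‖ * r) * 2 := by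
                gcongr
                · refine (norm_add_le _ _).trans (add_le_add (hBap ξ hξ t ht' _) ?_)
                  refine (hBdiff ξ η hξ hη t ht' η).trans ?_
                  gcongr
                · exact hU2 η hη t ht'
            _ = _ := by ring
    have hZ : ∀ t ∈ Icc (0 : ℝ) 1, HasDerivWithinAt
        (fun t => U ξ t - U η t + t • B y₀ (ξ - η))
        (-(B (y₀ + t • ξ) ξ) * (U ξ t - U η t)
          - ((B (y₀ + t • ξ) (ξ - η) - B (y₀ + t • (0 : V)) (ξ - η))
            + (B (y₀ + t • ξ) η - B (y₀ + t • η) η)) * U η t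
          - B y₀ (ξ - η) * (U η t - 1))
        (Icc 0 1) t := by
      intro t ht
      refine ((hsub t ht).add ((hasDerivWithinAt_id t _).smul_const (B y₀ (ξ - η)))).congr_deriv ?_
      rw [smul_zero, add_zero, one_smul]
      noncomm_ring
    have hfin := norm_image_sub_le_of_norm_deriv_le_segment_01'
      (C := M * (‖ξ‖ + ‖η‖) * ‖ξ - η‖) hZ fun t ht => ?_
    · simp only [(hU ξ hξ).1, (hU η hη).1, sub_self, zero_smul, add_zero, one_smul, sub_zero]
        at hfin
      rw [neg_apply, sub_neg_eq_add]
      exact hfin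
    · have ht' := Ico_subset_Icc_self ht
      have b1 : ‖-(B (y₀ + t • ξ) ξ) * (U ξ t - U η t)‖ ≤
          (C * ‖ξ‖) * (4 * (C + L * r) * ‖ξ - η‖) := by
        refine (norm_mul_le _ _).trans ?_
        rw [norm_neg]
        gcongr
        exacts [hBap ξ hξ t ht' ξ, hD t ht']
      have b2 : ‖((B (y₀ + t • ξ) (ξ - η) - B (y₀ + t • (0 : V)) (ξ - η))
            + (B (y₀ + t • ξ) η - B (y₀ + t • η) η)) * U η t‖ ≤
          (L * ‖ξ - 0‖ * ‖ξ - η‖ + L * ‖ξ - η‖ * ‖η‖) * 2 := by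
        refine (norm_mul_le _ _).trans ?_
        gcongr
        · exact (norm_add_le _ _).trans (add_le_add
            (hBdiff ξ 0 hξ (by simpa using hr0) t ht' _) (hBdiff ξ η hξ hη t ht' η))
        · exact hU2 η hη t ht'
      have b3 : ‖B y₀ (ξ - η) * (U η t - 1)‖ ≤ (C * ‖ξ - η‖) * (2 * C * ‖η‖) := by
        refine (norm_mul_le _ _).trans ?_
        gcongr
        · exact (B _).le_of_opNorm_le (hC _ (Metric.mem_ball_self hr₁)) _
        · exact hU1 η hη t ht'
      refine (norm_sub_le _ _).trans ((add_le_add ((norm_sub_le _ _).trans (add_le_add b1 b2))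
        b3).trans ?_)
      rw [sub_zero]
      have k1 : 0 ≤ 4 * C * (C + L * r) * ‖η‖ * ‖ξ - η‖ := by positivity
      have k2 : 0 ≤ 2 * C * C * ‖ξ‖ * ‖ξ - η‖ := by positivity
      rw [hM]
      linarith
  rw [hasStrictFDerivAt_iff_isLittleO, Asymptotics.isLittleO_iff]
  intro c hc
  have hcont : Filter.Tendsto (fun p : V × V => M * (‖p.1‖ + ‖p.2‖)) (𝓝 (0, 0)) (𝓝 0) := by
    have : Continuous (fun p : V × V => M * (‖p.1‖ + ‖p.2‖)) := by fun_prop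
    simpa using this.tendsto (0, 0)
  have hn : ∀ᶠ p : V × V in 𝓝 (0, 0), ‖p.1‖ < r ∧ ‖p.2‖ < r := by
    have h1 : Continuous (fun p : V × V => ‖p.1‖) := by fun_prop
    have h2 : Continuous (fun p : V × V => ‖p.2‖) := by fun_prop
    exact ((h1.tendsto (0, 0)).eventually (Iio_mem_nhds (by simpa using hr0))).and
      ((h2.tendsto (0, 0)).eventually (Iio_mem_nhds (by simpa using hr0)))
  filter_upwards [hn, hcont.eventually (Iio_mem_nhds hc)] with p hp hpc
  exact (hmain p.1 p.2 hp.1 hp.2).trans (by gcongr)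

end LinearODE

/-! ### Parallel transport from a point to its neighbours. -/

section LocalTransport

variable {n p q : ℕ} {M : Type*} [TopologicalSpace M] [ChartedSpace (E n) M]
  [IsManifold (𝓡 n) ∞ M]

theorem tractorMetric_nondeg (g : Metric n p q M) (x : M) {τ : Tractor n}
    (h : ∀ τ', tractorMetric g x τ τ' = 0) : τ = 0 := by
  obtain ⟨α, Y, β⟩ := τ
  have h1 := h (1, 0, 0)
  have h2 := h (0, 0, 1)
  have h3 : Y = 0 := metric_nondeg g x fun v => by
    have := h (0, v, 0)
    simpa [tractorMetric] using! this
  subst h3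
  have e0 : g.val x (0 : E n) (0 : E n) = 0 := by
    have : g.val x (0 : TangentSpace (𝓡 n) x) = 0 := map_zero _
    exact DFunLike.congr_fun this _
  simp only [tractorMetric] at h1 h2
  erw [e0] at h1 h2
  simp at h1 h2
  rw [h1, h2]
  rfl

theorem injective_of_isometry (g : Metric n p q M) {x y : M} {A : Tractor n →L[ℝ] Tractor n}
    (h : ∀ v w, tractorMetric g y (A v) (A w) = tractorMetric g x v w) :
    Function.Injective A := by
  rw [injective_iff_map_eq_zero]
  intro v hv
  apply tractorMetric_nondeg g x
  intro w
  rw [← h, hv]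
  have e0 : g.val y (0 : E n) (A w).2.1 = 0 := by
    have : g.val y (0 : TangentSpace (𝓡 n) y) = 0 := map_zero _
    exact DFunLike.congr_fun this _
  change (0 : ℝ) * _ + _ * 0 + g.val y (0 : E n) _ = 0
  rw [e0]
  ring

theorem exists_isTransport_line (g : Metric n p q M) (x₀ : M) {ξ : E n}
    (hξ : ∀ t ∈ Icc (0 : ℝ) 1, extChartAt (𝓡 n) x₀ x₀ + t • ξ ∈ (extChartAt (𝓡 n) x₀).target)
    {U : ℝ → Tractor n →L[ℝ] Tractor n}
    (hU : IsFundamental (tractorForm g x₀) (extChartAt (𝓡 n) x₀ x₀) ξ U) :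
    ∃ γ : Path x₀ ((extChartAt (𝓡 n) x₀).symm (extChartAt (𝓡 n) x₀ x₀ + ξ)),
      IsTransport g γ (chartTInv x₀ (extChartAt (𝓡 n) x₀ x₀ + ξ) ∘L U 1) := by
  set y₀ := extChartAt (𝓡 n) x₀ x₀ with hy₀
  let ℓ : ℝ → E n := fun t => y₀ + t • ξ
  have hℓ : ContDiff ℝ ∞ ℓ := by fun_prop
  let f : ℝ → M := fun t => (extChartAt (𝓡 n) x₀).symm (ℓ t)
  have hf : ContMDiffOn 𝓘(ℝ, ℝ) (𝓡 n) ∞ f (Icc 0 1) :=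
    (contMDiffOn_extChartAt_symm x₀).comp hℓ.contMDiff.contMDiffOn hξ
  have hf0 : f 0 = x₀ := by
    simp only [f, ℓ, zero_smul, add_zero]
    exact extChartAt_to_inv x₀
  have hf1 : f 1 = (extChartAt (𝓡 n) x₀).symm (y₀ + ξ) := by
    simp only [f, ℓ, one_smul]
  let γ := Path.ofLine hf.continuousOn hf0 hf1
  have hγ : ∀ t ∈ Icc (0 : ℝ) 1, γ.extend t = f t := fun t ht => Path.extend_apply γ ht
  refine ⟨γ, ⟨∅, fun a b ha _ hb _ => ?_⟩, fun v => ?_⟩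
  · exact (hf.mono (Icc_subset_Icc ha hb)).congr fun t ht => hγ t ⟨ha.trans ht.1, ht.2.trans hb⟩
  have hu : ∀ t ∈ Icc (0 : ℝ) 1, HasDerivWithinAt (fun t => U t v)
      ((-(tractorForm g x₀ (ℓ t) ξ) * U t) v) (Icc 0 1) t := by
    intro t ht
    have := (hU.2 t ht).clm_apply (hasDerivWithinAt_const t (Icc 0 1) v)
    simpa using this
  have huc : ContinuousOn (fun t => U t v) (Icc 0 1) := fun t ht => (hu t ht).continuousWithinAt
  refine ⟨fun t => chartTInv x₀ (ℓ t) (U t v), ⟨huc.fst, ?_, huc.snd.snd, ∅, ?_⟩, ?_, ?_⟩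
  · refine ContinuousOn.congr (f := fun t => (Bundle.TotalSpace.mk (f t)
      (chartTInv x₀ (ℓ t) (U t v)).2.1 : TangentBundle (𝓡 n) M)) ?_
      fun t ht => by rw [hγ t ht]
    intro t ht
    refine (tendsto_tangent_iff ((extChartAt (𝓡 n) x₀).map_target (hξ t ht))).2
      ⟨hf.continuousOn t ht, ?_⟩
    simp only [chartTInv_apply]
    have e : chartD x₀ ((extChartAt (𝓡 n) x₀).symm (y₀ + t • ξ))
        (chartDInv x₀ (ℓ t) (U t v).2.1) = (U t v).2.1 := chartD_chartDInv (hξ t ht) _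
    rw [e]
    refine Filter.Tendsto.congr' ?_ (huc.snd.fst t ht)
    filter_upwards [self_mem_nhdsWithin] with s hs
    exact (chartD_chartDInv (hξ s hs) _).symm
  · intro t ht _
    have ht' := Ioo_subset_Icc_self ht
    have hnear : Icc (0 : ℝ) 1 ∈ 𝓝 t := Icc_mem_nhds ht.1 ht.2
    refine IsParallelAt.congr (γ := f) (τ := fun t => chartTInv x₀ (ℓ t) (U t v)) ?_ ?_ .rfl
    · refine isParallelAt_of_chart (x₀ := x₀) (c' := ξ)
        ((extChartAt (𝓡 n) x₀).map_target (hξ t ht'))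
        (hf.continuousOn.continuousAt hnear) ?_ ?_
      · have : HasDerivAt ℓ ξ t :=
          (((hasDerivAt_id t).smul_const ξ).const_add y₀).congr_deriv (one_smul _ _)
        refine this.congr_of_eventuallyEq ?_
        filter_upwards [hnear] with s hs
        exact (extChartAt (𝓡 n) x₀).right_inv (hξ s hs)
      · have e : extChartAt (𝓡 n) x₀ (f t) = ℓ t := (extChartAt (𝓡 n) x₀).right_inv (hξ t ht')
        have e' : chartT x₀ (f t) (chartTInv x₀ (ℓ t) (U t v)) = U t v :=
          chartT_chartTInv (hξ t ht') _
        rw [e, e']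
        refine ((hu t ht').hasDerivAt hnear).congr_of_eventuallyEq ?_
        filter_upwards [hnear] with s hs
        exact chartT_chartTInv (hξ s hs) _
    · filter_upwards [hnear] with s hs using hγ s hs
  · simp only [ℓ, zero_smul, add_zero, hU.1]
    exact chartTInv_self x₀ v
  · simp [ℓ]

theorem isFundamental_zero {V R : Type*} [NormedAddCommGroup V] [NormedSpace ℝ V] [NormedRing R]
    [NormedAlgebra ℝ R] {B : V → V →L[ℝ] R} {y₀ : V} {U : ℝ → R} (h : IsFundamental B y₀ 0 U) :
    U 1 = 1 := by
  have := norm_image_sub_le_of_norm_deriv_le_segment_01' (C := 0) h.2 (by simp)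
  rw [h.1] at this
  exact sub_eq_zero.1 (norm_le_zero_iff.1 this)

theorem hasStrictFDerivAt_inverse_of_eq_one {V R : Type*} [NormedAddCommGroup V] [NormedSpace ℝ V]
    [NormedRing R] [NormedAlgebra ℝ R] [CompleteSpace R] {u : V → R} {u' : V →L[ℝ] R} {x : V}
    (h : HasStrictFDerivAt u u' x) (hx : u x = 1) :
    HasStrictFDerivAt (fun y => Ring.inverse (u y)) (-u') x := by
  have h1 : HasStrictFDerivAt (Ring.inverse : R → R)
      (-ContinuousLinearMap.mulLeftRight ℝ R 1 1) (u x) := by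
    rw [hx]
    simpa using hasStrictFDerivAt_ringInverse (𝕜 := ℝ) (1 : Rˣ)
  refine (h1.comp x h).congr_fderiv ?_
  ext v
  simp

/-- This is `∇_X s₋ = X`. It is what moves the transported null line in every tangent direction as
the end point varies. -/
theorem tractorForm_sMinus (g : Metric n p q M) (x₀ : M) (ξ : E n) :
    tractorForm g x₀ (extChartAt (𝓡 n) x₀ x₀) ξ (sMinus n) = (0, ξ, 0) := by
  have hM := isMetricOn_coordMetric g x₀
  have hy := mem_extChartAt_target (I := 𝓡 n) x₀
  rw [tractorForm_apply g hy, tractorTerm, sMinus]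
  have h1 := schouten_smul_right hM hy 0 ξ 0
  rw [zero_smul, zero_mul] at h1
  rw [h1, ← christoffelBil_apply]
  simp

/-- Parallel transport along the straight segments of the chart centred at `x₀`. -/
theorem exists_local_transport (g : Metric n p q M) (x₀ : M) :
    ∃ r > 0, ∃ P : E n → Tractor n ≃L[ℝ] Tractor n,
      (∀ ξ, ‖ξ‖ < r → extChartAt (𝓡 n) x₀ x₀ + ξ ∈ (extChartAt (𝓡 n) x₀).target ∧
        ∃ γ : Path x₀ ((extChartAt (𝓡 n) x₀).symm (extChartAt (𝓡 n) x₀ x₀ + ξ)),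
          IsTransport g γ (P ξ)) ∧
      (P 0).symm (sMinus n) = sMinus n ∧
      HasStrictFDerivAt (fun ξ => (P ξ).symm (sMinus n))
        ((ContinuousLinearMap.inr ℝ ℝ (E n × ℝ)).comp (ContinuousLinearMap.inl ℝ (E n) ℝ)) 0 := by
  set y₀ := extChartAt (𝓡 n) x₀ x₀ with hy₀
  have htarget := (isOpen_extChartAt_target (I := 𝓡 n) x₀).mem_nhds (mem_extChartAt_target x₀)
  have hB : ContDiffAt ℝ 1 (tractorForm g x₀) y₀ :=
    ((contDiffOn_tractorForm g x₀).contDiffAt htarget).of_le (by simp)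
  obtain ⟨r₁, hr₁, U, hU, hstrict⟩ := exists_fundamental_family
    (R := Tractor n →L[ℝ] Tractor n) hB
  obtain ⟨r₂, hr₂, hball⟩ := Metric.mem_nhds_iff.1 htarget
  have hseg : ∀ ξ : E n, ‖ξ‖ < min r₁ r₂ → ∀ t ∈ Icc (0 : ℝ) 1,
      y₀ + t • ξ ∈ (extChartAt (𝓡 n) x₀).target := by
    intro ξ hξ t ht
    apply hball
    rw [mem_ball_iff_norm, add_sub_cancel_left, norm_smul, Real.norm_of_nonneg ht.1]
    nlinarith [norm_nonneg ξ, ht.2, hξ.trans_le (min_le_right r₁ r₂)]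
  have hP : ∀ ξ : E n, ‖ξ‖ < min r₁ r₂ → ∃ P : Tractor n ≃L[ℝ] Tractor n,
      (∃ γ : Path x₀ ((extChartAt (𝓡 n) x₀).symm (y₀ + ξ)), IsTransport g γ P) ∧
      P.symm (sMinus n) = Ring.inverse (U ξ 1) (sMinus n) := by
    intro ξ hξ
    obtain ⟨γ, hγ⟩ := exists_isTransport_line g x₀ (hseg ξ hξ) (hU ξ (hξ.trans_le (min_le_left _ _)))
    have hinj : Function.Injective (chartTInv x₀ (y₀ + ξ) ∘L U ξ 1) :=
      injective_of_isometry g hγ.isometry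
    have hy : y₀ + ξ ∈ (extChartAt (𝓡 n) x₀).target := by
      simpa using hseg ξ hξ 1 (by simp)
    have hinjU : Function.Injective (U ξ 1) := Function.Injective.of_comp (f := chartTInv x₀ (y₀ + ξ)) hinj
    have hinjC : Function.Injective (chartTInv x₀ (y₀ + ξ)) :=
      Function.LeftInverse.injective (chartT_chartTInv hy)
    let eU := (LinearEquiv.ofInjectiveEndo (U ξ 1 : Tractor n →ₗ[ℝ] Tractor n)
      hinjU).toContinuousLinearEquiv
    let eC := (LinearEquiv.ofInjectiveEndo (chartTInv x₀ (y₀ + ξ) : Tractor n →ₗ[ℝ] Tractor n)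
      hinjC).toContinuousLinearEquiv
    have heU : (eU : Tractor n →L[ℝ] Tractor n) = U ξ 1 := rfl
    refine ⟨eU.trans eC, ⟨γ, hγ⟩, ?_⟩
    rw [← heU, ContinuousLinearMap.ringInverse_equiv, ContinuousLinearMap.inverse_equiv]
    -- Reading a tractor in a chart changes only its tangent component, so `s₋` is fixed and only
    -- the fundamental solution matters.
    change eU.symm (eC.symm (sMinus n)) = eU.symm (sMinus n)
    congr 1
    rw [ContinuousLinearEquiv.symm_apply_eq]
    change sMinus n = chartTInv x₀ (y₀ + ξ) (sMinus n)
    rw [chartTInv_apply, sMinus]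
    simp
  choose! P hP1 hP2 using hP
  have hr : 0 < min r₁ r₂ := lt_min hr₁ hr₂
  have hU0 : U 0 1 = 1 := isFundamental_zero (hU 0 (by simpa using hr₁))
  refine ⟨min r₁ r₂, hr, P, fun ξ hξ => ⟨by simpa using hseg ξ hξ 1 (by simp), hP1 ξ hξ⟩, ?_, ?_⟩
  · rw [hP2 0 (by simpa using hr), hU0, Ring.inverse_one]
    rfl
  · have h2 := (hasStrictFDerivAt_inverse_of_eq_one hstrict hU0).clm_apply
      (hasStrictFDerivAt_const (sMinus n) (0 : E n))
    refine (h2.congr_of_eventuallyEq ?_).congr_fderiv ?_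
    · filter_upwards [Metric.ball_mem_nhds (0 : E n) hr] with ξ hξ
      exact (hP2 ξ (by simpa using hξ)).symm
    · ext1 ξ
      rw [add_apply, ContinuousLinearMap.comp_apply, zero_apply, map_zero, zero_add,
        ContinuousLinearMap.flip_apply, neg_neg]
      exact tractorForm_sMinus g x₀ ξ

end LocalTransport

/-! ### Continuous sections of kernels. -/

section KernelSections

/-- `P` extends to all of `W₂` a linear section of `T` over its range. -/
theorem exists_generalized_inverse {W₁ W₂ : Type*} [AddCommGroup W₁] [Module ℝ W₁]
    [AddCommGroup W₂] [Module ℝ W₂] (T : W₁ →ₗ[ℝ] W₂) :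
    ∃ P : W₂ →ₗ[ℝ] W₁, ∀ x, T (P (T x)) = T x := by
  obtain ⟨s, hs⟩ := T.rangeRestrict.exists_rightInverse_of_surjective T.range_rangeRestrict
  obtain ⟨P, hP⟩ := s.exists_extend
  refine ⟨P, fun x => ?_⟩
  have h1 : P (T x) = s (T.rangeRestrict x) := DFunLike.congr_fun hP (T.rangeRestrict x)
  have h2 := DFunLike.congr_fun hs (T.rangeRestrict x)
  rw [h1]
  exact congrArg Subtype.val h2

/-- A continuous family of linear maps whose kernel is nontrivial on a dense set of parameters
has, near some parameter, a continuous nonzero section of its kernel. -/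
theorem exists_continuous_kernel_section {X W₁ W₂ : Type*} [TopologicalSpace X]
    [NormedAddCommGroup W₁] [NormedSpace ℝ W₁] [FiniteDimensional ℝ W₁]
    [NormedAddCommGroup W₂] [NormedSpace ℝ W₂] [FiniteDimensional ℝ W₂]
    {T : X → W₁ →L[ℝ] W₂} (hT : Continuous T) {O : Set X} (hO : IsOpen O) (hne : O.Nonempty)
    (hD : ∀ O' ⊆ O, IsOpen O' → O'.Nonempty → ∃ y ∈ O', ∃ w ≠ 0, T y w = 0) :
    ∃ y₁ ∈ O, ∃ κ : X → W₁, ContinuousAt κ y₁ ∧ κ y₁ ≠ 0 ∧ ∀ᶠ y in 𝓝 y₁, T y (κ y) = 0 := by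
  have : CompleteSpace W₁ := FiniteDimensional.complete ℝ W₁
  let d : X → ℕ := fun y => Module.finrank ℝ (LinearMap.ker (T y : W₁ →ₗ[ℝ] W₂))
  -- Kernel dimension can only drop under small perturbations, so at a minimum over `O` it is
  -- locally constant.
  obtain ⟨y₁, hy₁, hmin⟩ : ∃ y₁ ∈ O, ∀ y ∈ O, d y₁ ≤ d y := by
    obtain ⟨y₁, hy₁⟩ := exists_minimal_of_wellFoundedLT (fun k => k ∈ d '' O) (hne.image d)
    obtain ⟨⟨y, hy, rfl⟩, h⟩ := hy₁
    exact ⟨y, hy, fun z hz => (le_total (d y) (d z)).elim id fun hzy => h ⟨z, hz, rfl⟩ hzy⟩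
  obtain ⟨P, hP⟩ := exists_generalized_inverse (T y₁ : W₁ →ₗ[ℝ] W₂)
  let P' : W₂ →L[ℝ] W₁ := P.toContinuousLinearMap
  -- `S y` is a perturbation of the identity that sends the kernel of `T y` into that of `T y₁`; its
  -- inverse will carry a fixed kernel vector of `T y₁` back.
  let S : X → W₁ →L[ℝ] W₁ := fun y => 1 - P' ∘L T y₁ + P' ∘L T y
  have hS : Continuous S := by fun_prop
  have hS1 : S y₁ = 1 := by simp [S]
  have hunit : ∀ᶠ y in 𝓝 y₁, IsUnit (S y) :=
    hS.continuousAt.eventually (by rw [hS1]; exact Units.isOpen.mem_nhds isUnit_one)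
  have hker : ∀ y x, T y x = 0 → T y₁ (S y x) = 0 := by
    intro y x hx
    have h1 : T y₁ (P' (T y₁ x)) = T y₁ x := hP x
    simp [S, hx, h1]
  obtain ⟨w, hw, hw0⟩ : ∃ w, T y₁ w = 0 ∧ w ≠ 0 := by
    -- If `T y₁` were injective, then so would be every `T y` with `S y` invertible, against the
    -- density of nontrivial kernels.
    by_contra! hcon
    obtain ⟨O', hO', hO'open, hmem⟩ := eventually_nhds_iff.1 hunit
    obtain ⟨y, hy, w, hw, hTw⟩ := hD (O ∩ O') inter_subset_left (hO.inter hO'open) ⟨y₁, hy₁, hmem⟩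
    have h1 := hcon _ (hker y w hTw)
    apply hw
    have h2 := congrArg (fun A : W₁ →L[ℝ] W₁ => A w) (Ring.inverse_mul_cancel _ (hO' y hy.2))
    simpa [h1] using h2.symm
  refine ⟨y₁, hy₁, fun y => Ring.inverse (S y) w, ?_, by simpa [hS1] using hw0, ?_⟩
  · have h1 : ContinuousAt Ring.inverse (S y₁) := by
      rw [hS1]
      exact NormedRing.inverse_continuousAt 1
    exact (ContinuousAt.comp (f := S) h1 hS.continuousAt).clm_apply continuousAt_const
  · filter_upwards [hunit, hO.mem_nhds hy₁] with y hy hyO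
    have hinj : Function.Injective (S y : W₁ →ₗ[ℝ] W₁) := by
      refine Function.LeftInverse.injective (g := (Ring.inverse (S y) : W₁ →L[ℝ] W₁)) fun x => ?_
      exact congrArg (fun A : W₁ →L[ℝ] W₁ => A x) (Ring.inverse_mul_cancel _ hy)
    set K₁ := LinearMap.ker (T y₁ : W₁ →ₗ[ℝ] W₂) with hK₁
    set K := LinearMap.ker (T y : W₁ →ₗ[ℝ] W₂) with hK
    have hle : K ≤ K₁.comap (S y : W₁ →ₗ[ℝ] W₁) := fun x hx => hker y x hx
    have hfin : Module.finrank ℝ (K₁.comap (S y : W₁ →ₗ[ℝ] W₁)) ≤ Module.finrank ℝ K := by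
      refine le_trans ?_ (hmin y hyO)
      rw [(Submodule.equivMapOfInjective _ hinj (K₁.comap (S y : W₁ →ₗ[ℝ] W₁))).finrank_eq]
      exact Submodule.finrank_mono (Submodule.map_comap_le _ _)
    -- Minimality of the kernel dimension at `y₁` makes the preimage under `S y` of the kernel there
    -- exactly the kernel of `T y`.
    have heq := Submodule.eq_of_le_of_finrank_le hle hfin
    have hmemK : Ring.inverse (S y) w ∈ K := by
      rw [heq]
      change T y₁ (S y (Ring.inverse (S y) w)) = 0
      have h2 := congrArg (fun A : W₁ →L[ℝ] W₁ => A w) (Ring.mul_inverse_cancel _ hy)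
      have h3 : S y (Ring.inverse (S y) w) = w := h2
      rw [h3, hw]
    exact hmemK

end KernelSections

/-! ### Moving a null vector by wedges at nearby null vectors. -/

section NullCone

variable {n : ℕ}

/-- The tractor metric built from the bilinear form `b`. -/
def tractorBil (b : Bil n) : Tractor n →L[ℝ] Tractor n →L[ℝ] ℝ :=
  (LinearMap.mk₂ ℝ (fun τ τ' : Tractor n => τ.1 * τ'.2.2 + τ'.1 * τ.2.2 + b τ.2.1 τ'.2.1)
    (by intro a c d; simp; ring) (by intro r a c; simp; ring) (by intro a c d; simp; ring)
    (by intro r a c; simp; ring)).toContinuousBilinearMap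

theorem tractorBil_apply (b : Bil n) (τ τ' : Tractor n) :
    tractorBil b τ τ' = τ.1 * τ'.2.2 + τ'.1 * τ.2.2 + b τ.2.1 τ'.2.1 := rfl

/-- The endomorphism `a ∧ c : u ↦ h(a, u) c - h(c, u) a`. -/
def wedge (b : Bil n) (a c : Tractor n) : Tractor n →L[ℝ] Tractor n :=
  (tractorBil b a).smulRight c - (tractorBil b c).smulRight a

theorem wedge_apply (b : Bil n) (a c u : Tractor n) :
    wedge b a c u = tractorBil b a u • c - tractorBil b c u • a := rfl

/-- A parametrization of the null lines not orthogonal to `s₊`. -/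
def nullVec (b : Bil n) (y : E n) : Tractor n := (1, y, -(1 / 2) * b y y)

/-- The derivative of `nullVec`. -/
def nullTangent (b : Bil n) (y w : E n) : Tractor n := (0, w, -b y w)

theorem nullTangent_add (b : Bil n) (y w w' : E n) :
    nullTangent b y (w + w') = nullTangent b y w + nullTangent b y w' := by
  simp [nullTangent]
  ring

theorem nullTangent_smul (b : Bil n) (y : E n) (r : ℝ) (w : E n) :
    nullTangent b y (r • w) = r • nullTangent b y w := by
  simp [nullTangent]

theorem tractorBil_nullVec_self {b : Bil n} (y : E n) :
    tractorBil b (nullVec b y) (nullVec b y) = 0 := by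
  simp [tractorBil_apply, nullVec]
  ring

/-- The orthogonal complement of a null vector `v` is spanned by `v` and the tangent vectors of the
parametrized cone. -/
theorem eq_smul_nullVec_add_nullTangent {b : Bil n} {y : E n} {u : Tractor n}
    (hu : tractorBil b (nullVec b y) u = 0) :
    u = u.1 • nullVec b y + nullTangent b y (u.2.1 - u.1 • y) := by
  obtain ⟨a, Z, c⟩ := u
  rw [tractorBil_apply] at hu
  simp only [nullVec] at hu
  simp only [nullVec, nullTangent, Prod.smul_mk, Prod.mk_add_mk, smul_eq_mul]
  refine Prod.ext ?_ (Prod.ext ?_ ?_)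
  · simp
  · simp
  · simp only [map_sub, map_smul, smul_eq_mul]
    linarith

/-- Polarize to `b(X,w) Z + b(Z,w) X - b(X,Z) w ∈ K`. If `w` is not null, take `Z = w`. If `w` is
null, `n ≥ 3` makes `w^⊥` larger than its radical `ℝ w`, so two vectors of `w^⊥` with nonzero
pairing give `w ∈ K`. Then `K` contains every `Y` not orthogonal to `w`, and differences of such
vectors give the rest. -/
theorem eq_top_of_forall_quadratic_mem (hn : 3 ≤ n) {b : Bil n} (hsymm : ∀ u v, b u v = b v u)
    (hnd : ∀ u, (∀ v, b u v = 0) → u = 0) {w : E n} (hw : w ≠ 0) {K : Submodule ℝ (E n)}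
    (hK : ∀ X, b X w • X - (1 / 2 * b X X) • w ∈ K) : K = ⊤ := by
  have hpol : ∀ X Z, b X w • Z + b Z w • X - b X Z • w ∈ K := by
    intro X Z
    have h := K.sub_mem (K.sub_mem (hK (X + Z)) (hK X)) (hK Z)
    convert! h using 1
    simp only [map_add, add_apply, hsymm Z X]
    module
  rw [eq_top_iff]
  rintro X -
  by_cases hww : b w w = 0
  · obtain ⟨X₀, hX₀⟩ : ∃ X₀, b w X₀ ≠ 0 := by
      by_contra! h
      exact hw (hnd w h)
    have hwK : w ∈ K := by
      obtain ⟨X₁, hX₁, hX₁w⟩ : ∃ X₁, b w X₁ = 0 ∧ X₁ ∉ Submodule.span ℝ {w} := by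
        by_contra! h
        have h1 : LinearMap.ker (b w : E n →ₗ[ℝ] ℝ) ≤ Submodule.span ℝ {w} := h
        have h2 := Submodule.finrank_mono h1
        have h3 := LinearMap.finrank_range_add_finrank_ker (b w : E n →ₗ[ℝ] ℝ)
        have h4 := Submodule.finrank_le (LinearMap.range (b w : E n →ₗ[ℝ] ℝ))
        have h5 := finrank_span_singleton (K := ℝ) hw
        have h6 : Module.finrank ℝ (E n) = n := finrank_euclideanSpace_fin
        rw [Module.finrank_self] at h4
        omega
      obtain ⟨Z, hZ, hXZ⟩ : ∃ Z, b w Z = 0 ∧ b X₁ Z ≠ 0 := by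
        by_contra! h
        apply hX₁w
        rw [Submodule.mem_span_singleton]
        refine ⟨b X₁ X₀ / b w X₀, ?_⟩
        rw [← sub_eq_zero]
        apply hnd
        intro v
        have h1 := h (v - (b w v / b w X₀) • X₀) (by
          rw [map_sub, map_smul, smul_eq_mul]
          field_simp
          ring)
        rw [map_sub, map_smul, smul_eq_mul, sub_eq_zero] at h1
        rw [map_sub, map_smul, sub_apply, smul_apply, smul_eq_mul, h1]
        field_simp
        ring
      have h1 := hpol X₁ Z
      rw [hsymm X₁ w, hX₁, hsymm Z w, hZ, zero_smul, zero_smul, add_zero, zero_sub] at h1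
      have h2 := K.smul_mem (-(b X₁ Z)⁻¹) h1
      rwa [smul_neg, neg_smul, neg_neg, smul_smul, inv_mul_cancel₀ hXZ, one_smul] at h2
    have hmem : ∀ Y, b Y w ≠ 0 → Y ∈ K := by
      intro Y hY
      have h1 := K.add_mem (hK Y) (K.smul_mem (1 / 2 * b Y Y) hwK)
      rw [sub_add_cancel] at h1
      exact (K.smul_mem_iff hY).1 h1
    by_cases hX : b X w = 0
    · have h1 : X + X₀ ∈ K := hmem _ (by
        rw [map_add, add_apply, hX, zero_add, hsymm]
        exact hX₀)
      have h2 : X₀ ∈ K := hmem _ (by rwa [hsymm])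
      simpa using K.sub_mem h1 h2
    · exact hmem X hX
  · have h1 := hpol X w
    rw [add_sub_cancel_left] at h1
    exact (K.smul_mem_iff hww).1 h1

theorem continuous_nullVec (b : Bil n) : Continuous (nullVec b) := by
  unfold nullVec
  fun_prop

/-- Two null vectors in this normalization pair to minus half the squared separation, hence to
second order in `t`; a tangent vector and a null vector pair to first order. The double limit in
`exists_nullVec_orbit_tangent` rests on this gap. -/
theorem tractorBil_nullVec_line {b : Bil n} (hsymm : ∀ u v, b u v = b v u) (y X : E n) (t : ℝ) :
    tractorBil b (nullVec b (y + t • X)) (nullVec b y) = -(1 / 2) * t ^ 2 * b X X := by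
  simp only [tractorBil_apply, nullVec, map_add, add_apply, map_smul, smul_apply, smul_eq_mul]
  rw [hsymm X y]
  ring

theorem tractorBil_nullTangent_line {b : Bil n} (hsymm : ∀ u v, b u v = b v u) (y X w : E n)
    (t : ℝ) : tractorBil b (nullTangent b (y + t • X) w) (nullVec b y) = -(t * b X w) := by
  simp only [tractorBil_apply, nullTangent, nullVec, map_add, add_apply, map_smul, smul_apply,
    smul_eq_mul]
  rw [hsymm w y]
  ring

/-- If a subspace of endomorphisms contains a nonzero `v ∧ w` with `w` tangent to the null cone at
`v` for a dense set of null vectors `v` from some open set, then it moves some null vector in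
all tangential directions. -/
theorem exists_nullVec_orbit_tangent (hn : 3 ≤ n) {b : Bil n} (hsymm : ∀ u v, b u v = b v u)
    (hnd : ∀ u, (∀ v, b u v = 0) → u = 0) (h : Submodule ℝ (Tractor n →L[ℝ] Tractor n))
    {O : Set (E n)} (hO : IsOpen O) (hne : O.Nonempty)
    (hD : ∀ O' ⊆ O, IsOpen O' → O'.Nonempty → ∃ y ∈ O', ∃ w ≠ 0,
      wedge b (nullVec b y) (nullTangent b y w) ∈ h) :
    ∃ y ∈ O, ∀ u, tractorBil b (nullVec b y) u = 0 → ∃ A ∈ h, A (nullVec b y) = u := by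
  -- Projecting along `h` to a complement turns membership in `h` into the vanishing of a linear
  -- map.
  obtain ⟨C, hC⟩ := h.exists_isCompl
  let q : (Tractor n →L[ℝ] Tractor n) →L[ℝ] C :=
    (C.projectionOnto h hC.symm).toContinuousLinearMap
  have hq : ∀ A, q A = 0 ↔ A ∈ h := fun A => Submodule.projectionOnto_apply_eq_zero_iff hC.symm
  let T : E n → E n →L[ℝ] C := fun y => LinearMap.toContinuousLinearMap
    { toFun := fun w => q (wedge b (nullVec b y) (nullTangent b y w))
      map_add' := fun w w' => by
        rw [← map_add]
        congr 1
        refine ContinuousLinearMap.ext fun u => ?_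
        simp only [wedge_apply, nullTangent_add, map_add, add_apply]
        module
      map_smul' := fun r w => by
        rw [RingHom.id_apply, ← map_smul]
        congr 1
        refine ContinuousLinearMap.ext fun u => ?_
        simp only [wedge_apply, nullTangent_smul, map_smul, smul_apply]
        module }
  have hTapply : ∀ y w, T y w = q (wedge b (nullVec b y) (nullTangent b y w)) := fun _ _ => rfl
  have hT : Continuous T := by
    rw [continuous_clm_apply]
    intro w
    refine q.continuous.comp ?_
    rw [continuous_clm_apply]
    intro u
    have h1 := continuous_nullVec b
    have h2 : Continuous fun y => nullTangent b y w := by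
      unfold nullTangent
      fun_prop
    simp only [wedge_apply]
    fun_prop
  obtain ⟨y, hy, κ, hκ, hκ0, hker⟩ := exists_continuous_kernel_section hT hO hne
    fun O' h1 h2 h3 => by
      obtain ⟨y, hy, w, hw, hmem⟩ := hD O' h1 h2 h3
      exact ⟨y, hy, w, hw, (hq _).2 hmem⟩
  refine ⟨y, hy, ?_⟩
  set v := nullVec b y with hv
  set w := κ y with hw
  -- `H = h · v` is closed, being finite dimensional, so limits of its elements stay in it.
  let H : Submodule ℝ (Tractor n) :=
    h.map (ContinuousLinearMap.apply ℝ (Tractor n) v : _ →ₗ[ℝ] Tractor n)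
  have hH : ∀ A ∈ h, A v ∈ H := fun A hA => ⟨A, hA, rfl⟩
  have hHclosed : IsClosed (H : Set (Tractor n)) := H.closed_of_finiteDimensional
  have hline : ∀ X : E n, Continuous fun t : ℝ => y + t • X := fun X => by fun_prop
  have hκX : ∀ X : E n, ContinuousAt (fun t : ℝ => κ (y + t • X)) 0 := fun X =>
    ContinuousAt.comp (f := fun t : ℝ => y + t • X) (by simpa using hκ) (hline X).continuousAt
  -- The wedge at `y + t • X` applied to `v`, divided by `t`.
  have hnear : ∀ X : E n, ∀ᶠ t in 𝓝[≠] (0 : ℝ),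
      b X (κ (y + t • X)) • nullVec b (y + t • X)
        - (1 / 2 * t * b X X) • nullTangent b (y + t • X) (κ (y + t • X)) ∈ H := by
    intro X
    have h1 : ∀ᶠ t in 𝓝 (0 : ℝ), T (y + t • X) (κ (y + t • X)) = 0 :=
      ((hline X).tendsto' 0 y (by simp)).eventually hker
    filter_upwards [h1.filter_mono nhdsWithin_le_nhds, self_mem_nhdsWithin] with t ht ht0
    have h2 := hH _ ((hq _).1 ht)
    rw [wedge_apply, tractorBil_nullVec_line hsymm, tractorBil_nullTangent_line hsymm] at h2
    refine (H.smul_mem_iff (show t ≠ 0 from ht0)).1 ?_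
    convert! h2 using 1
    module
  have hlim1 : ∀ X : E n, b X w • v ∈ H := by
    intro X
    refine hHclosed.mem_of_tendsto (f := fun t : ℝ => b X (κ (y + t • X)) • nullVec b (y + t • X)
        - (1 / 2 * t * b X X) • nullTangent b (y + t • X) (κ (y + t • X)))
      (b := 𝓝[≠] (0 : ℝ)) ?_ (hnear X)
    refine Filter.Tendsto.mono_left ?_ nhdsWithin_le_nhds
    have hc : ContinuousAt (fun t : ℝ => b X (κ (y + t • X)) • nullVec b (y + t • X)
        - (1 / 2 * t * b X X) • nullTangent b (y + t • X) (κ (y + t • X))) 0 := by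
      have h1 : ∀ k : ℝ → E n, ContinuousAt k 0 → ContinuousAt (fun t : ℝ =>
          b X (k t) • nullVec b (y + t • X)
            - (1 / 2 * t * b X X) • nullTangent b (y + t • X) (k t)) 0 := by
        intro k hk
        unfold nullTangent nullVec
        fun_prop
      exact h1 _ (hκX X)
    simpa using hc.tendsto
  have hvH : v ∈ H := by
    obtain ⟨X, hX⟩ : ∃ X, b w X ≠ 0 := by
      by_contra! hcon
      exact hκ0 (hnd w hcon)
    exact (H.smul_mem_iff (by rwa [hsymm] : b X w ≠ 0)).1 (hlim1 X)
  -- With `v ∈ H` its multiple can be subtracted. The remainder is again divisible by `t`, and the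
  -- quotient converges although `κ` is only continuous.
  have hlim2 : ∀ X : E n, b X w • nullTangent b y X - (1 / 2 * b X X) • nullTangent b y w ∈ H := by
    intro X
    let f : ℝ → Tractor n := fun t => b X (κ (y + t • X)) • (0, X, -b y X - 1 / 2 * t * b X X)
        - (1 / 2 * b X X) • nullTangent b (y + t • X) (κ (y + t • X))
    refine hHclosed.mem_of_tendsto (f := f) (b := 𝓝[≠] (0 : ℝ)) ?_ ?_
    · refine Filter.Tendsto.mono_left ?_ nhdsWithin_le_nhds
      have hc : ContinuousAt f 0 := by
        have h1 : ∀ k : ℝ → E n, ContinuousAt k 0 → ContinuousAt (fun t : ℝ =>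
            b X (k t) • ((0, X, -b y X - 1 / 2 * t * b X X) : Tractor n)
              - (1 / 2 * b X X) • nullTangent b (y + t • X) (k t)) 0 := by
          intro k hk
          unfold nullTangent
          fun_prop
        exact h1 _ (hκX X)
      have h2 := hc.tendsto
      have h3 : f 0 = b X w • nullTangent b y X - (1 / 2 * b X X) • nullTangent b y w := by
        simp [f, nullTangent, hw]
      rwa [h3] at h2
    · filter_upwards [hnear X, self_mem_nhdsWithin] with t ht ht0
      refine (H.smul_mem_iff (show t ≠ 0 from ht0)).1 ?_
      have h1 := H.sub_mem ht (H.smul_mem (b X (κ (y + t • X))) hvH)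
      convert! h1 using 1
      simp only [f, hv, nullVec, nullTangent, map_add, add_apply, map_smul, smul_apply,
        smul_eq_mul, Prod.smul_mk, Prod.mk_sub_mk, hsymm X y]
      refine Prod.ext ?_ (Prod.ext ?_ ?_)
      · dsimp only
        ring
      · dsimp only
        module
      · dsimp only
        ring
  let ν : E n →ₗ[ℝ] Tractor n :=
    { toFun := nullTangent b y
      map_add' := nullTangent_add b y
      map_smul' := nullTangent_smul b y }
  have htop : H.comap ν = ⊤ := by
    refine eq_top_of_forall_quadratic_mem hn hsymm hnd hκ0 fun X => ?_
    rw [Submodule.mem_comap, map_sub, map_smul, map_smul]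
    exact hlim2 X
  intro u hu
  have hu' : u = u.1 • v + ν (u.2.1 - u.1 • y) := eq_smul_nullVec_add_nullTangent hu
  have huH : u ∈ H := by
    rw [hu']
    refine H.add_mem (H.smul_mem _ hvH) ?_
    have : u.2.1 - u.1 • y ∈ H.comap ν := htop ▸ Submodule.mem_top
    exact this
  exact huH

end NullCone

/-! ### Wedge form of the relevant skew endomorphisms. -/

section Wedge

variable {n : ℕ}

theorem tractorBil_symm {b : Bil n} (hsymm : ∀ u v, b u v = b v u) (τ τ' : Tractor n) :
    tractorBil b τ τ' = tractorBil b τ' τ := by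
  rw [tractorBil_apply, tractorBil_apply, hsymm τ.2.1]
  ring

theorem eq_of_forall_tractorBil_eq {b : Bil n} (hnd : ∀ u, (∀ v, b u v = 0) → u = 0)
    {τ τ' : Tractor n} (h : ∀ u, tractorBil b τ u = tractorBil b τ' u) : τ = τ' := by
  have h1 := h (0, 0, 1)
  have h2 := h (1, 0, 0)
  have h3 : τ.2.1 - τ'.2.1 = 0 := hnd _ fun v => by
    have h4 := h (0, v, 0)
    simpa [tractorBil_apply, sub_eq_zero] using h4
  refine Prod.ext ?_ (Prod.ext ?_ ?_)
  · simpa [tractorBil_apply] using h1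
  · exact sub_eq_zero.1 h3
  · simpa [tractorBil_apply] using h2

/-- The elements of the nilradical of the stabilizer of the null line spanned by `s₋`. -/
theorem eq_wedge_of_skew {b : Bil n} (hsymm : ∀ u v, b u v = b v u)
    (hnd : ∀ u, (∀ v, b u v = 0) → u = 0) {A : Tractor n →L[ℝ] Tractor n}
    (hA : ∀ u v, tractorBil b (A u) v = -tractorBil b u (A v)) (h0 : A (sMinus n) = 0)
    (h1 : ∀ τ τ', tractorBil b (sMinus n) τ = 0 → tractorBil b (sMinus n) τ' = 0 →
      tractorBil b (A τ) τ' = 0) :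
    A = wedge b (sMinus n) (0, (A (0, 0, 1)).2.1, 0) := by
  have hs : ∀ a Y, tractorBil b (sMinus n) (a, Y, 0) = 0 := fun a Y => by
    simp [tractorBil_apply, sMinus]
  have hdec : ∀ u : Tractor n,
      A u = A (0, u.2.1, 0) + u.2.2 • A (0, 0, 1) := by
    intro u
    have h : u = u.1 • sMinus n + (0, u.2.1, 0) + u.2.2 • (0, 0, 1) := by
      simp [sMinus]
    conv_lhs => rw [h]
    rw [map_add, map_add, map_smul, map_smul, h0, smul_zero, zero_add]
  have hp := hA (0, 0, 1) (sMinus n)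
  have hq := hA (0, 0, 1) (0, 0, 1)
  rw [h0, map_zero, neg_zero] at hp
  rw [tractorBil_symm hsymm] at hq
  -- Skewness against `s₋` and against `s₊` itself kills the two outer components of `A s₊`.
  have hp' : (A (0, 0, 1)).2.2 = 0 := by simpa [tractorBil_apply, sMinus] using hp
  have hq' : (A (0, 0, 1)).1 = 0 := by
    have : tractorBil b (0, 0, 1) (A (0, 0, 1)) = 0 := by linarith
    simpa [tractorBil_apply] using this
  have hw : A (0, 0, 1) = (0, (A (0, 0, 1)).2.1, 0) := Prod.ext hq' (Prod.ext rfl hp')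
  set w := (A (0, 0, 1)).2.1
  -- `A Y` is orthogonal to `ℐ^⊥`, hence a multiple of `s₋`; skewness against `s₊` gives the
  -- coefficient.
  have hY : ∀ Y, A (0, Y, 0) = -(b w Y) • sMinus n := by
    intro Y
    refine eq_of_forall_tractorBil_eq hnd fun u => ?_
    have e1 : u = (u.1, u.2.1, 0) + u.2.2 • ((0, 0, 1) : Tractor n) := by simp
    have e2 := h1 (0, Y, 0) (u.1, u.2.1, 0) (hs _ _) (hs _ _)
    have e3 := hA (0, Y, 0) (0, 0, 1)
    rw [hw] at e3
    conv_lhs => rw [e1]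
    rw [map_add, e2, map_smul, e3]
    simp [tractorBil_apply, sMinus, hsymm w Y, mul_comm]
  refine ContinuousLinearMap.ext fun u => ?_
  rw [hdec, hY, hw, wedge_apply]
  simp [tractorBil_apply, sMinus]

theorem wedge_smul_left (b : Bil n) (r : ℝ) (a c : Tractor n) :
    wedge b (r • a) c = r • wedge b a c := by
  refine ContinuousLinearMap.ext fun u => ?_
  simp only [smul_apply, wedge_apply, map_smul]
  module

theorem wedge_add_smul_right (b : Bil n) (r : ℝ) (a c : Tractor n) :
    wedge b a (r • a + c) = wedge b a c := by
  refine ContinuousLinearMap.ext fun u => ?_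
  simp only [wedge_apply, map_add, add_apply, map_smul, smul_apply]
  module

theorem eq_smul_nullVec {b : Bil n} {f : Tractor n} (hf : tractorBil b f f = 0) (h : f.1 ≠ 0) :
    f = f.1 • nullVec b (f.1⁻¹ • f.2.1) := by
  obtain ⟨a, Y, c⟩ := f
  rw [tractorBil_apply] at hf
  refine Prod.ext ?_ (Prod.ext ?_ ?_)
  · simp [nullVec]
  · simp [nullVec, smul_smul, mul_inv_cancel₀ (show a ≠ 0 from h)]
  · simp only [nullVec, Prod.smul_mk, smul_eq_mul, map_smul, smul_apply] at hf h ⊢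
    field_simp
    linarith

/-- Rescaling `f ∧ k`, with `f` null and `k` orthogonal to `f`, to the normal form
`nullVec ∧ nullTangent`. -/
theorem exists_wedge_eq {b : Bil n} {f k : Tractor n} (hf : tractorBil b f f = 0) (h : f.1 ≠ 0)
    (hk : tractorBil b f k = 0) (hfk : ∀ r : ℝ, k ≠ r • f) :
    ∃ w ≠ 0, wedge b f k =
      f.1 • wedge b (nullVec b (f.1⁻¹ • f.2.1)) (nullTangent b (f.1⁻¹ • f.2.1) w) := by
  have hf' := eq_smul_nullVec hf h
  generalize f.1⁻¹ • f.2.1 = z at hf' ⊢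
  generalize f.1 = α at hf' h ⊢
  have hk' : tractorBil b (nullVec b z) k = 0 := by
    rw [hf', map_smul, smul_apply, smul_eq_mul] at hk
    exact (mul_eq_zero.1 hk).resolve_left h
  have hdec := eq_smul_nullVec_add_nullTangent hk'
  refine ⟨k.2.1 - k.1 • z, fun hw => hfk (k.1 * α⁻¹) ?_, ?_⟩
  · rw [hw] at hdec
    rw [hf', smul_smul, mul_assoc, inv_mul_cancel₀ h, mul_one]
    refine hdec.trans ?_
    simp [nullTangent]
  · rw [hf', wedge_smul_left]
    congr 1
    conv_lhs => rw [hdec]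
    exact wedge_add_smul_right _ _ _ _

end Wedge

/-! ### The holonomy algebra and its wedges transported to one point. -/

section HolonomyAlgebra

variable {n p q : ℕ} {M : Type*} [TopologicalSpace M] [ChartedSpace (E n) M]
  [IsManifold (𝓡 n) ∞ M]

/-- The metric at `x` as a bilinear form on coordinate space. -/
def metricAt (g : Metric n p q M) (x : M) : Bil n := g.val x

theorem tractorMetric_eq (g : Metric n p q M) (x : M) (τ τ' : Tractor n) :
    tractorMetric g x τ τ' = tractorBil (metricAt g x) τ τ' := rfl

theorem metricAt_symm (g : Metric n p q M) (x : M) (u v : E n) :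
    metricAt g x u v = metricAt g x v u := g.symm x u v

theorem metricAt_nondeg (g : Metric n p q M) (x : M) (u : E n) (h : ∀ v, metricAt g x u v = 0) :
    u = 0 := metric_nondeg g x h

/-- Differentiate invariance of the metric along a curve of isometries; skewness then passes to the
span. -/
theorem tractorBil_of_mem_holAlg {g : Metric n p q M} {x : M} {A : Tractor n →L[ℝ] Tractor n}
    (hA : A ∈ holAlg g x) (u v : Tractor n) :
    tractorBil (metricAt g x) (A u) v = -tractorBil (metricAt g x) u (A v) := by
  induction hA using Submodule.span_induction with
  | mem A hA =>
    obtain ⟨c, -, hc, hc0, hcA⟩ := hA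
    have h1 : HasDerivAt (fun t => tractorBil (metricAt g x) (c t u) (c t v))
        (tractorBil (metricAt g x) (A u) v + tractorBil (metricAt g x) u (A v)) 0 := by
      have hu : HasDerivAt (fun t => c t u) (A u) 0 := by
        simpa using hcA.clm_apply (hasDerivAt_const (0 : ℝ) u)
      have hv : HasDerivAt (fun t => c t v) (A v) 0 := by
        simpa using hcA.clm_apply (hasDerivAt_const (0 : ℝ) v)
      have h2 := ((tractorBil (metricAt g x)).hasFDerivAt.comp_hasDerivAt 0 hu).clm_apply hv
      simpa [hc0] using h2
    have h2 : HasDerivAt (fun t => tractorBil (metricAt g x) (c t u) (c t v)) 0 0 := by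
      have h3 : ∀ t, tractorBil (metricAt g x) (c t u) (c t v) = tractorBil (metricAt g x) u v :=
        fun t => isometry_of_mem_holonomy0 (hc t) u v
      simp only [h3]
      exact hasDerivAt_const _ _
    linarith [h1.unique h2]
  | zero => simp
  | add A B _ _ hA hB =>
    simp only [add_apply, map_add, hA, hB]
    ring
  | smul r A _ hA => simp only [smul_apply, map_smul, hA, smul_neg]

theorem IsTransport.conj_mem_holAlg {g : Metric n p q M} {x y : M} {γ : Path x y}
    {P : Tractor n ≃L[ℝ] Tractor n} (h : IsTransport g γ P) {A : Tractor n →L[ℝ] Tractor n}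
    (hA : A ∈ holAlg g y) :
    (P.symm : Tractor n →L[ℝ] Tractor n) ∘L A ∘L (P : Tractor n →L[ℝ] Tractor n)
      ∈ holAlg g x := by
  induction hA using Submodule.span_induction with
  | mem A hA =>
    obtain ⟨c, hsm, hc, hc0, hcA⟩ := hA
    refine Submodule.subset_span ⟨fun t => (P.symm : Tractor n →L[ℝ] Tractor n) ∘L c t ∘L
      (P : Tractor n →L[ℝ] Tractor n), ?_, fun t => h.conj_mem_holonomy0 (hc t), ?_, ?_⟩
    · exact contDiff_const.clm_comp (hsm.clm_comp contDiff_const)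
    · dsimp only
      rw [hc0]
      refine ContinuousLinearMap.ext fun u => ?_
      simp
    · have h1 := (hasDerivAt_const (0 : ℝ) (P.symm : Tractor n →L[ℝ] Tractor n)).clm_comp
        (hcA.clm_comp (hasDerivAt_const (0 : ℝ) (P : Tractor n →L[ℝ] Tractor n)))
      simpa using h1
  | zero => simp
  | add A B _ _ hA hB =>
    simpa [ContinuousLinearMap.add_comp, ContinuousLinearMap.comp_add] using add_mem hA hB
  | smul r A _ hA =>
    simpa [ContinuousLinearMap.smul_comp, ContinuousLinearMap.comp_smul] using
      Submodule.smul_mem _ r hA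

/-- A nonzero generator of `ℰ_y` comes from some `A = s₋ ∧ w`, and `w = 0` would make `A` zero. -/
theorem exists_wedge_mem_holAlg {g : Metric n p q M} {y : M} (h : 1 ≤ rankE g y) :
    ∃ w ≠ 0, wedge (metricAt g y) (sMinus n) (0, w, 0) ∈ holAlg g y := by
  have h1 : holDistribution g y ≠ ⊥ := fun hbot => by
    rw [rankE, hbot] at h
    have h2 : Module.finrank ℝ (⊥ : Submodule ℝ (E n)) = 0 := finrank_bot ℝ (E n)
    have h3 : Module.finrank ℝ (⊥ : Submodule ℝ (TangentSpace (𝓡 n) y)) = 0 := h2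
    omega
  rw [holDistribution, Ne, Submodule.span_eq_bot] at h1
  push Not at h1
  obtain ⟨X, ⟨A, hA, hA0, hA1, τ, rfl⟩, hX⟩ := h1
  have h2 := eq_wedge_of_skew (metricAt_symm g y) (metricAt_nondeg g y)
    (tractorBil_of_mem_holAlg hA) hA0 hA1
  refine ⟨_, fun hw => ?_, h2 ▸ hA⟩
  rw [hw] at h2
  apply hX
  rw [h2, wedge_apply]
  have h3 : ((0, 0, 0) : Tractor n) = 0 := rfl
  rw [h3, map_zero]
  simp
  rfl

/-- An isometry conjugates `s₋ ∧ w` into the wedge of the preimages; rescaling the null factor to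
first component `1` gives the normal form. -/
theorem IsTransport.exists_wedge_mem_holAlg {g : Metric n p q M} {x y : M} {γ : Path x y}
    {P : Tractor n ≃L[ℝ] Tractor n} (h : IsTransport g γ P) (hy : 1 ≤ rankE g y)
    (h0 : (P.symm (sMinus n)).1 ≠ 0) :
    ∃ w ≠ 0, wedge (metricAt g x)
      (nullVec (metricAt g x) ((P.symm (sMinus n)).1⁻¹ • (P.symm (sMinus n)).2.1))
      (nullTangent (metricAt g x) ((P.symm (sMinus n)).1⁻¹ • (P.symm (sMinus n)).2.1) w)
        ∈ holAlg g x := by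
  obtain ⟨w, hw, hmem⟩ := ConfHol.exists_wedge_mem_holAlg hy
  have hiso : ∀ u v, tractorBil (metricAt g y) (P u) (P v) = tractorBil (metricAt g x) u v :=
    h.isometry
  set b := metricAt g x
  set f := P.symm (sMinus n) with hf
  set k := P.symm (0, w, 0) with hk
  have hPf : P f = sMinus n := P.apply_symm_apply _
  have hPk : P k = (0, w, 0) := P.apply_symm_apply _
  have hconj : (P.symm : Tractor n →L[ℝ] Tractor n) ∘L wedge (metricAt g y) (sMinus n) (0, w, 0) ∘L
      (P : Tractor n →L[ℝ] Tractor n) = wedge b f k := by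
    refine ContinuousLinearMap.ext fun u => ?_
    simp only [ContinuousLinearMap.comp_apply, wedge_apply, ContinuousLinearEquiv.coe_coe, map_sub,
      map_smul]
    rw [← hPf, ← hPk, hiso, hiso, P.symm_apply_apply, P.symm_apply_apply]
  have hff : tractorBil b f f = 0 := by
    rw [← hiso, hPf]
    simp [tractorBil_apply, sMinus]
  have hfk : tractorBil b f k = 0 := by
    rw [← hiso, hPf, hPk]
    simp [tractorBil_apply, sMinus]
  have hne : ∀ r : ℝ, k ≠ r • f := by
    intro r hr
    have h1 := congrArg P hr
    rw [map_smul, hPf, hPk] at h1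
    exact hw (by simpa [sMinus] using congrArg (fun τ : Tractor n => τ.2.1) h1)
  obtain ⟨w', hw', heq⟩ := exists_wedge_eq hff h0 hfk hne
  refine ⟨w', hw', ((holAlg g x).smul_mem_iff h0).1 ?_⟩
  rw [← heq, ← hconj]
  exact h.conj_mem_holAlg hmem

/-- If the holonomy distribution is nonzero on a dense subset of a neighbourhood of `x₀`, then
the holonomy algebra at `x₀` satisfies the hypothesis of `exists_nullVec_orbit_tangent`. -/
theorem exists_open_forall_wedge_mem_holAlg (g : Metric n p q M) {x₀ : M} {W : Set M}
    (hW : IsOpen W) (hx₀ : x₀ ∈ W)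
    (hD : ∀ W' ⊆ W, IsOpen W' → W'.Nonempty → ∃ y ∈ W', 1 ≤ rankE g y) :
    ∃ O : Set (E n), IsOpen O ∧ O.Nonempty ∧ ∀ O' ⊆ O, IsOpen O' → O'.Nonempty →
      ∃ y ∈ O', ∃ w ≠ 0, wedge (metricAt g x₀) (nullVec (metricAt g x₀) y)
        (nullTangent (metricAt g x₀) y w) ∈ holAlg g x₀ := by
  obtain ⟨r, hr, P, hP, hP0, hstrict⟩ := exists_local_transport g x₀
  set ψ := extChartAt (𝓡 n) x₀ with hψ
  let f : E n → Tractor n := fun ξ => (P ξ).symm (sMinus n)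
  have hf0 : f 0 = sMinus n := hP0
  -- The coordinate of the transported null line. Its strict derivative at `0` is the identity, so
  -- it is a local homeomorphism.
  let φ : E n → E n := fun ξ => (f ξ).1⁻¹ • (f ξ).2.1
  have hf1 : HasStrictFDerivAt (fun ξ => (f ξ).1) (0 : E n →L[ℝ] ℝ) 0 := by
    refine hstrict.fst.congr_fderiv ?_
    ext v
    simp
  have hf2 : HasStrictFDerivAt (fun ξ => (f ξ).2.1) (ContinuousLinearMap.id ℝ (E n)) 0 := by
    refine hstrict.snd.fst.congr_fderiv ?_
    refine ContinuousLinearMap.ext fun v => ?_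
    simp
  have hf1' : (f 0).1 = 1 := by rw [hf0]; rfl
  have hφ : HasStrictFDerivAt φ
      ((ContinuousLinearEquiv.refl ℝ (E n) : E n ≃L[ℝ] E n) : E n →L[ℝ] E n) 0 := by
    have hinv : HasStrictFDerivAt (fun ξ => (f ξ).1⁻¹) (0 : E n →L[ℝ] ℝ) 0 := by
      have h1 := (hasStrictDerivAt_inv (show (f 0).1 ≠ 0 by simp [hf1'])).hasStrictFDerivAt.comp
        (0 : E n) hf1
      simpa using h1
    refine (hinv.smul hf2).congr_fderiv ?_
    refine ContinuousLinearMap.ext fun v => ?_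
    simp [hf1']
  let Φ := hφ.toOpenPartialHomeomorph φ
  have hev : ∀ᶠ ξ in 𝓝 (0 : E n), ξ ∈ Φ.source ∧ ‖ξ‖ < r ∧ (f ξ).1 ≠ 0 ∧
      ψ.symm (ψ x₀ + ξ) ∈ W := by
    have h0 : ∀ᶠ ξ in 𝓝 (0 : E n), ξ ∈ Φ.source :=
      Φ.open_source.mem_nhds hφ.mem_toOpenPartialHomeomorph_source
    refine h0.and (Filter.Eventually.and ?_ (Filter.Eventually.and ?_ ?_))
    · exact (continuous_norm.tendsto' (0 : E n) 0 norm_zero).eventually (gt_mem_nhds hr)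
    · exact hf1.hasFDerivAt.continuousAt.eventually_ne (by simp [hf1'])
    · have h1 : ContinuousAt (fun ξ => ψ.symm (ψ x₀ + ξ)) 0 := by
        refine ContinuousAt.comp (g := ψ.symm) ?_ (by fun_prop)
        rw [add_zero]
        exact continuousAt_extChartAt_symm x₀
      refine h1.eventually (hW.mem_nhds ?_)
      dsimp only
      rw [add_zero, extChartAt_to_inv]
      exact hx₀
  obtain ⟨D, hD1, hDopen, hD0⟩ := eventually_nhds_iff.1 hev
  have hDs : D ⊆ Φ.source := fun ξ hξ => (hD1 ξ hξ).1
  refine ⟨Φ '' D, Φ.isOpen_image_of_subset_source hDopen hDs, ⟨_, 0, hD0, rfl⟩, ?_⟩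
  intro O' hO' hO'open ⟨z, hz⟩
  have hD'open : IsOpen (D ∩ Φ ⁻¹' O') :=
    (Φ.continuousOn.mono hDs).isOpen_inter_preimage hDopen hO'open
  -- The points of `M` whose null lines land in `O'`; density is assumed on `M` and has to be
  -- carried through `φ`.
  let W' : Set M := (chartAt (E n) x₀).source ∩ ψ ⁻¹' ((fun η => η - ψ x₀) ⁻¹' (D ∩ Φ ⁻¹' O'))
  have hW'open : IsOpen W' :=
    isOpen_extChartAt_preimage (I := 𝓡 n) x₀ (hD'open.preimage (by fun_prop))
  have hW'mem : ∀ y ∈ W', ∃ ξ ∈ D ∩ Φ ⁻¹' O', ψ.symm (ψ x₀ + ξ) = y := by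
    intro y hy
    refine ⟨ψ y - ψ x₀, hy.2, ?_⟩
    rw [add_sub_cancel]
    exact ψ.left_inv (by rw [hψ, extChartAt_source]; exact hy.1)
  have hW'W : W' ⊆ W := by
    intro y hy
    obtain ⟨ξ, hξ, rfl⟩ := hW'mem y hy
    exact (hD1 ξ hξ.1).2.2.2
  have hW'ne : W'.Nonempty := by
    obtain ⟨ξ, hξ, rfl⟩ := hO' hz
    have h1 := (hP ξ (hD1 ξ hξ).2.1).1
    refine ⟨ψ.symm (ψ x₀ + ξ), ?_, ?_⟩
    · rw [← extChartAt_source (𝓡 n)]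
      exact ψ.map_target h1
    · change ψ (ψ.symm (ψ x₀ + ξ)) - ψ x₀ ∈ D ∩ Φ ⁻¹' O'
      rw [ψ.right_inv h1, add_sub_cancel_left]
      exact ⟨hξ, hz⟩
  obtain ⟨y, hy, hrank⟩ := hD W' hW'W hW'open hW'ne
  obtain ⟨ξ, hξ, rfl⟩ := hW'mem y hy
  obtain ⟨-, hξr, hξ1, -⟩ := hD1 ξ hξ.1
  obtain ⟨γ, hγ⟩ := (hP ξ hξr).2
  exact ⟨φ ξ, hξ.2, hγ.exists_wedge_mem_holAlg hrank hξ1⟩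

end HolonomyAlgebra

/-! ### From infinitesimal transitivity to open orbits, and independence of the base point. -/

section OpenOrbit

/-- The product of one-parameter families lying in a monoid `H`. -/
theorem exists_product_family {R : Type*} [NormedRing R] [NormedAlgebra ℝ R] {H : Set R}
    (h1 : 1 ∈ H) (hmul : ∀ a ∈ H, ∀ b ∈ H, a * b ∈ H) {ι : Type*} [Fintype ι] {c : ι → ℝ → R}
    {A : ι → R} (hc : ∀ i t, c i t ∈ H) (hc0 : ∀ i, c i 0 = 1)
    (hd : ∀ i, HasStrictDerivAt (c i) (A i) 0) (s : Finset ι) :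
    ∃ Ψ : (ι → ℝ) → R, (∀ t, Ψ t ∈ H) ∧ Ψ 0 = 1 ∧ HasStrictFDerivAt Ψ
      (∑ i ∈ s, (ContinuousLinearMap.proj i : (ι → ℝ) →L[ℝ] ℝ).smulRight (A i)) 0 := by
  classical
  induction s using Finset.induction_on with
  | empty => exact ⟨fun _ => 1, fun _ => h1, rfl, by simpa using hasStrictFDerivAt_const _ _⟩
  | insert i s hi ih =>
    obtain ⟨Ψ, hΨ, hΨ0, hΨd⟩ := ih
    refine ⟨fun t => c i (t i) * Ψ t, fun t => hmul _ (hc i _) _ (hΨ t), by simp [hc0, hΨ0], ?_⟩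
    have h2 : HasStrictFDerivAt (fun t : ι → ℝ => c i (t i))
        ((ContinuousLinearMap.proj i : (ι → ℝ) →L[ℝ] ℝ).smulRight (A i)) 0 := by
      have h3 := (hd i).hasStrictFDerivAt.comp (0 : ι → ℝ)
        (ContinuousLinearMap.proj i : (ι → ℝ) →L[ℝ] ℝ).hasStrictFDerivAt
      refine h3.congr_fderiv ?_
      refine ContinuousLinearMap.ext fun t => ?_
      simp
    refine (h2.mul' hΨd).congr_fderiv ?_
    refine ContinuousLinearMap.ext fun t => ?_
    simp [hc0, hΨ0, Finset.sum_insert hi, add_comm]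

variable {n p q : ℕ} {M : Type*} [TopologicalSpace M] [ChartedSpace (E n) M]
  [IsManifold (𝓡 n) ∞ M]

/-- The projection `(α, Y, β) ↦ (α, Y)`. -/
def dropLast (n : ℕ) : Tractor n →L[ℝ] ℝ × E n :=
  (ContinuousLinearMap.fst ℝ ℝ (E n × ℝ)).prod
    ((ContinuousLinearMap.fst ℝ (E n) ℝ).comp (ContinuousLinearMap.snd ℝ ℝ (E n × ℝ)))

theorem dropLast_apply (τ : Tractor n) : dropLast n τ = (τ.1, τ.2.1) := rfl

theorem eq_of_dropLast_eq {b : Bil n} {u v : Tractor n} (hu : tractorBil b u u = 0)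
    (hv : tractorBil b v v = 0) (h0 : u.1 ≠ 0) (h : dropLast n u = dropLast n v) : u = v := by
  obtain ⟨a, Y, c⟩ := u
  obtain ⟨a', Y', c'⟩ := v
  simp only [dropLast_apply, Prod.mk.injEq] at h
  obtain ⟨rfl, rfl⟩ := h
  rw [tractorBil_apply] at hu hv
  dsimp only at hu hv h0
  have : a * (c - c') = 0 := by linarith
  rw [sub_eq_zero.1 ((mul_eq_zero.1 this).resolve_left h0)]

/-- A product of holonomy curves, applied to `v` and projected to `(α, Y)`, has surjective
derivative and so covers a neighbourhood. A null vector with `α ≠ 0` is determined by `(α, Y)`,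
which upgrades this to a neighbourhood in the cone. -/
theorem eventually_mem_orbit (g : Metric n p q M) (x : M) {y : E n}
    (h : ∀ u, tractorBil (metricAt g x) (nullVec (metricAt g x) y) u = 0 →
      ∃ A ∈ holAlg g x, A (nullVec (metricAt g x) y) = u) :
    ∀ᶠ u in 𝓝 (nullVec (metricAt g x) y), tractorMetric g x u u = 0 →
      ∃ A ∈ holonomy0 g x, A (nullVec (metricAt g x) y) = u := by
  set b := metricAt g x with hb
  set v := nullVec b y with hv
  let S : Set (Tractor n →L[ℝ] Tractor n) := {A | ∃ c : ℝ → (Tractor n →L[ℝ] Tractor n),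
    ContDiff ℝ ∞ c ∧ (∀ t, c t ∈ holonomy0 g x) ∧ c 0 = ContinuousLinearMap.id ℝ (Tractor n) ∧
      HasDerivAt c A 0}
  let L : (Tractor n →L[ℝ] Tractor n) →L[ℝ] ℝ × E n :=
    (dropLast n).comp (ContinuousLinearMap.apply ℝ (Tractor n) v)
  have hL : ∀ A, L A = dropLast n (A v) := fun _ => rfl
  have hspan : ⊤ ≤ Submodule.span ℝ (L '' S) := by
    rintro ⟨a, Y⟩ -
    -- The last entry is the unique one making the vector orthogonal to `v`; thus `v^⊥` projects
    -- onto all pairs `(a, Y)`.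
    obtain ⟨A, hA, hAv⟩ := h (a, Y, a * (1 / 2 * b y y) - b y Y) (by
      simp only [tractorBil_apply, hv, nullVec]
      ring)
    have h1 : (a, Y) = L A := by rw [hL, hAv, dropLast_apply]
    rw [h1]
    have h2 := Submodule.mem_map_of_mem (f := (L : _ →ₗ[ℝ] ℝ × E n)) hA
    rwa [holAlg, Submodule.map_span] at h2
  -- `holAlg` is a span, so the basis is drawn from images of actual tangent vectors of curves.
  let B := Module.Basis.ofSpan hspan
  have : Fintype ((linearIndepOn_empty ℝ (id : ℝ × E n → ℝ × E n)).extend (empty_subset (L '' S))) :=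
    Module.Basis.fintypeIndexOfRankLtAleph0 B (Module.rank_lt_aleph0 _ _)
  have hB : ∀ i, B i ∈ L '' S := fun i => Module.Basis.ofSpan_subset hspan ⟨i, rfl⟩
  choose A hAS hAB using hB
  choose c hsm hc hc0 hcA using hAS
  obtain ⟨Ψ, hΨ, hΨ0, hΨd⟩ := exists_product_family (H := holonomy0 g x) (one_mem_holonomy0 g x)
    (fun _ ha _ hb => comp_mem_holonomy0 ha hb) hc hc0
    (fun i => (hsm i).contDiffAt.hasStrictDerivAt' (hcA i) (by simp)) Finset.univ
  have hG : HasStrictFDerivAt (fun t => L (Ψ t)) (L.comp _) 0 := L.hasStrictFDerivAt.comp 0 hΨd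
  have hmap := hG.map_nhds_eq_of_surj (by
    rw [LinearMap.range_eq_top]
    intro z
    refine ⟨B.equivFun z, ?_⟩
    conv_rhs => rw [← B.sum_equivFun z]
    simp [hAB])
  have hL0 : L (Ψ 0) = dropLast n v := by rw [hΨ0]; rfl
  rw [hL0] at hmap
  have h1 : ∀ᶠ z in 𝓝 (dropLast n v), ∃ t, L (Ψ t) = z := by
    rw [← hmap, Filter.eventually_map]
    exact Filter.Eventually.of_forall fun t => ⟨t, rfl⟩
  have h2 : ∀ᶠ u in 𝓝 v, u.1 ≠ 0 :=
    continuous_fst.continuousAt.eventually_ne (by simp [hv, nullVec])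
  filter_upwards [(dropLast n).continuous.continuousAt.eventually h1, h2] with u ⟨t, ht⟩ hu1 hu
  refine ⟨Ψ t, hΨ t, (eq_of_dropLast_eq (b := b) hu ?_ hu1 ht.symm).symm⟩
  exact (isometry_of_mem_holonomy0 (hΨ t) v v).trans (tractorBil_nullVec_self y)

/-- Some orbit of `Hol⁰_x` in the null cone of `𝒯_x` is open. -/
def HasOpenNullOrbit (g : Metric n p q M) (x : M) : Prop :=
  ∃ v : Tractor n, v ≠ 0 ∧ tractorMetric g x v v = 0 ∧ ∀ A₀ ∈ holonomy0 g x,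
    ∀ᶠ u in 𝓝 (A₀ v), tractorMetric g x u u = 0 → ∃ A ∈ holonomy0 g x, A v = u

/-- Openness at `v` moves to `A₀ v` because `A₀` is an invertible isometry belonging to the group.
-/
theorem hasOpenNullOrbit_of_tangent (g : Metric n p q M) (x : M) {y : E n}
    (h : ∀ u, tractorBil (metricAt g x) (nullVec (metricAt g x) y) u = 0 →
      ∃ A ∈ holAlg g x, A (nullVec (metricAt g x) y) = u) : HasOpenNullOrbit g x := by
  refine ⟨nullVec (metricAt g x) y, fun h0 => ?_, tractorBil_nullVec_self y, fun A₀ hA₀ => ?_⟩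
  · have h1 := congrArg Prod.fst h0
    simp [nullVec] at h1
  · have hinj : Function.Injective (A₀ : Tractor n →ₗ[ℝ] Tractor n) :=
      injective_of_isometry g (isometry_of_mem_holonomy0 hA₀)
    let e := (LinearEquiv.ofInjectiveEndo _ hinj).toContinuousLinearEquiv
    have he : ∀ u, e u = A₀ u := fun _ => rfl
    have h1 : Filter.Tendsto e.symm (𝓝 (A₀ (nullVec (metricAt g x) y)))
        (𝓝 (nullVec (metricAt g x) y)) :=
      e.symm.continuous.tendsto' _ _ (by rw [← he, e.symm_apply_apply])
    filter_upwards [h1.eventually (eventually_mem_orbit g x h)] with u hu hu0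
    have h2 : A₀ (e.symm u) = u := e.apply_symm_apply u
    obtain ⟨A, hA, hAu⟩ := hu (by rw [← isometry_of_mem_holonomy0 hA₀, h2, hu0])
    exact ⟨A₀ ∘L A, comp_mem_holonomy0 hA₀ hA, by
      rw [ContinuousLinearMap.comp_apply, hAu, h2]⟩

theorem IsTransport.hasOpenNullOrbit {g : Metric n p q M} {x y : M} {γ : Path x y}
    {P : Tractor n ≃L[ℝ] Tractor n} (h : IsTransport g γ P) (hy : HasOpenNullOrbit g y) :
    HasOpenNullOrbit g x := by
  obtain ⟨v, hv0, hv, hopen⟩ := hy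
  have hiso : ∀ u w, tractorMetric g y (P u) (P w) = tractorMetric g x u w := h.isometry
  refine ⟨P.symm v, by simpa using hv0, by rw [← hiso, P.apply_symm_apply, hv], fun A₀ hA₀ => ?_⟩
  have h1 := hopen _ (h.symm.conj_mem_holonomy0 hA₀)
  have h2 : Filter.Tendsto P (𝓝 (A₀ (P.symm v))) (𝓝 (P (A₀ (P.symm v)))) :=
    P.continuous.continuousAt
  filter_upwards [h2.eventually h1] with u hu hu0
  obtain ⟨A, hA, hAu⟩ := hu (by rw [hiso, hu0])
  refine ⟨_, h.conj_mem_holonomy0 hA, ?_⟩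
  simp [hAu]

theorem eventually_hasOpenNullOrbit_iff (g : Metric n p q M) (x₀ : M) :
    ∀ᶠ y in 𝓝 x₀, HasOpenNullOrbit g y ↔ HasOpenNullOrbit g x₀ := by
  obtain ⟨r, hr, P, hP, -⟩ := exists_local_transport g x₀
  have h1 : ∀ᶠ y in 𝓝 x₀, ‖extChartAt (𝓡 n) x₀ y - extChartAt (𝓡 n) x₀ x₀‖ < r := by
    have h2 : ContinuousAt
        (fun y => ‖extChartAt (𝓡 n) x₀ y - extChartAt (𝓡 n) x₀ x₀‖) x₀ :=
      ((continuousAt_extChartAt x₀).sub continuousAt_const).norm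
    exact h2.eventually (gt_mem_nhds (by simpa using hr))
  filter_upwards [h1, extChartAt_source_mem_nhds (I := 𝓡 n) x₀] with y hy hys
  obtain ⟨γ, hγ⟩ := (hP _ hy).2
  have hyy : (extChartAt (𝓡 n) x₀).symm (extChartAt (𝓡 n) x₀ x₀ +
      (extChartAt (𝓡 n) x₀ y - extChartAt (𝓡 n) x₀ x₀)) = y := by
    rw [add_sub_cancel]
    exact (extChartAt (𝓡 n) x₀).left_inv hys
  constructor
  · intro h
    exact hγ.hasOpenNullOrbit (by rwa [hyy])
  · intro h
    have h2 := IsTransport.hasOpenNullOrbit (P := (P _).symm) hγ.symm h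
    rwa [hyy] at h2

/-- Local transport makes the property locally constant in the base point. -/
theorem hasOpenNullOrbit_of_exists [PreconnectedSpace M] {g : Metric n p q M} {x₀ : M}
    (h : HasOpenNullOrbit g x₀) (x : M) : HasOpenNullOrbit g x := by
  have h1 : IsLocallyConstant (HasOpenNullOrbit g) := by
    rw [IsLocallyConstant.iff_eventually_eq]
    intro z
    filter_upwards [eventually_hasOpenNullOrbit_iff g z] with y hy
    exact propext hy
  exact (h1.apply_eq_of_preconnectedSpace x x₀).symm ▸ h

end OpenOrbit

/-! ### Tractor frames and the model light cone. -/

section Frames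

variable {n p q : ℕ} {M : Type*} [TopologicalSpace M] [ChartedSpace (E n) M]
  [IsManifold (𝓡 n) ∞ M]

theorem eq_zero_of_pseudoInner {v : PseudoSpace p q} (h : ∀ w, pseudoInner v w = 0) : v = 0 := by
  funext k
  have h1 := h (Pi.single k 1)
  rcases k with i | j
  · simpa [pseudoInner, Pi.single_apply] using h1
  · simpa [pseudoInner, Pi.single_apply] using h1

theorem exists_isTractorFrame (g : Metric n p q M) (x : M) :
    ∃ ψ : PseudoSpace p q ≃ₗ[ℝ] Tractor n, IsTractorFrame g x ψ := by
  obtain ⟨e', he'⟩ := g.signature x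
  let e : Module.Basis (Fin p ⊕ Fin q) ℝ (E n) := e'
  have he : ∀ i j, metricAt g x (e i) (e j) =
      if i = j then Sum.elim (fun _ => (-1 : ℝ)) (fun _ => 1) i else 0 := he'
  let Y : PseudoSpace p q →ₗ[ℝ] E n :=
    e.equivFun.symm.toLinearMap ∘ₗ LinearMap.funLeft ℝ ℝ (Sum.map Fin.succ Fin.succ)
  have hY : ∀ v, Y v = ∑ i : Fin p, v (Sum.inl i.succ) • e (Sum.inl i) +
      ∑ j : Fin q, v (Sum.inr j.succ) • e (Sum.inr j) := by
    intro v
    simp [Y, Module.Basis.equivFun_symm_apply, LinearMap.funLeft_apply]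
  have hYY : ∀ v w, metricAt g x (Y v) (Y w) = -∑ i : Fin p, v (Sum.inl i.succ) * w (Sum.inl i.succ) +
      ∑ j : Fin q, v (Sum.inr j.succ) * w (Sum.inr j.succ) := by
    intro v w
    rw [hY, hY]
    simp [he, sum_apply]
  let π : Fin (p + 1) ⊕ Fin (q + 1) → PseudoSpace p q →ₗ[ℝ] ℝ := fun k => LinearMap.proj k
  -- With `l`, `r` the extra negative and positive coordinates, `α = r - l` and `β = (l + r) / 2`
  -- give `2αβ = r² - l²`.
  let f : PseudoSpace p q →ₗ[ℝ] Tractor n :=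
    (π (Sum.inr 0) - π (Sum.inl 0)).prod
      (Y.prod ((1 / 2 : ℝ) • (π (Sum.inl 0) + π (Sum.inr 0))))
  have hf : ∀ v, f v = (v (Sum.inr 0) - v (Sum.inl 0), Y v,
      (1 / 2 : ℝ) * (v (Sum.inl 0) + v (Sum.inr 0))) := fun v => rfl
  have hiso : ∀ v w, tractorMetric g x (f v) (f w) = pseudoInner v w := by
    intro v w
    rw [tractorMetric_eq, tractorBil_apply, hf, hf]
    dsimp only
    rw [hYY, pseudoInner, Fin.sum_univ_succ, Fin.sum_univ_succ]
    ring
  have hinj : Function.Injective f := by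
    rw [injective_iff_map_eq_zero]
    intro v hv
    refine eq_zero_of_pseudoInner fun w => ?_
    rw [← hiso, hv, tractorMetric_eq, map_zero, zero_apply]
  have hdim : Module.finrank ℝ (PseudoSpace p q) = Module.finrank ℝ (Tractor n) := by
    have h1 := Module.finrank_eq_card_basis e
    simp only [finrank_euclideanSpace_fin, Fintype.card_sum, Fintype.card_fin] at h1
    simp [h1]
    omega
  exact ⟨f.linearEquivOfInjective hinj hdim, hiso⟩

theorem hasOpenOrbit_of_forall {g : Metric n p q M} (h : ∀ x, HasOpenNullOrbit g x) :
    HasOpenOrbit g := by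
  intro x
  refine ⟨exists_isTractorFrame g x, fun ψ hψ => ?_⟩
  obtain ⟨v, hv0, hv, hopen⟩ := h x
  refine ⟨ψ.symm v, ⟨by simpa using hv0, by rw [← hψ, ψ.apply_symm_apply, hv]⟩, ?_⟩
  rw [isOpen_iff_mem_nhds]
  rintro w ⟨A₀, hA₀, hw⟩
  rw [ψ.apply_symm_apply] at hw
  have hψc : Continuous ψ := ψ.toLinearMap.continuous_of_finiteDimensional
  have h1 : Filter.Tendsto (fun w' : nullCone p q => ψ w') (𝓝 w) (𝓝 (A₀ v)) :=
    (hψc.comp continuous_subtype_val).tendsto' _ _ (by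
      rw [Function.comp_apply, ← hw, ψ.apply_symm_apply])
  filter_upwards [h1.eventually (hopen A₀ hA₀)] with w' hw'
  obtain ⟨A, hA, hAw⟩ := hw' (by rw [hψ, w'.2.2])
  exact ⟨A, hA, by rw [ψ.apply_symm_apply, hAw, ψ.symm_apply_apply]⟩

end Frames

end ConfHol

end

theorem mainTheorem8 {n p q : ℕ} (hn : 3 ≤ n) (hn_even : Even n)
    {M : Type*} [TopologicalSpace M] [T2Space M] [SecondCountableTopology M] [ConnectedSpace M]
    [ChartedSpace (ConfHol.E n) M] [IsManifold (𝓡 n) ∞ M]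
    (c : ConfHol.ConformalStructure n p q M) (g : ConfHol.Metric n p q M) (hg : g ∈ c) :
    (∃ U : Set M, IsOpen U ∧ Dense U ∧ ∀ x ∈ U, ConfHol.rankE g x ≤ 1) ∨
      ConfHol.HasOpenOrbit g := by
  by_cases hd : Dense (interior {x | ConfHol.rankE g x ≤ 1})
  · exact Or.inl ⟨_, isOpen_interior, hd, fun x hx =>
      interior_subset (s := {x | ConfHol.rankE g x ≤ 1}) hx⟩
  · right
    obtain ⟨x₀, hx₀⟩ : ∃ x₀, x₀ ∉ closure (interior {x | ConfHol.rankE g x ≤ 1}) := by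
      simpa [Dense] using hd
    obtain ⟨O, hO, hne, hO'⟩ := ConfHol.exists_open_forall_wedge_mem_holAlg g
      isClosed_closure.isOpen_compl hx₀ fun W' hW' hW'open ⟨z, hz⟩ => by
        -- An open set on which `ℰ` vanishes would lie in the interior whose closure avoids `W'`.
        by_contra! hlt
        have hsub : W' ⊆ interior {x | ConfHol.rankE g x ≤ 1} :=
          interior_maximal (fun y hy => (hlt y hy).le) hW'open
        exact hW' hz (subset_closure (hsub hz))
    obtain ⟨y, -, hy⟩ := ConfHol.exists_nullVec_orbit_tangent hn (ConfHol.metricAt_symm g x₀)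
      (ConfHol.metricAt_nondeg g x₀) (ConfHol.holAlg g x₀) hO hne hO'
    exact ConfHol.hasOpenOrbit_of_forall fun x =>
      ConfHol.hasOpenNullOrbit_of_exists (ConfHol.hasOpenNullOrbit_of_tangent g x₀ hy) x
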